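/- **Setting.** Let $\mathrm{Sp}(2)$ act on $\mathbb{S}^7\subset\mathbb{H}^2$ by left multiplication, so that $\mathbb{S}^7=\mathrm{Sp}(2)/\mathrm{Sp}(1)$, where $\mathrm{Sp}(1)=\{\mathrm{diag}(q,1)\}$ is the stabiliser of $o=(0,1)$. Let $\mathfrak p\subset\mathfrak{sp}(2)$ be spanned by $e_1=\begin{pmatrix}0&0\\0&i\end{pmatrix}$, $e_2=\begin{pmatrix}0&0\\0&j\end{pmatrix}$, $e_3=\begin{pmatrix}0&0\\0&k\end{pmatrix}$, $e_4=\tfrac1{\sqrt2}\begin{pmatrix}0&i\\i&0\end{pmatrix}$, $e_5=\tfrac1{\sqrt2}\begin{pmatrix}0&j\\j&0\end{pmatrix}$, $e_6=\tfrac1{\sqrt2}\begin{pmatrix}0&k\\k&0\end{pmatrix}$, $e_7=\tfrac1{\sqrt2}\begin{pmatrix}0&1\\-1&0\end{pmatrix}$, identified with $T_o\mathbb{S}^7$ by $X\mapsto Xo$, with dual basis $e^1,\dots,e^7$, and put $\omega_1=e^{47}+e^{56}$, $\omega_2=e^{46}-e^{57}$, $\omega_3=e^{45}+e^{67}$. Orient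 $\mathbb{S}^7$ by $(e_1,\dots,e_7)$ at $o$. For $r>0$ and $D\in\mathrm{SO}(3)$ let $\Phi(r,D)$ be the $\mathrm{Sp}(2)$-invariant $3$-form on $\mathbb{S}^7$ with value $$r^3e^{123}+\sum_{i,j=1}^3(D^{-1})_{ij}\,e^j\wedge\omega_i$$ at $o$, let $\mathcal B_r=\Phi(\{r\}\times\mathrm{SO}(3))$, and let $g_r$ be the $\mathrm{Sp}(2)$-invariant metric with value $r^2\sum_{l\le3}(e^l)^2+r^{-1}\sum_{l\ge4}(e^l)^2$ at $o$. For a unit quaternion $h=h_0+h_1i+h_2j+h_3k\in\mathbb{S}^3$ let $\varphi_{(r,h)}=\Phi(r,\Upsilon(h)^{-1})$, where $\Upsilon:\mathbb{S}^3\to\mathrm{SO}(3)$, $\Upsilon(h)x=hx\bar h$ on $\mathrm{Im}\,\mathbb{H}$, is the double cover. For a $\mathrm{G}_2$-structure $\varphi$ with metric $g_\varphi$ write $\psi=*_\varphi\varphi$. It is called *coclosed* if $d\psi=0$ (torsion forms $\tau_1=\tau_2=0$); *nearly parallel* if $d\varphi=\tau_0\psi$ with a constant $\tau_0\ne0$ and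 $d\psi=0$; *locally conformally coclosed* if it belongs to the torsion class $\tau_2=0$, that is $d\psi=4\tau_1\wedge\psi$ for a $1$-form $\tau_1$ (not required to be closed); *purely coclosed* if $d\psi=0$ and $\varphi\wedge d\varphi=0$ ($\tau_0=\tau_1=\tau_2=0$). **Theorem.** For every $r>0$, $\mathcal B_r$ is exactly the set of $\mathrm{Sp}(2)$-invariant $\mathrm{G}_2$-structures on $\mathbb{S}^7$ that induce the metric $g_r$ and the given orientation; it is the full invariant isometric class of each of its elements, and $\mathcal B_r\cap\mathcal B_s=\emptyset$ for $r\ne s$. The map $h\mapsto\varphi_{(r,h)}$ is a smooth immersion of $\mathbb{S}^3$ that induces a homeomorphism $\mathbb{RP}^3=\mathbb{S}^3/\{\pm1\}\to\mathcal B_r$. In terms of the equator $\mathbb{RP}^2=\{h_2=0\}/\{\pm1\}$ and the poles $\mathrm{NS}=[(0,0,\pm1,0)]$: 1. $\varphi_{(r,h)}$ is coclosed if and only if $h$ lies on the equator or is a pole. 2. $\varphi_{(r,h)}$ is nearly parallel if and only if either $r^3=2$ and $h$ lies on the equator, or $r^3=2/5$ and $h$ is a pole. In the first case $g_r$ is homothetic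 to the round metric of $\mathbb{S}^7$, in the second case to the squashed metric (the round metric with the fibres of the Hopf fibration $\mathbb{S}^7\to\mathbb{S}^4$ shrunk in length by the factor $1/\sqrt5$). 3. All elements of $\mathcal B_1$ are locally conformally coclosed, and for $r\neq1$ the only locally conformally coclosed elements of $\mathcal B_r$ are the coclosed ones. In other words, $\varphi_{(r,h)}$ is locally conformally coclosed if and only if $r=1$ or $\varphi_{(r,h)}$ is coclosed. Furthermore, no element of $\mathcal B_r$ is purely coclosed. -/

import Mathlib

open scoped Quaternion Manifold ContDiff RealInnerProductSpace

noncomputable section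

namespace G2Sphere

/-! ### The homogeneous sphere `S⁷ = Sp(2)/Sp(1)` -/

/-- The real Euclidean space `ℍ² = ℝ⁸`. -/
abbrev HH : Type := EuclideanSpace ℍ[ℝ] (Fin 2)

/-- The sphere `S⁷`, the unit sphere of `ℍ²`. The tangent space at `x` is the real orthogonal
complement of `x`. -/
abbrev S7 : Type := Metric.sphere (0 : HH) 1

/-- `Sp(2)`: the quaternionic `2 × 2` matrices `A` with `A* A = A A* = 1`. -/
abbrev Sp2 : Type := unitary (Matrix (Fin 2) (Fin 2) ℍ[ℝ])

/-- The real-linear action of a quaternionic matrix on `ℍ²` by left multiplication. -/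
def act (A : Matrix (Fin 2) (Fin 2) ℍ[ℝ]) : HH →L[ℝ] HH :=
  LinearMap.toContinuousLinearMap
    { toFun := fun v => WithLp.toLp 2 (A.mulVec v.ofLp)
      map_add' := fun v w => by ext1 a; simp [Matrix.mulVec_add]
      map_smul' := fun c v => by ext1 a; simp [Matrix.mulVec_smul] }

/-- The base point `o = (0, 1)`. Its stabiliser in `Sp(2)` is `Sp(1) = {diag(h, 1)}`. -/
def o : S7 :=
  ⟨WithLp.toLp 2 ![0, 1], by
    rw [mem_sphere_zero_iff_norm, ← sq_eq_sq₀ (norm_nonneg _) zero_le_one,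
      PiLp.norm_sq_eq_of_L2]
    simp⟩

/-- `Sp(2)` acts transitively on `S⁷`. -/
theorem exists_act_eq (x : S7) : ∃ A : Sp2, act A o = (x : HH) := by
  obtain ⟨x, hx⟩ := x
  rw [mem_sphere_zero_iff_norm] at hx
  have hn : ‖x 0‖ ^ 2 + ‖x 1‖ ^ 2 = 1 := by
    have := PiLp.norm_sq_eq_of_L2 (fun _ : Fin 2 => ℍ[ℝ]) x
    rw [hx, Fin.sum_univ_two] at this
    linarith
  have key : ∀ M : Matrix (Fin 2) (Fin 2) ℍ[ℝ], M 0 1 = x 0 → M 1 1 = x 1 →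
      star M * M = 1 → M * star M = 1 → ∃ A : Sp2, act A o = x := by
    intro M h0 h1 hM hM'
    refine ⟨⟨M, hM, hM'⟩, ?_⟩
    ext1 a
    fin_cases a <;> simp [act, o, h0, h1]
  have hsm (q : ℍ[ℝ]) : star q * q = ‖q‖ ^ 2 • (1 : ℍ[ℝ]) := by
    rw [Quaternion.star_mul_self, Quaternion.normSq_eq_norm_mul_self, ← sq,
      ← Quaternion.coe_mul_eq_smul, mul_one]
  have hms (q : ℍ[ℝ]) : q * star q = ‖q‖ ^ 2 • (1 : ℍ[ℝ]) := by
    rw [Quaternion.self_mul_star, Quaternion.normSq_eq_norm_mul_self, ← sq,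
      ← Quaternion.coe_mul_eq_smul, mul_one]
  by_cases h : x 1 = 0
  · have h1 : ‖x 0‖ ^ 2 = 1 := by simpa [h] using hn
    refine key !![0, x 0; 1, 0] rfl h.symm ?_ ?_ <;>
    · refine Matrix.ext fun a b => ?_
      fin_cases a <;> fin_cases b <;> simp [Matrix.mul_apply, hsm, hms, h1]
  · obtain ⟨c, hc⟩ : ∃ c, c = ‖x 1‖ := ⟨_, rfl⟩
    have hc0 : c ≠ 0 := by simpa [hc] using h
    rw [← hc] at hn
    have h0 : ‖x 0‖ ^ 2 = 1 - c ^ 2 := by linarith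
    generalize x 0 = p at *
    generalize x 1 = q at *
    have a1 := hsm p
    have a2 := hms p
    have a3 := hsm q
    have a4 := hms q
    rw [h0] at a1 a2
    rw [← hc] at a3 a4
    have b1 : p * star q * q = c ^ 2 • p := by rw [mul_assoc, a3]; simp
    have b2 : star q * (q * star p) = c ^ 2 • star p := by rw [← mul_assoc, a3]; simp
    have b3 : p * star q * (q * star p) = (c ^ 2 * (1 - c ^ 2)) • (1 : ℍ[ℝ]) := by
      rw [← mul_assoc, b1, smul_mul_assoc, a2, smul_smul]
    have b4 : q * star p * (p * star q) = (c ^ 2 * (1 - c ^ 2)) • (1 : ℍ[ℝ]) := by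
      rw [mul_assoc, ← mul_assoc (star p), a1, smul_mul_assoc, one_mul, mul_smul_comm, a4,
        smul_smul, mul_comm]
    refine key !![c • 1, p; -(c⁻¹ • (q * star p)), q] rfl rfl ?_ ?_ <;>
    · refine Matrix.ext fun a b => ?_
      fin_cases a <;> fin_cases b <;>
        simp [Matrix.mul_apply, a1, a2, a3, a4, b1, b2, b3, b4, smul_smul, ← add_smul] <;>
        field_simp <;> simp

/-- An element of `Sp(2)` that takes the base point to `x`. -/
def transport (x : S7) : Sp2 := Classical.choose (exists_act_eq x)

/-- The quaternion unit `i`. -/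
def qI : ℍ[ℝ] := ⟨0, 1, 0, 0⟩
/-- The quaternion unit `j`. -/
def qJ : ℍ[ℝ] := ⟨0, 0, 1, 0⟩
/-- The quaternion unit `k`. -/
def qK : ℍ[ℝ] := ⟨0, 0, 0, 1⟩

/-- The basis `e₁, …, e₇` (indexed from `0`) of the complement `𝔭` of
`𝔰𝔭(1) = {diag(q, 0) : q ∈ Im ℍ}` in `𝔰𝔭(2)`. -/
def pBasis : Fin 7 → Matrix (Fin 2) (Fin 2) ℍ[ℝ] :=
  ![!![0, 0; 0, qI],
    !![0, 0; 0, qJ],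
    !![0, 0; 0, qK],
    (√2)⁻¹ • !![0, qI; qI, 0],
    (√2)⁻¹ • !![0, qJ; qJ, 0],
    (√2)⁻¹ • !![0, qK; qK, 0],
    (√2)⁻¹ • !![0, 1; -1, 0]]

/-- The basis of `T_o S⁷` that corresponds to `e₁, …, e₇` under `𝔭 ≃ T_o S⁷`, `X ↦ X o`. -/
def eVec (i : Fin 7) : HH := act (pBasis i) o

/-- The dual basis `e¹, …, e⁷` of the `eVec i` (which are orthogonal in `ℍ²`), extended by `0` to
the normal line `ℝ o`. -/
def eDual (i : Fin 7) : HH →L[ℝ] ℝ := (‖eVec i‖ ^ 2)⁻¹ • innerSL ℝ (eVec i)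

/-! ### Differential forms on `S⁷` -/

/-- Sections over `S⁷` of the alternating `k`-forms on `ℍ²`. A `k`-form on `S⁷` is such a section
that is `Tangential`: an alternating form on `T_x S⁷ = xᗮ` is regarded as the alternating form on
`ℍ²` which agrees with it on `xᗮ` and vanishes as soon as one argument is `x`. -/
abbrev Form (k : ℕ) : Type := S7 → HH [⋀^Fin k]→L[ℝ] ℝ

/-- The section is a form on `S⁷`: it vanishes when the normal vector is inserted. -/
def Tangential {k : ℕ} (α : Form k) : Prop :=
  ∀ (x : S7) (v : Fin k → HH), (∃ i, v i = x) → α x v = 0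

/-- The radial projection `ℍ² ∖ {0} → S⁷`. -/
def radial (y : HH) (hy : y ≠ 0) : S7 :=
  ⟨‖y‖⁻¹ • y, by
    rw [mem_sphere_zero_iff_norm, norm_smul, norm_inv, norm_norm,
      inv_mul_cancel₀ (norm_ne_zero_iff.2 hy)]⟩

/-- The pullback of a form on `S⁷` to `ℍ² ∖ {0}` under the radial projection `y ↦ y / ‖y‖`,
whose derivative at `y` is `‖y‖⁻¹` times the orthogonal projection to `yᗮ`. -/
def radialExt {k : ℕ} (α : Form k) (y : HH) : HH [⋀^Fin k]→L[ℝ] ℝ :=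
  open Classical in
  if hy : y = 0 then 0 else (‖y‖⁻¹) ^ k • α (radial y hy)

/-- Smooth differential forms on `S⁷`. -/
structure IsSmoothForm {k : ℕ} (α : Form k) : Prop where
  tangential : Tangential α
  smooth : ContDiffOn ℝ ∞ (radialExt α) {0}ᶜ

/-- The exterior derivative on `S⁷`: the exterior derivative of the radial pullback, restricted
to `S⁷`. -/
def d {k : ℕ} (α : Form k) : Form (k + 1) := fun x => extDeriv (radialExt α) x

/-- The value of the wedge product of two alternating forms. -/
def wedge {k l : ℕ} (α : HH [⋀^Fin k]→L[ℝ] ℝ) (β : HH [⋀^Fin l]→L[ℝ] ℝ)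
    (v : Fin (k + l) → HH) : ℝ :=
  ((k.factorial : ℝ) * l.factorial)⁻¹ *
    ∑ σ : Equiv.Perm (Fin (k + l)), (Equiv.Perm.sign σ : ℝ) *
      (α (fun i => v (σ (Fin.castAdd l i))) * β (fun j => v (σ (Fin.natAdd k j))))

/-- Invariance of a form under `Sp(2)`. -/
def Invariant {k : ℕ} (α : Form k) : Prop :=
  ∀ (A : Sp2) (x y : S7), (y : HH) = act A x →
    ∀ v : Fin k → HH, α y (fun i => act A (v i)) = α x v

/-- The `Sp(2)`-invariant form on `S⁷` with a given `Sp(1)`-invariant value at `o`. -/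
def invForm {k : ℕ} (α : HH [⋀^Fin k]→L[ℝ] ℝ) : Form k :=
  fun x => α.compContinuousLinearMap (act ((transport x)⁻¹ : Sp2))

/-! ### The invariant `G₂`-structures `Φ(a, D)` and metrics `g_r` -/

/-- `e^{i₁ … i_k} = e^{i₁} ∧ … ∧ e^{i_k}` on `𝔭 ≃ T_o S⁷`. -/
def eForm {k : ℕ} (i : Fin k → Fin 7) : HH [⋀^Fin k]→L[ℝ] ℝ :=
  ContinuousMultilinearMap.alternatization
    ((ContinuousMultilinearMap.mkPiAlgebra ℝ (Fin k) ℝ).compContinuousLinearMap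
      fun a => eDual (i a))

/-- `e^j ∧ ω_i` for `ω₁ = e⁴⁷ + e⁵⁶`, `ω₂ = e⁴⁶ - e⁵⁷`, `ω₃ = e⁴⁵ + e⁶⁷`
(all indices shifted down by one). -/
def eOmega (j : Fin 7) : Fin 3 → HH [⋀^Fin 3]→L[ℝ] ℝ :=
  ![eForm ![j, 3, 6] + eForm ![j, 4, 5],
    eForm ![j, 3, 5] - eForm ![j, 4, 6],
    eForm ![j, 3, 4] + eForm ![j, 5, 6]]

/-- The `3`-form `a³ e¹²³ + ∑ᵢⱼ (D⁻¹)ᵢⱼ eʲ ∧ ωᵢ` on `𝔭 ≃ T_o S⁷`. -/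
def PhiAt (a : ℝ) (D : Matrix (Fin 3) (Fin 3) ℝ) : HH [⋀^Fin 3]→L[ℝ] ℝ :=
  a ^ 3 • eForm ![0, 1, 2] + ∑ i : Fin 3, ∑ j : Fin 3, D⁻¹ i j • eOmega (Fin.castAdd 4 j) i

/-- The `Sp(2)`-invariant `3`-form `Φ(a, D)` on `S⁷`. -/
def Phi (a : ℝ) (D : Matrix (Fin 3) (Fin 3) ℝ) : Form 3 := invForm (PhiAt a D)

/-- The family `B_r = Φ({r} × SO(3))`. -/
def B (r : ℝ) : Set (Form 3) := Phi r '' (Matrix.specialOrthogonalGroup (Fin 3) ℝ : Set _)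

/-- Symmetric `2`-tensors on `S⁷`, with the normal line in the kernel (see `IsMetricOf`). -/
abbrev Tensor2 : Type := S7 → LinearMap.BilinForm ℝ HH

/-- The inner product `r² ((e¹)² + (e²)² + (e³)²) + r⁻¹ ((e⁴)² + ⋯ + (e⁷)²)` on `𝔭 ≃ T_o S⁷`. -/
def gAt (r : ℝ) : LinearMap.BilinForm ℝ HH :=
  ∑ i : Fin 7, (if i < 3 then r ^ 2 else r⁻¹) •
    LinearMap.smulRight (eDual i : HH →ₗ[ℝ] ℝ) (eDual i : HH →ₗ[ℝ] ℝ)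

/-- The `Sp(2)`-invariant metric `g_r` on `S⁷`. -/
def g (r : ℝ) : Tensor2 := fun x =>
  (gAt r).compl₁₂ (act ((transport x)⁻¹ : Sp2) : HH →ₗ[ℝ] HH)
    (act ((transport x)⁻¹ : Sp2) : HH →ₗ[ℝ] HH)

/-! ### `G₂`-structures, their metric and their dual `4`-form -/

/-- The basis `b` of `T_x S⁷` is adapted to `φ`: in it `φ` is the standard `3`-form
`φ₀ = e¹²³ + e¹ ∧ ω₁ + e² ∧ ω₂ + e³ ∧ ω₃`. -/
structure Adapted (φ : Form 3) (x : S7) (b : Fin 7 → HH) : Prop where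
  tangent : ∀ i, ⟪(x : HH), b i⟫ = 0
  linearIndependent : LinearIndependent ℝ b
  coeff : ∀ i j k, φ x ![b i, b j, b k] = PhiAt 1 1 ![eVec i, eVec j, eVec k]

/-- `φ` is a `G₂`-structure on `S⁷`: a smooth `3`-form that is pointwise in the
`GL(7)`-orbit of `φ₀`. -/
structure IsG2Structure (φ : Form 3) : Prop where
  isSmoothForm : IsSmoothForm φ
  exists_adapted : ∀ x, ∃ b, Adapted φ x b

/-- The orientation of the `G₂`-structure `φ` at `o` is that of `e₁, …, e₇`. As `S⁷` is connected,
this fixes the orientation everywhere. -/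
def PositivelyOriented (φ : Form 3) : Prop :=
  ∃ b, Adapted φ o b ∧ ∃ M : Matrix (Fin 7) (Fin 7) ℝ, 0 < M.det ∧ ∀ i, b i = ∑ j, M i j • eVec j

/-- The `Sp(2)`-invariant `G₂`-structures on `S⁷` that induce the fixed orientation. -/
def InvG2 : Set (Form 3) := {φ | IsG2Structure φ ∧ Invariant φ ∧ PositivelyOriented φ}

/-- `m` is the metric induced by the `G₂`-structure `φ`: adapted bases are orthonormal. -/
def IsMetricOf (φ : Form 3) (m : Tensor2) : Prop :=
  ∀ x : S7, (∀ v, m x x v = 0 ∧ m x v x = 0) ∧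
    ∃ b, Adapted φ x b ∧ ∀ i j, m x (b i) (b j) = if i = j then 1 else 0

/-- The invariant isometric class of `φ`: all invariant `G₂`-structures with the same metric
and orientation. -/
def isometricClass (φ : Form 3) : Set (Form 3) :=
  {φ' | φ' ∈ InvG2 ∧ ∃ m, IsMetricOf φ m ∧ IsMetricOf φ' m}

/-- `ψ = ∗φ`, the Hodge dual of `φ` for the metric and the orientation of `φ`, in which adapted
bases are orthonormal and positive. -/
def IsDual (φ : Form 3) (ψ : Form 4) : Prop :=
  Tangential ψ ∧ ∀ x : S7, ∃ b, Adapted φ x b ∧ ∀ σ : Equiv.Perm (Fin 7),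
    ψ x ![b (σ 3), b (σ 4), b (σ 5), b (σ 6)]
      = (Equiv.Perm.sign σ : ℝ) * φ x ![b (σ 0), b (σ 1), b (σ 2)]

/-- Coclosed: `dψ = 0`, that is `τ₁ = 0` and `τ₂ = 0`. -/
def Coclosed (φ : Form 3) : Prop := ∃ ψ, IsDual φ ψ ∧ d ψ = 0

/-- Nearly parallel: `dφ = τ₀ ψ` with a constant `τ₀ ≠ 0`, and `dψ = 0`. -/
def NearlyParallel (φ : Form 3) : Prop :=
  ∃ ψ, IsDual φ ψ ∧ d ψ = 0 ∧ ∃ τ₀ : ℝ, τ₀ ≠ 0 ∧ d φ = τ₀ • ψ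

/-- Locally conformally coclosed, as a torsion class: `dψ = 4 τ₁ ∧ ψ` for a `1`-form `τ₁` on `S⁷`,
that is `τ₂ = 0`. -/
def LocallyConformallyCoclosed (φ : Form 3) : Prop :=
  ∃ ψ, IsDual φ ψ ∧ ∃ τ₁ : Form 1, Tangential τ₁ ∧
    ∀ (x : S7) (v : Fin 5 → HH), d ψ x v = 4 * wedge (τ₁ x) (ψ x) v

/-- Purely coclosed: `dψ = 0` and `φ ∧ dφ = 0`, that is `τ₁ = 0`, `τ₂ = 0` and `τ₀ = 0`. -/
def PurelyCoclosed (φ : Form 3) : Prop :=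
  Coclosed φ ∧ ∀ (x : S7) (v : Fin 7 → HH), wedge (φ x) (d φ x) v = 0

/-! ### The parametrisation of `B_r` by `S³` -/

/-- The sphere `S³` of unit quaternions `h = (h₀, h₁, h₂, h₃)`. -/
abbrev S3 : Type := Metric.sphere (0 : EuclideanSpace ℝ (Fin 4)) 1

instance : Fact (Module.finrank ℝ (EuclideanSpace ℝ (Fin 4)) = 3 + 1) := ⟨by simp⟩

/-- The antipodal equivalence relation on `S³`. -/
def antipodal : Setoid S3 where
  r h h' := h = h' ∨ h = -h'
  iseqv :=
    { refl := fun _ => Or.inl rfl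
      symm := by rintro x y (rfl | rfl) <;> simp
      trans := by rintro x y z (rfl | rfl) (rfl | rfl) <;> simp }

/-- `ℝP³ = S³ / {±1}` with the quotient topology. -/
abbrev RP3 : Type := Quotient antipodal

/-- The double cover `S³ → SO(3)`, `Υ(h) x = h x h̄` on `Im ℍ`. -/
def Upsilon (h : S3) : Matrix (Fin 3) (Fin 3) ℝ :=
  let q : Fin 4 → ℝ := fun i => (h : EuclideanSpace ℝ (Fin 4)) i
  !![q 0 ^ 2 + q 1 ^ 2 - q 2 ^ 2 - q 3 ^ 2, 2 * (q 1 * q 2 - q 0 * q 3),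
      2 * (q 1 * q 3 + q 0 * q 2);
    2 * (q 1 * q 2 + q 0 * q 3), q 0 ^ 2 - q 1 ^ 2 + q 2 ^ 2 - q 3 ^ 2,
      2 * (q 2 * q 3 - q 0 * q 1);
    2 * (q 1 * q 3 - q 0 * q 2), 2 * (q 2 * q 3 + q 0 * q 1),
      q 0 ^ 2 - q 1 ^ 2 - q 2 ^ 2 + q 3 ^ 2]

/-- `φ_{(r, h)} = Φ(r, Υ(h̄)) = Φ(r, Υ(h)⁻¹)`, whose value at `o` is
`r³ e¹²³ + ∑ᵢⱼ Υ(h)ᵢⱼ eʲ ∧ ωᵢ`. -/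
def phi (r : ℝ) (h : S3) : Form 3 := Phi r (Upsilon h)⁻¹

/-- `h` lies on the equator `h₂ = 0`. -/
def OnEquator (h : S3) : Prop := (h : EuclideanSpace ℝ (Fin 4)) 2 = 0

/-- `h` is one of the two poles `(0, 0, ±1, 0)`. -/
def IsPole (h : S3) : Prop :=
  (h : EuclideanSpace ℝ (Fin 4)) = !₂[0, 0, 1, 0] ∨
    (h : EuclideanSpace ℝ (Fin 4)) = !₂[0, 0, -1, 0]

/-! ### The round and the squashed metric -/

/-- `m` is homothetic to the round metric of `S⁷`, which is induced from `ℍ² = ℝ⁸`. -/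
def IsRound (m : Tensor2) : Prop :=
  ∃ c : ℝ, 0 < c ∧ ∀ (x : S7) (v w : HH), ⟪(x : HH), v⟫ = 0 → ⟪(x : HH), w⟫ = 0 →
    m x v w = c * ⟪v, w⟫

/-- The unit vectors `x i`, `x j`, `x k`, which span the tangent space at `x` of the fibre of
the Hopf fibration `S⁷ → S⁴ = ℍP¹`. -/
def hopf (x : S7) (l : Fin 3) : HH :=
  WithLp.toLp 2 fun a => (x : HH) a * (![qI, qJ, qK] : Fin 3 → ℍ[ℝ]) l

/-- `m` is homothetic to the squashed metric of `S⁷`, which is the round metric with the fibres of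
the Hopf fibration shrunk by the factor `1 / √5` in length. -/
def IsSquashed (m : Tensor2) : Prop :=
  ∃ c : ℝ, 0 < c ∧ ∀ (x : S7) (v w : HH), ⟪(x : HH), v⟫ = 0 → ⟪(x : HH), w⟫ = 0 →
    m x v w = c * (⟪v, w⟫ - 4 / 5 * ∑ l : Fin 3, ⟪hopf x l, v⟫ * ⟪hopf x l, w⟫)

end G2Sphere

end

open G2Sphere

/-! An invariant form is determined by its value at `o`. The isotropy group Sp(1) fixes e₁, e₂, e₃
and acts on span(e₄, …, e₇) ≅ ℍ by left multiplication, so the invariant 3-forms are c e¹²³ + ∑ Cᵢⱼ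
eʲ ∧ ωᵢ (`Invariant.eq_formAt`).

Metric classes. A linear map preserving φ₀ lies in SO(7) (`mul_transpose_of_phi0`,
`det_eq_one_of_phi0`), so metric and Hodge dual can be read off in any coframe that makes φ
standard. For C ∈ SO(3) the coframe rCe, se⁴, …, se⁷ with rs² = 1 is such a coframe for c = r³; its
metric is g_r whatever C is. Conversely, the contraction identity φ·φ = g∧g + ψ, written in a
g_r-orthonormal frame, becomes a system of quadratic equations that forces c = r³ and C ∈ SO(3)
(`HasComponents`).

Derivatives. Right multiplication by i, j, k commutes with Sp(2), which gives closed formulas `eta`,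
`om` for the forms eˡ, ωₗ on ℍ² ∖ {0}, hence the structure equations deˡ = εₗωₗ − 2eˡ⁺¹ ∧ eˡ⁺² and
the matching ones for dωₗ, with ε = (−1, 1, −1). Put E = diag(ε). Then dφ sees only the symmetric
part of EC (`d_formAt`), and dψ = 2r ∑ νₘ (eᵐ ∧ e⁴⁵⁶⁷ + εₘ e¹²³ ∧ ωₘ), where ν is the axial vector
of EC (`d_dualForm_apply`).

Torsion. Here C = Υ(h) and E = Υ(j), so EC = Υ(jh) is the rotation of a quaternion with real part
−h₂. Its axial vector vanishes exactly when it is a half-turn (equator) or the identity (poles):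
this is coclosedness. A rotation fixes its axis, so Cν = Eν, and dψ = 4τ₁ ∧ ψ reduces to (r³ − 1)ν =
0. Where ν = 0, put t = tr(EC), which is −1 on the equator and 3 at the poles; then dφ = τ₀ψ means
τ₀ = 2tr² and (r³ + 2t)·1 = (4 + 2tr³)EC, which gives r³ = 2 and r³ = 2/5. There φ ∧ dφ is −4r³ − 20
or 12r³ + 12 times the volume e¹…e⁷, so it never vanishes.

Parameters. The matrix qqᵀ is an affine function of Υ(q), which yields q up to sign, the
surjectivity of Υ, and the injectivity of its derivative. -/

noncomputable section

namespace G2Sphere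

/-! ### Linear algebra of the standard `G₂`-form on `R⁷` -/

section LinearAlgebra

variable {R : Type*} [CommRing R]

/-- The value of `e^{ijk}` on three vectors of `R⁷`. -/
def det3 (i j k : Fin 7) (p q s : Fin 7 → R) : R :=
  p i * (q j * s k - q k * s j) - p j * (q i * s k - q k * s i) + p k * (q i * s j - q j * s i)

/-- The value of `e^{ijkl}` on four vectors of `R⁷`. -/
def det4 (i j k l : Fin 7) (p q s t : Fin 7 → R) : R :=
  p i * det3 j k l q s t - p j * det3 i k l q s t + p k * det3 i j l q s t
    - p l * det3 i j k q s t

/-- The standard `G₂`-form on `R⁷`. -/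
def phi0 (p q s : Fin 7 → R) : R :=
  det3 0 1 2 p q s + det3 0 3 6 p q s + det3 0 4 5 p q s + det3 1 3 5 p q s - det3 1 4 6 p q s
    + det3 2 3 4 p q s + det3 2 5 6 p q s

/-- The Hodge dual of the standard `G₂`-form on `R⁷`. -/
def psi0 (p q s t : Fin 7 → R) : R :=
  det4 3 4 5 6 p q s t + det4 1 2 3 6 p q s t + det4 1 2 4 5 p q s t + det4 2 0 3 5 p q s t
    - det4 2 0 4 6 p q s t + det4 0 1 3 4 p q s t + det4 0 1 5 6 p q s t

/-- The matrix of the `2`-form `ι_u φ₀`. -/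
def crossMat (u : Fin 7 → R) : Matrix (Fin 7) (Fin 7) R :=
  !![0, u 2, -u 1, u 6, u 5, -u 4, -u 3;
    -u 2, 0, u 0, u 5, -u 6, -u 3, u 4;
    u 1, -u 0, 0, u 4, -u 3, u 6, -u 5;
    -u 6, -u 5, -u 4, 0, u 2, u 1, u 0;
    -u 5, u 6, u 3, -u 2, 0, u 0, -u 1;
    u 4, u 3, -u 6, -u 1, -u 0, 0, u 2;
    u 3, -u 4, u 5, -u 0, u 1, -u 2, 0]

theorem dotProduct_crossMat_mulVec (u p q : Fin 7 → R) :
    p ⬝ᵥ (crossMat u).mulVec q = phi0 u p q := by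
  simp only [dotProduct, Matrix.mulVec, Fin.sum_univ_seven, crossMat, phi0, det3]
  simp
  ring

theorem crossMat_transpose (u : Fin 7 → R) : (crossMat u).transpose = -crossMat u := by
  refine Matrix.ext fun i j => ?_
  fin_cases i <;> fin_cases j <;> simp [crossMat]

/-- The double cross product identity u × (u × v) = ⟨u, v⟩u − |u|²v. All determinants below rest on
it. -/
theorem crossMat_mul_self (u : Fin 7 → R) :
    crossMat u * crossMat u = Matrix.vecMulVec u u - (u ⬝ᵥ u) • 1 := by
  refine Matrix.ext fun i j => ?_
  fin_cases i <;> fin_cases j <;>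
    simp [crossMat, Matrix.mul_apply, Fin.sum_univ_seven, Matrix.vecMulVec_apply, dotProduct] <;>
    ring

theorem crossMat_mulVec_self (u : Fin 7 → R) : (crossMat u).mulVec u = 0 := by
  ext i
  fin_cases i <;> simp [crossMat, Matrix.mulVec, dotProduct, Fin.sum_univ_seven] <;> ring

theorem crossMat_sum {ι : Type*} [Fintype ι] (c : ι → R) (u : ι → Fin 7 → R) :
    crossMat (fun a => ∑ i, c i * u i a) = ∑ i, c i • crossMat (u i) := by
  refine Matrix.ext fun a b => ?_
  rw [Matrix.sum_apply]
  fin_cases a <;> fin_cases b <;> simp [crossMat]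

theorem crossMat_vecMul (c : Fin 7 → R) (m : Matrix (Fin 7) (Fin 7) R) :
    crossMat (Matrix.vecMul c m) = ∑ i, c i • crossMat (m i) := by
  exact crossMat_sum c m

theorem mul_crossMat_mul_transpose (m : Matrix (Fin 7) (Fin 7) R) (u : Fin 7 → R) (j k : Fin 7) :
    (m * crossMat u * m.transpose) j k = phi0 u (m j) (m k) := by
  rw [← dotProduct_crossMat_mulVec, Matrix.mul_assoc, Matrix.mul_apply_eq_vecMul,
    Matrix.dotProduct_mulVec]
  simp [Matrix.mul_apply, Matrix.vecMul, dotProduct, Finset.sum_mul, Finset.mul_sum]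
  rw [Finset.sum_comm]
  simp [mul_assoc]

theorem crossMat_apply (u : Fin 7 → R) (j k : Fin 7) :
    crossMat u j k = phi0 u (Pi.single j 1) (Pi.single k 1) := by
  rw [← dotProduct_crossMat_mulVec]
  simp

end LinearAlgebra

theorem det_one_add_vecMulVec {n R : Type*} [Fintype n] [DecidableEq n] [CommRing R]
    (u v : n → R) : (1 + Matrix.vecMulVec u v).det = 1 + v ⬝ᵥ u := by
  rw [Matrix.vecMulVec_eq Unit, Matrix.det_one_add_replicateCol_mul_replicateRow]

theorem det_smul_one_add_vecMulVec_self (u : Fin 7 → ℝ) (a c : ℝ) (ha : a ≠ 0) :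
    (a • (1 : Matrix (Fin 7) (Fin 7) ℝ) + c • Matrix.vecMulVec u u).det
      = a ^ 6 * (a + c * (u ⬝ᵥ u)) := by
  have : a • (1 : Matrix (Fin 7) (Fin 7) ℝ) + c • Matrix.vecMulVec u u
      = a • (1 + Matrix.vecMulVec ((c / a) • u) u) := by
    rw [smul_add, Matrix.smul_vecMulVec, smul_smul, mul_div_cancel₀ _ ha]
  rw [this, Matrix.det_smul, det_one_add_vecMulVec]
  simp
  field_simp

/-- `crossMat u` is skew and annihilates u, so the matrix times its transpose is a combination of 1
and uuᵀ, whose determinant is known. This leaves the sign open, hence the square. -/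
theorem det_crossMat_add_smul_vecMulVec_self_sq (u : Fin 7 → ℝ) (hu : u ⬝ᵥ u ≠ 0) (c : ℝ) :
    (crossMat u + c • Matrix.vecMulVec u u).det ^ 2 = c ^ 2 * (u ⬝ᵥ u) ^ 8 := by
  have h : (crossMat u + c • Matrix.vecMulVec u u) *
      (crossMat u + c • Matrix.vecMulVec u u).transpose
      = (u ⬝ᵥ u) • 1 + (c ^ 2 * (u ⬝ᵥ u) - 1) • Matrix.vecMulVec u u := by
    have h1 : Matrix.vecMul u (crossMat u) = 0 := by
      rw [← Matrix.mulVec_transpose, crossMat_transpose, Matrix.neg_mulVec, crossMat_mulVec_self,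
        neg_zero]
    rw [Matrix.transpose_add, Matrix.transpose_smul, Matrix.transpose_vecMulVec,
      crossMat_transpose, Matrix.add_mul, Matrix.mul_add, Matrix.mul_add, Matrix.mul_neg,
      crossMat_mul_self, Matrix.mul_smul, Matrix.mul_vecMulVec, crossMat_mulVec_self,
      Matrix.smul_mul, Matrix.mul_neg, Matrix.vecMulVec_mul, h1, Matrix.smul_mul,
      Matrix.mul_smul, Matrix.vecMulVec_mul_vecMulVec]
    simp only [Matrix.zero_vecMulVec, Matrix.vecMulVec_zero, smul_zero, neg_zero, add_zero,
      zero_add, Matrix.vecMulVec_smul, smul_smul]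
    module
  have h2 := congrArg Matrix.det h
  rw [Matrix.det_mul, Matrix.det_transpose, det_smul_one_add_vecMulVec_self _ _ _ hu] at h2
  rw [sq, h2]
  ring

/-- Write w = a(u + |u|²y) with y ⊥ u. Congruence by the transvection 1 + yuᵀ, of determinant 1,
carries A + a²uuᵀ to A + wwᵀ, where A = `crossMat u`, and so reduces to w parallel to u. -/
theorem det_crossMat_add_vecMulVec_sq (u w : Fin 7 → ℝ) (hu : u ⬝ᵥ u ≠ 0) (hw : w ⬝ᵥ u ≠ 0) :
    (crossMat u + Matrix.vecMulVec w w).det ^ 2 = (w ⬝ᵥ u) ^ 4 * (u ⬝ᵥ u) ^ 4 := by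
  obtain ⟨a, ha⟩ : ∃ a, a = w ⬝ᵥ u / u ⬝ᵥ u := ⟨_, rfl⟩
  have ha0 : a ≠ 0 := by rw [ha]; exact div_ne_zero hw hu
  obtain ⟨y, hy⟩ : ∃ y, y = (u ⬝ᵥ u)⁻¹ • (a⁻¹ • w - u) := ⟨_, rfl⟩
  have hyu : u ⬝ᵥ y = 0 := by
    rw [hy, dotProduct_smul, dotProduct_sub, dotProduct_smul, dotProduct_comm u w, ha]
    simp
    field_simp
    simp
  have hwy : w = a • (u + (u ⬝ᵥ u) • y) := by
    rw [hy, smul_smul, mul_inv_cancel₀ hu, one_smul, add_sub_cancel, smul_smul,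
      mul_inv_cancel₀ ha0, one_smul]
  have h1 : Matrix.vecMul u (crossMat u) = 0 := by
    rw [← Matrix.mulVec_transpose, crossMat_transpose, Matrix.neg_mulVec, crossMat_mulVec_self,
      neg_zero]
  have h2 : (1 + Matrix.vecMulVec y u) * (crossMat u + a ^ 2 • Matrix.vecMulVec u u) *
      (1 + Matrix.vecMulVec y u).transpose = crossMat u + Matrix.vecMulVec w w := by
    have h3 : (1 + Matrix.vecMulVec y u) * (crossMat u + a ^ 2 • Matrix.vecMulVec u u)
        = crossMat u + (a ^ 2) • Matrix.vecMulVec (u + (u ⬝ᵥ u) • y) u := by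
      rw [Matrix.add_mul, one_mul, Matrix.mul_add, Matrix.vecMulVec_mul, h1, Matrix.mul_smul,
        Matrix.vecMulVec_mul_vecMulVec, Matrix.add_vecMulVec, Matrix.smul_vecMulVec,
        Matrix.vecMulVec_smul, Matrix.vecMulVec_zero]
      module
    rw [h3, Matrix.transpose_add, Matrix.transpose_one, Matrix.transpose_vecMulVec,
      Matrix.mul_add, mul_one, Matrix.add_mul, Matrix.mul_vecMulVec, crossMat_mulVec_self,
      Matrix.smul_mul, Matrix.vecMulVec_mul_vecMulVec, hwy]
    simp only [Matrix.zero_vecMulVec, Matrix.vecMulVec_smul, Matrix.vecMulVec_add,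
      Matrix.smul_vecMulVec]
    module
  rw [← h2, Matrix.det_mul, Matrix.det_mul, Matrix.det_transpose, det_one_add_vecMulVec, hyu,
    add_zero, one_mul, mul_one, det_crossMat_add_smul_vecMulVec_self_sq _ hu, ha]
  field_simp

/-- A linear map that preserves the standard `G₂`-form is orthogonal. -/
theorem mul_transpose_of_phi0 (m : Matrix (Fin 7) (Fin 7) ℝ) (hm : m.det ≠ 0)
    (h : ∀ i j k, phi0 (m i) (m j) (m k)
      = phi0 (Pi.single i 1) (Pi.single j 1) (Pi.single k (1 : ℝ))) :
    m * m.transpose = 1 := by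
  -- Invariance of φ₀ is this identity for basis vectors u; both sides are linear in u.
  have key : ∀ u : Fin 7 → ℝ, m * crossMat (Matrix.vecMul u m) * m.transpose = crossMat u := by
    intro u
    have h1 : ∀ i, m * crossMat (m i) * m.transpose = crossMat (Pi.single i 1) := by
      intro i
      refine Matrix.ext fun j k => ?_
      rw [mul_crossMat_mul_transpose, h, crossMat_apply]
    rw [crossMat_vecMul, Matrix.mul_sum, Matrix.sum_mul]
    simp_rw [Matrix.mul_smul, Matrix.smul_mul, h1]
    conv_rhs => rw [← Matrix.vecMul_one u, crossMat_vecMul]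
    refine Finset.sum_congr rfl fun i _ => ?_
    congr 2
    ext j
    simp [Matrix.one_apply, Pi.single_apply, eq_comm]
  have hinj : ∀ u : Fin 7 → ℝ, u ≠ 0 → Matrix.vecMul u m ≠ 0 := fun u hu h0 =>
    hu (Matrix.eq_zero_of_vecMul_eq_zero hm h0)
  have hsq : ∀ u : Fin 7 → ℝ, u ≠ 0 → 0 < u ⬝ᵥ u := fun u hu => by
    refine lt_of_le_of_ne (Finset.sum_nonneg fun i _ => mul_self_nonneg _) fun h0 => hu ?_
    exact dotProduct_self_eq_zero.1 h0.symm
  -- A skew matrix of odd size is singular; adding vvᵀ with v = uᵀm makes it invertible. Squared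
  -- determinants of m(A_v + vvᵀ)mᵀ = A_u + (mv)(mv)ᵀ, with mv · u = v · v, give det(m)⁴(v·v)⁸ =
  -- (v·v)⁴(u·u)⁴. Thus m is conformal.
  have hnorm : ∀ u : Fin 7 → ℝ, u ≠ 0 →
      |m.det| * (Matrix.vecMul u m ⬝ᵥ Matrix.vecMul u m) = u ⬝ᵥ u := by
    intro u hu
    obtain ⟨v, hv⟩ : ∃ v, v = Matrix.vecMul u m := ⟨_, rfl⟩
    have hv0 : 0 < v ⬝ᵥ v := hsq v (hv ▸ hinj u hu)
    have hu0 := hsq u hu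
    have hmv : m.mulVec v ⬝ᵥ u = v ⬝ᵥ v := by
      rw [dotProduct_comm, Matrix.dotProduct_mulVec, ← hv]
    have e1 : m * (crossMat v + Matrix.vecMulVec v v) * m.transpose
        = crossMat u + Matrix.vecMulVec (m.mulVec v) (m.mulVec v) := by
      rw [Matrix.mul_add, Matrix.add_mul, hv, key, Matrix.mul_vecMulVec, Matrix.vecMulVec_mul,
        Matrix.vecMul_transpose]
    have e2 := congrArg (fun A => A.det ^ 2) e1
    simp only [Matrix.det_mul, Matrix.det_transpose] at e2
    rw [det_crossMat_add_vecMulVec_sq _ _ hu0.ne' (by rw [hmv]; exact hv0.ne'), hmv, mul_pow,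
      mul_pow, det_crossMat_add_vecMulVec_sq _ _ hv0.ne' hv0.ne'] at e2
    rw [← hv]
    have e3 : (|m.det| * (v ⬝ᵥ v)) ^ 4 = (u ⬝ᵥ u) ^ 4 := by
      have : (v ⬝ᵥ v) ^ 4 * (|m.det| * (v ⬝ᵥ v)) ^ 4 = (v ⬝ᵥ v) ^ 4 * (u ⬝ᵥ u) ^ 4 := by
        rw [← e2, mul_pow, show |m.det| ^ 4 = m.det ^ 4 from by
          rw [show (4 : ℕ) = 2 * 2 from rfl, pow_mul, pow_mul, sq_abs]]
        ring
      exact mul_left_cancel₀ (pow_ne_zero 4 hv0.ne') this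
    exact (pow_left_inj₀ (by positivity) hu0.le (by norm_num)).1 e3
  -- Polarisation: a symmetric matrix with vanishing quadratic form is zero.
  have hmul : |m.det| • (m * m.transpose) = 1 := by
    have hB : ∀ u : Fin 7 → ℝ,
        u ⬝ᵥ (|m.det| • (m * m.transpose) - 1).mulVec u = 0 := by
      intro u
      by_cases hu : u = 0
      · simp [hu]
      · rw [Matrix.sub_mulVec, Matrix.one_mulVec, Matrix.smul_mulVec, dotProduct_sub,
          dotProduct_smul, ← Matrix.mulVec_mulVec, Matrix.dotProduct_mulVec,
          Matrix.mulVec_transpose, smul_eq_mul, hnorm u hu, sub_self]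
    have hsymm : (|m.det| • (m * m.transpose) - 1).transpose
        = |m.det| • (m * m.transpose) - 1 := by
      simp [Matrix.transpose_mul]
    obtain ⟨S, hS⟩ : ∃ S, S = |m.det| • (m * m.transpose) - 1 := ⟨_, rfl⟩
    rw [← hS] at hB hsymm
    suffices S = 0 by rwa [hS, sub_eq_zero] at this
    refine Matrix.ext fun i j => ?_
    have a1 := hB (Pi.single i 1 + Pi.single j 1)
    have a2 := hB (Pi.single i 1)
    have a3 := hB (Pi.single j 1)
    have a4 : S j i = S i j := congrFun (congrFun hsymm i) j
    simp [Matrix.mulVec_add] at a1 a2 a3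
    simp
    linarith
  -- In dimension 7 the determinant of |det m| m mᵀ is |det m|⁹.
  have hdet : |m.det| = 1 := by
    have := congrArg Matrix.det hmul
    rw [Matrix.det_smul, Matrix.det_mul, Matrix.det_transpose, Matrix.det_one, ← sq,
      ← sq_abs m.det, ← pow_add] at this
    exact (pow_eq_one_iff_of_nonneg (abs_nonneg _) (by simp)).1 this
  rwa [hdet, one_smul] at hmul

/-! ### Hodge duality and orientation for φ₀ -/

/-- Complementary minors of an orthogonal matrix. -/
theorem det_toBlocks₂₂_of_mul_transpose {m n : Type*} [Fintype m] [Fintype n] [DecidableEq m]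
    [DecidableEq n] (Q : Matrix (m ⊕ n) (m ⊕ n) ℝ) (h : Q * Q.transpose = 1) :
    Q.toBlocks₂₂.det = Q.det * Q.toBlocks₁₁.det := by
  obtain ⟨A, B, C, D, rfl⟩ : ∃ A B C D, Q = Matrix.fromBlocks A B C D :=
    ⟨_, _, _, _, (Matrix.fromBlocks_toBlocks Q).symm⟩
  have hd : (Matrix.fromBlocks A B C D).det * (Matrix.fromBlocks A B C D).det = 1 := by
    simpa using congrArg Matrix.det h
  rw [Matrix.fromBlocks_transpose, Matrix.fromBlocks_multiply, ← Matrix.fromBlocks_one,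
    Matrix.fromBlocks_inj] at h
  -- The last block row of Q is orthonormal and orthogonal to the first, so this product is block
  -- triangular and det Q · det D = det A.
  have h2 : Matrix.fromBlocks A B C D * Matrix.fromBlocks 1 C.transpose 0 D.transpose
      = Matrix.fromBlocks A 0 C 1 := by
    rw [Matrix.fromBlocks_multiply]
    simp [h.2.1, h.2.2.2]
  have h3 := congrArg Matrix.det h2
  rw [Matrix.det_mul, Matrix.det_fromBlocks_zero₂₁, Matrix.det_fromBlocks_zero₁₂,
    Matrix.det_one, Matrix.det_one, Matrix.det_transpose, one_mul, mul_one] at h3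
  rw [Matrix.toBlocks_fromBlocks₂₂, Matrix.toBlocks_fromBlocks₁₁, ← h3, ← mul_assoc, hd, one_mul]

theorem det4_eq_det3 (m : Matrix (Fin 7) (Fin 7) ℝ) (h : m * m.transpose = 1)
    (π : Equiv.Perm (Fin 7)) :
    det4 (π 3) (π 4) (π 5) (π 6) (m 3) (m 4) (m 5) (m 6)
      = (Equiv.Perm.sign π : ℝ) * m.det * det3 (π 0) (π 1) (π 2) (m 0) (m 1) (m 2) := by
  let e : Fin 3 ⊕ Fin 4 ≃ Fin 7 := finSumFinEquiv
  have h1 := det_toBlocks₂₂_of_mul_transpose ((m.submatrix id π).submatrix e e) (by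
    rw [Matrix.transpose_submatrix, Matrix.submatrix_mul_equiv, Matrix.transpose_submatrix]
    have : m.submatrix id π * m.transpose.submatrix π id = 1 := by
      rw [Matrix.submatrix_mul_equiv, h, Matrix.submatrix_one _ Function.injective_id]
    rw [this, Matrix.submatrix_one_equiv])
  rw [Matrix.det_submatrix_equiv_self, Matrix.det_permute'] at h1
  have e4 : (((m.submatrix id π).submatrix e e).toBlocks₂₂).det
      = det4 (π 3) (π 4) (π 5) (π 6) (m 3) (m 4) (m 5) (m 6) := by
    have i0 : e (Sum.inr 0) = 3 := rfl
    have i1 : e (Sum.inr 1) = 4 := rfl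
    have i2 : e (Sum.inr 2) = 5 := rfl
    have i3 : e (Sum.inr 3) = 6 := rfl
    rw [Matrix.det_succ_row_zero, Fin.sum_univ_four]
    simp only [Matrix.det_fin_three, Matrix.submatrix_apply, Matrix.toBlocks₂₂, Matrix.of_apply]
    simp [Fin.succAbove, i0, i1, i2, i3, det4, det3]
    ring
  have e3 : (((m.submatrix id π).submatrix e e).toBlocks₁₁).det
      = det3 (π 0) (π 1) (π 2) (m 0) (m 1) (m 2) := by
    have i0 : e (Sum.inl 0) = 0 := rfl
    have i1 : e (Sum.inl 1) = 1 := rfl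
    have i2 : e (Sum.inl 2) = 2 := rfl
    rw [Matrix.det_fin_three]
    simp [Matrix.toBlocks₁₁, i0, i1, i2, det3]
    ring
  rw [← e4, h1, e3]

/-- `ψ₀` is the Hodge dual of `φ₀`. -/
theorem psi0_eq_phi0 (m : Matrix (Fin 7) (Fin 7) ℝ) (h : m * m.transpose = 1) :
    psi0 (m 3) (m 4) (m 5) (m 6) = m.det * phi0 (m 0) (m 1) (m 2) := by
  -- One permutation per monomial of φ₀: its first three entries are the indices of that monomial,
  -- its last four those of the complementary monomial of ψ₀.
  have h0 := det4_eq_det3 m h 1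
  have h1 := det4_eq_det3 m h ⟨![0, 3, 6, 1, 2, 4, 5], ![0, 3, 4, 1, 5, 6, 2], by decide, by decide⟩
  have h2 := det4_eq_det3 m h ⟨![0, 4, 5, 1, 2, 3, 6], ![0, 3, 4, 5, 1, 2, 6], by decide, by decide⟩
  have h3 := det4_eq_det3 m h ⟨![1, 3, 5, 2, 0, 4, 6], ![4, 0, 3, 1, 5, 2, 6], by decide, by decide⟩
  have h4 := det4_eq_det3 m h ⟨![1, 4, 6, 2, 0, 3, 5], ![4, 0, 3, 5, 1, 6, 2], by decide, by decide⟩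
  have h5 := det4_eq_det3 m h ⟨![2, 3, 4, 0, 1, 5, 6], ![3, 4, 0, 1, 2, 5, 6], by decide, by decide⟩
  have h6 := det4_eq_det3 m h ⟨![2, 5, 6, 0, 1, 3, 4], ![3, 4, 0, 5, 6, 1, 2], by decide, by decide⟩
  rw [show Equiv.Perm.sign _ = 1 by decide] at h0 h2 h1 h5 h6
  rw [show Equiv.Perm.sign _ = -1 by decide] at h3 h4
  simp at h0 h1 h2 h3 h4 h5 h6
  rw [psi0, phi0]
  linarith

theorem phi0_sum_mul_phi0 (p q s t : Fin 7 → ℝ) (m : Matrix (Fin 7) (Fin 7) ℝ)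
    (h : m * m.transpose = 1) :
    ∑ k, phi0 (m k) p q * phi0 (m k) s t
      = ∑ k, phi0 (Pi.single k 1) p q * phi0 (Pi.single k 1) s t := by
  have h' : m.transpose * m = 1 := mul_eq_one_comm.1 h
  have hs : ∀ (p q u : Fin 7 → ℝ), phi0 u p q = u ⬝ᵥ fun j => phi0 (Pi.single j 1) p q := by
    intro p q u
    simp [dotProduct, Fin.sum_univ_seven, phi0, det3]
    ring
  obtain ⟨f, hf⟩ : ∃ f : Fin 7 → ℝ, f = fun j => phi0 (Pi.single j 1) p q := ⟨_, rfl⟩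
  obtain ⟨g, hg⟩ : ∃ g : Fin 7 → ℝ, g = fun j => phi0 (Pi.single j 1) s t := ⟨_, rfl⟩
  have hL : ∑ k, phi0 (m k) p q * phi0 (m k) s t = m.mulVec f ⬝ᵥ m.mulVec g := by
    refine Finset.sum_congr rfl fun k _ => ?_
    rw [hs p q, hs s t, ← hf, ← hg]; rfl
  have hR : ∑ k, phi0 (Pi.single k 1) p q * phi0 (Pi.single k 1) s t = f ⬝ᵥ g := by
    rw [hf, hg]; rfl
  rw [hL, hR, Matrix.dotProduct_mulVec, Matrix.vecMul_mulVec, ← Matrix.mulVec_transpose,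
    h', Matrix.transpose_one, Matrix.one_mulVec]

set_option maxRecDepth 10000 in
/-- The contraction of `φ₀` with itself. -/
theorem sum_phi0_mul_phi0 (p q s t : Fin 7 → ℝ) :
    ∑ k, phi0 (Pi.single k 1) p q * phi0 (Pi.single k 1) s t
    = p ⬝ᵥ s * q ⬝ᵥ t - p ⬝ᵥ t * q ⬝ᵥ s + psi0 p q s t := by
  have e0 : ∀ p q : Fin 7 → ℝ, phi0 (Pi.single 0 1) p q
      = (p 1 * q 2 - p 2 * q 1) + (p 3 * q 6 - p 6 * q 3) + (p 4 * q 5 - p 5 * q 4) := by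
    intro p q; simp [phi0, det3]; try ring
  have e1 : ∀ p q : Fin 7 → ℝ, phi0 (Pi.single 1 1) p q
      = (p 2 * q 0 - p 0 * q 2) + (p 3 * q 5 - p 5 * q 3) + (p 6 * q 4 - p 4 * q 6) := by
    intro p q; simp [phi0, det3]; try ring
  have e2 : ∀ p q : Fin 7 → ℝ, phi0 (Pi.single 2 1) p q
      = (p 0 * q 1 - p 1 * q 0) + (p 3 * q 4 - p 4 * q 3) + (p 5 * q 6 - p 6 * q 5) := by
    intro p q; simp [phi0, det3]; try ring
  have e3 : ∀ p q : Fin 7 → ℝ, phi0 (Pi.single 3 1) p q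
      = (p 6 * q 0 - p 0 * q 6) + (p 5 * q 1 - p 1 * q 5) + (p 4 * q 2 - p 2 * q 4) := by
    intro p q; simp [phi0, det3]; try ring
  have e4 : ∀ p q : Fin 7 → ℝ, phi0 (Pi.single 4 1) p q
      = (p 5 * q 0 - p 0 * q 5) + (p 1 * q 6 - p 6 * q 1) + (p 2 * q 3 - p 3 * q 2) := by
    intro p q; simp [phi0, det3]; try ring
  have e5 : ∀ p q : Fin 7 → ℝ, phi0 (Pi.single 5 1) p q
      = (p 0 * q 4 - p 4 * q 0) + (p 1 * q 3 - p 3 * q 1) + (p 6 * q 2 - p 2 * q 6) := by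
    intro p q; simp [phi0, det3]; try ring
  have e6 : ∀ p q : Fin 7 → ℝ, phi0 (Pi.single 6 1) p q
      = (p 0 * q 3 - p 3 * q 0) + (p 4 * q 1 - p 1 * q 4) + (p 2 * q 5 - p 5 * q 2) := by
    intro p q; simp [phi0, det3]; try ring
  simp only [dotProduct, Fin.sum_univ_seven, e0, e1, e2, e3, e4, e5, e6, det3, psi0, det4]
  ring

/-- A linear map that preserves the standard `G₂`-form is orientation preserving. -/
theorem det_eq_one_of_phi0 (m : Matrix (Fin 7) (Fin 7) ℝ) (hm : m.det ≠ 0)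
    (h : ∀ i j k, phi0 (m i) (m j) (m k)
      = phi0 (Pi.single i 1) (Pi.single j 1) (Pi.single k (1 : ℝ))) :
    m.det = 1 := by
  have ho := mul_transpose_of_phi0 m hm h
  have hdot : ∀ i j, m i ⬝ᵥ m j = (1 : Matrix (Fin 7) (Fin 7) ℝ) i j := fun i j => by
    rw [← ho]; rfl
  -- The contraction identity recovers ψ₀ from φ₀ and the metric alone, hence ψ₀ is preserved by m;
  -- as a Hodge dual it is multiplied by det m.
  have h1 := sum_phi0_mul_phi0 (m 3) (m 4) (m 5) (m 6)
  rw [← phi0_sum_mul_phi0 _ _ _ _ m ho, hdot, hdot, hdot, hdot, psi0_eq_phi0 m ho] at h1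
  simp only [h] at h1
  rw [sum_phi0_mul_phi0] at h1
  simp [psi0, det4, phi0, det3] at h1
  linarith

/-! ### Coordinates on `ℍ²` and the action of `Sp(2)` -/

@[simp] theorem qI_re : qI.re = 0 := rfl

@[simp] theorem qI_imI : qI.imI = 1 := rfl

@[simp] theorem qI_imJ : qI.imJ = 0 := rfl

@[simp] theorem qI_imK : qI.imK = 0 := rfl

@[simp] theorem qJ_re : qJ.re = 0 := rfl

@[simp] theorem qJ_imI : qJ.imI = 0 := rfl

@[simp] theorem qJ_imJ : qJ.imJ = 1 := rfl

@[simp] theorem qJ_imK : qJ.imK = 0 := rfl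

@[simp] theorem qK_re : qK.re = 0 := rfl

@[simp] theorem qK_imI : qK.imI = 0 := rfl

@[simp] theorem qK_imJ : qK.imJ = 0 := rfl

@[simp] theorem qK_imK : qK.imK = 1 := rfl

/-- A shortcut instance for the inclusion of `Sp(2)`. -/
instance (A : Sp2) : CoeT Sp2 A (Matrix (Fin 2) (Fin 2) ℍ[ℝ]) := ⟨A.1⟩

theorem inner_eq_sum (u v : HH) : ⟪u, v⟫ =
    (u 0).re * (v 0).re + (u 0).imI * (v 0).imI + (u 0).imJ * (v 0).imJ + (u 0).imK * (v 0).imK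
    + ((u 1).re * (v 1).re + (u 1).imI * (v 1).imI + (u 1).imJ * (v 1).imJ
      + (u 1).imK * (v 1).imK) := by
  simp [PiLp.inner_apply, Quaternion.inner_def]

theorem act_apply (A : Matrix (Fin 2) (Fin 2) ℍ[ℝ]) (v : HH) (a : Fin 2) :
    act A v a = A a 0 * v 0 + A a 1 * v 1 := by
  fin_cases a <;> simp [act]

theorem act_mul (A B : Matrix (Fin 2) (Fin 2) ℍ[ℝ]) (v : HH) : act (A * B) v = act A (act B v) := by
  ext1 a
  simp only [act_apply, Matrix.mul_apply, Fin.sum_univ_two, add_mul, mul_add, mul_assoc]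
  abel

theorem act_one (v : HH) : act 1 v = v := by
  simp [act]

theorem inner_act_left (A : Matrix (Fin 2) (Fin 2) ℍ[ℝ]) (u v : HH) :
    ⟪act A u, v⟫ = ⟪u, act (star A) v⟫ := by
  simp only [inner_eq_sum, act_apply, Matrix.star_apply]
  simp
  ring

theorem act_inv_act (A : Sp2) (v : HH) :
    act ((A⁻¹ : Sp2) : Matrix (Fin 2) (Fin 2) ℍ[ℝ]) (act A v) = v := by
  rw [← act_mul, ← Submonoid.coe_mul, inv_mul_cancel, Submonoid.coe_one, act_one]

theorem act_act_inv (A : Sp2) (v : HH) :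
    act A (act ((A⁻¹ : Sp2) : Matrix (Fin 2) (Fin 2) ℍ[ℝ]) v) = v := by
  rw [← act_mul, ← Submonoid.coe_mul, mul_inv_cancel, Submonoid.coe_one, act_one]

theorem inner_act_act (A : Sp2) (u v : HH) : ⟪act A u, act A v⟫ = ⟪u, v⟫ := by
  rw [inner_act_left, ← act_mul, Unitary.coe_star_mul_self, act_one]

theorem norm_act (A : Sp2) (u : HH) : ‖act A u‖ = ‖u‖ := by
  rw [← sq_eq_sq₀ (norm_nonneg _) (norm_nonneg _), ← real_inner_self_eq_norm_sq,
    inner_act_act, real_inner_self_eq_norm_sq]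

/-- Right multiplication by the quaternion units `i`, `j`, `k`. -/
def rmul (l : Fin 3) : HH →L[ℝ] HH :=
  LinearMap.toContinuousLinearMap
    { toFun := fun v => WithLp.toLp 2 fun a => v a * (![qI, qJ, qK] : Fin 3 → ℍ[ℝ]) l
      map_add' := fun v w => by ext1 a; simp [add_mul]
      map_smul' := fun c v => by ext1 a; simp }

theorem rmul_apply (l : Fin 3) (v : HH) (a : Fin 2) :
    rmul l v a = v a * (![qI, qJ, qK] : Fin 3 → ℍ[ℝ]) l := rfl

theorem hopf_eq (x : S7) (l : Fin 3) : hopf x l = rmul l x := rfl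

/-- Left and right multiplication commute. Hence x ↦ xi, xj, xk are invariant vector fields, and all
expressions in them and the inner product are invariant. -/
theorem rmul_act (l : Fin 3) (A : Matrix (Fin 2) (Fin 2) ℍ[ℝ]) (v : HH) :
    rmul l (act A v) = act A (rmul l v) := by
  ext1 a
  simp only [rmul_apply, act_apply, add_mul, mul_assoc]

theorem inner_rmul_comm (l : Fin 3) (u v : HH) : ⟪rmul l u, v⟫ = -⟪rmul l v, u⟫ := by
  fin_cases l <;> simp [inner_eq_sum, rmul_apply] <;> ring

theorem o_zero : (o : HH) 0 = 0 := by simp [o]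

theorem o_one : (o : HH) 1 = 1 := by simp [o]

theorem norm_coe (x : S7) : ‖(x : HH)‖ = 1 := mem_sphere_zero_iff_norm.1 x.2

theorem act_transport (x : S7) : act (transport x) o = (x : HH) :=
  Classical.choose_spec (exists_act_eq x)

theorem act_transport_inv (x : S7) :
    act ((transport x)⁻¹ : Sp2) (x : HH) = (o : HH) := by
  rw [← act_transport x, act_inv_act]

/-! ### The frame `e₁, …, e₇` and its dual coframe -/

theorem eVec_apply (i : Fin 7) (a : Fin 2) : eVec i a = pBasis i a 1 := by
  rw [eVec, act_apply, o_zero, o_one, mul_zero, zero_add, mul_one]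

theorem inv_sqrt_two_sq : ((√2 : ℝ)⁻¹) * (√2)⁻¹ = 1 / 2 := by
  rw [← mul_inv, Real.mul_self_sqrt (by norm_num)]; norm_num

theorem two_mul_inv_sqrt_two : (2 : ℝ) * (√2)⁻¹ = √2 := by
  have : (√2 : ℝ) ≠ 0 := by simp
  field_simp
  simp

/-- The coordinates of `eDual`. -/
theorem eDual_apply (i : Fin 7) (v : HH) : eDual i v =
    (![(v 1).imI, (v 1).imJ, (v 1).imK, √2 * (v 0).imI, √2 * (v 0).imJ, √2 * (v 0).imK,
      √2 * (v 0).re] : Fin 7 → ℝ) i := by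
  have h2 := inv_sqrt_two_sq
  have h3 := two_mul_inv_sqrt_two
  have h : eDual i v = (⟪eVec i, eVec i⟫)⁻¹ * ⟪eVec i, v⟫ := by
    rw [real_inner_self_eq_norm_sq]; rfl
  rw [h, inner_eq_sum, inner_eq_sum]
  fin_cases i <;> simp [eVec_apply, pBasis, h2] <;>
    rw [← mul_assoc, h3]

theorem eVec_coord (i : Fin 7) : eVec i =
    WithLp.toLp 2 ((![![0, qI], ![0, qJ], ![0, qK], ![(√2)⁻¹ • qI, 0], ![(√2)⁻¹ • qJ, 0],
      ![(√2)⁻¹ • qK, 0], ![(√2)⁻¹ • 1, 0]] : Fin 7 → Fin 2 → ℍ[ℝ]) i) := by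
  ext1 a
  rw [eVec_apply]
  fin_cases i <;> fin_cases a <;> simp [pBasis]

theorem eDual_eVec (i j : Fin 7) : eDual i (eVec j) = if i = j then 1 else 0 := by
  have : (√2 : ℝ) ≠ 0 := by simp
  rw [eDual_apply, eVec_coord]
  fin_cases i <;> fin_cases j <;> simp [this]

theorem eDual_o (i : Fin 7) : eDual i o = 0 := by
  rw [eDual_apply, o_zero, o_one]
  fin_cases i <;> simp

theorem inner_o (v : HH) : ⟪(o : HH), v⟫ = (v 1).re := by
  rw [inner_eq_sum, o_zero, o_one]
  simp

theorem inner_o_eVec (i : Fin 7) : ⟪(o : HH), eVec i⟫ = 0 := by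
  rw [inner_o, eVec_coord]
  fin_cases i <;> simp

theorem eq_sum_eDual (v : HH) : v = ⟪(o : HH), v⟫ • (o : HH) + ∑ i, eDual i v • eVec i := by
  have h : √2 * (√2)⁻¹ = (1 : ℝ) := mul_inv_cancel₀ (by simp)
  have h' : ∀ y : ℝ, √2 * y * (√2)⁻¹ = y := fun y => by rw [mul_right_comm, h, one_mul]
  ext1 a
  rw [inner_o]
  simp only [Fin.sum_univ_seven, eDual_apply, PiLp.add_apply, PiLp.smul_apply, eVec_coord]
  fin_cases a <;> ext <;> simp [o_zero, o_one, h']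

/-- The coframe at `x` that is dual to the image of `e₁, …, e₇`. -/
def coframe (x : S7) (i : Fin 7) : HH →L[ℝ] ℝ := (eDual i).comp (act ((transport x)⁻¹ : Sp2))

/-- The image of `e₁, …, e₇` in the tangent space at `x`. -/
def frame (x : S7) (i : Fin 7) : HH := act (transport x) (eVec i)

theorem coframe_apply (x : S7) (i : Fin 7) (v : HH) :
    coframe x i v = eDual i (act ((transport x)⁻¹ : Sp2) v) := rfl

theorem coframe_frame (x : S7) (i j : Fin 7) :
    coframe x i (frame x j) = if i = j then 1 else 0 := by
  rw [coframe_apply, frame, act_inv_act, eDual_eVec]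

theorem coframe_self (x : S7) (i : Fin 7) : coframe x i x = 0 := by
  rw [coframe_apply, act_transport_inv, eDual_o]

theorem inner_frame (x : S7) (i : Fin 7) : ⟪(x : HH), frame x i⟫ = 0 := by
  rw [frame, ← act_transport x, inner_act_act, inner_o_eVec]

theorem eq_sum_coframe (x : S7) (v : HH) :
    v = ⟪(x : HH), v⟫ • (x : HH) + ∑ i, coframe x i v • frame x i := by
  have h := eq_sum_eDual (act ((transport x)⁻¹ : Sp2) v)
  have h2 := congrArg (act (transport x : Matrix (Fin 2) (Fin 2) ℍ[ℝ])) h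
  rw [act_act_inv, map_add, map_smul, map_sum, act_transport] at h2
  conv_lhs => rw [h2]
  congr 2
  · conv_rhs => rw [← act_act_inv (transport x) v, ← act_transport x, inner_act_act]
  · funext i
    rw [map_smul]; rfl

theorem eq_sum_frame (x : S7) {v : HH} (hv : ⟪(x : HH), v⟫ = 0) :
    v = ∑ i, coframe x i v • frame x i := by
  conv_lhs => rw [eq_sum_coframe x v, hv, zero_smul, zero_add]

/-! ### The invariant forms `ηₗ` and `ωₗ` -/

/-- The pullback of the invariant form `eˡ` under the radial projection. -/
def eta (l : Fin 3) (y u : HH) : ℝ := (‖y‖ ^ 2)⁻¹ * ⟪rmul l y, u⟫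

/-- The signs with `deˡ = εₗ ωₗ - 2 eˡ⁺¹ ∧ eˡ⁺²`. -/
def eps : Fin 3 → ℝ := ![-1, 1, -1]

/-- The pullback of the invariant form `ωₗ` under the radial projection. -/
def om (l : Fin 3) (y u v : HH) : ℝ :=
  2 * eps l * ((‖y‖ ^ 2)⁻¹ * (⟪rmul l u, v⟫
      - (‖y‖ ^ 2)⁻¹ * (⟪y, u⟫ * ⟪rmul l y, v⟫ - ⟪y, v⟫ * ⟪rmul l y, u⟫))
    + (eta (l + 1) y u * eta (l + 2) y v - eta (l + 2) y u * eta (l + 1) y v))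

theorem eta_act (A : Sp2) (l : Fin 3) (y u : HH) : eta l (act A y) (act A u) = eta l y u := by
  rw [eta, eta, norm_act, rmul_act, inner_act_act]

theorem om_act (A : Sp2) (l : Fin 3) (y u v : HH) :
    om l (act A y) (act A u) (act A v) = om l y u v := by
  simp only [om, eta_act, norm_act, rmul_act, inner_act_act]

theorem eta_o (l : Fin 3) (u : HH) : eta l o u = eDual (Fin.castAdd 4 l) u := by
  rw [eta, norm_coe, inner_eq_sum, eDual_apply]
  fin_cases l <;> simp [rmul_apply, o_zero, o_one, Fin.castAdd, Fin.castLE]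

/-- By invariance the identity only has to hold at `o`. This frees the vertical coframe from the
arbitrary choice in `transport`; `om_eq_coframe` does the same for ωₗ, although e⁴, …, e⁷ themselves
have no such formula. -/
theorem eta_eq_coframe (l : Fin 3) (x : S7) (u : HH) :
    eta l x u = coframe x (Fin.castAdd 4 l) u := by
  rw [coframe_apply, ← eta_o, ← act_transport_inv x, eta_act]

/-- The value of `ωₗ` in terms of the coordinates of the vectors. -/
def omCoord {R : Type*} [CommRing R] (l : Fin 3) (p q : Fin 7 → R) : R :=
  (![p 3 * q 6 - p 6 * q 3 + (p 4 * q 5 - p 5 * q 4),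
    p 3 * q 5 - p 5 * q 3 - (p 4 * q 6 - p 6 * q 4),
    p 3 * q 4 - p 4 * q 3 + (p 5 * q 6 - p 6 * q 5)] : Fin 3 → R) l

theorem om_o (l : Fin 3) (u v : HH) :
    om l o u v = omCoord l (fun i => eDual i u) (fun i => eDual i v) := by
  have h : ∀ a b : ℝ, √2 * a * (√2 * b) = 2 * (a * b) := fun a b => by
    rw [mul_mul_mul_comm, Real.mul_self_sqrt (by norm_num)]
  simp only [om, norm_coe, eta_o, omCoord, eDual_apply, inner_eq_sum, rmul_apply, o_zero, o_one]
  fin_cases l <;> simp [Fin.castAdd, Fin.castLE, eps, h] <;> ring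

theorem om_eq_coframe (l : Fin 3) (x : S7) (u v : HH) :
    om l x u v = omCoord l (fun i => coframe x i u) (fun i => coframe x i v) := by
  simp only [coframe_apply]
  rw [← om_o, ← act_transport_inv x, om_act]

/-! ### Values of the invariant forms -/

theorem eForm_apply {k : ℕ} (i : Fin k → Fin 7) (v : Fin k → HH) :
    eForm i v = (Matrix.of fun a b => eDual (i b) (v a)).det := by
  rw [Matrix.det_apply, eForm, ContinuousMultilinearMap.alternatization_apply_apply]
  refine Finset.sum_congr rfl fun σ _ => ?_
  simp

theorem eForm_three (a b c : Fin 7) (v : Fin 3 → HH) :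
    eForm ![a, b, c] v = det3 a b c (fun i => eDual i (v 0)) (fun i => eDual i (v 1))
      (fun i => eDual i (v 2)) := by
  rw [eForm_apply, Matrix.det_fin_three]
  simp [det3]
  ring

theorem eForm_four (a b c e : Fin 7) (v : Fin 4 → HH) :
    eForm ![a, b, c, e] v = det4 a b c e (fun i => eDual i (v 0)) (fun i => eDual i (v 1))
      (fun i => eDual i (v 2)) (fun i => eDual i (v 3)) := by
  rw [eForm_apply, Matrix.det_succ_row_zero, Fin.sum_univ_four]
  simp only [Matrix.det_fin_three, Matrix.submatrix_apply, Matrix.of_apply]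
  simp [Fin.succAbove, det4, det3]
  ring

/-- The value of the wedge product of a `1`-form and a `2`-form. -/
def wedge12 {R : Type*} [CommRing R] (a : Fin 3 → R) (w : Fin 3 → Fin 3 → R) : R :=
  a 0 * w 1 2 - a 1 * w 0 2 + a 2 * w 0 1

/-- The value of the wedge product of two `1`-forms and a `2`-form. -/
def wedge112 {R : Type*} [CommRing R] (a b : Fin 4 → R) (w : Fin 4 → Fin 4 → R) : R :=
  (a 0 * b 1 - a 1 * b 0) * w 2 3 - (a 0 * b 2 - a 2 * b 0) * w 1 3
    + (a 0 * b 3 - a 3 * b 0) * w 1 2 + (a 1 * b 2 - a 2 * b 1) * w 0 3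
    - (a 1 * b 3 - a 3 * b 1) * w 0 2 + (a 2 * b 3 - a 3 * b 2) * w 0 1

/-- Half the value of the wedge square of a `2`-form. -/
def wedge22 {R : Type*} [CommRing R] (w : Fin 4 → Fin 4 → R) : R :=
  w 0 1 * w 2 3 - w 0 2 * w 1 3 + w 0 3 * w 1 2

/-- The form `e^j ∧ e^k ∧ ωᵢ`. -/
def eeOmega (j k : Fin 7) : Fin 3 → HH [⋀^Fin 4]→L[ℝ] ℝ :=
  ![eForm ![j, k, 3, 6] + eForm ![j, k, 4, 5],
    eForm ![j, k, 3, 5] - eForm ![j, k, 4, 6],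
    eForm ![j, k, 3, 4] + eForm ![j, k, 5, 6]]

theorem eOmega_apply (j : Fin 7) (i : Fin 3) (v : Fin 3 → HH) : eOmega j i v
    = wedge12 (fun n => eDual j (v n))
      (fun n m => omCoord i (fun a => eDual a (v n)) (fun a => eDual a (v m))) := by
  fin_cases i <;> simp [eOmega, eForm_three, wedge12, omCoord, det3] <;> ring

theorem eeOmega_apply (j k : Fin 7) (i : Fin 3) (v : Fin 4 → HH) : eeOmega j k i v
    = wedge112 (fun n => eDual j (v n)) (fun n => eDual k (v n))
      (fun n m => omCoord i (fun a => eDual a (v n)) (fun a => eDual a (v m))) := by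
  fin_cases i <;> simp [eeOmega, eForm_four, wedge112, omCoord, det3, det4] <;> ring

theorem eForm_horizontal_apply (v : Fin 4 → HH) : eForm ![3, 4, 5, 6] v
    = wedge22 (fun n m => omCoord 2 (fun a => eDual a (v n)) (fun a => eDual a (v m))) := by
  simp [eForm_four, wedge22, omCoord, det3, det4]
  ring

theorem eForm_vertical_apply (v : Fin 3 → HH) : eForm ![0, 1, 2] v
    = (Matrix.of fun a b : Fin 3 => eDual (Fin.castAdd 4 b) (v a)).det := by
  rw [eForm_three, Matrix.det_fin_three]
  simp [det3, Fin.castAdd, Fin.castLE]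
  ring

theorem invForm_apply {k : ℕ} (α : HH [⋀^Fin k]→L[ℝ] ℝ) (x : S7) (v : Fin k → HH) :
    invForm α x v = α (fun n => act ((transport x)⁻¹ : Sp2) (v n)) := rfl

/-! ### The radial extension and smoothness -/

/-- `eta` has degree −1 in the base point and `om` degree −2, so products representing k-forms have
degree −k, which matches the factor `(‖y‖⁻¹) ^ k` of the radial extension. -/
theorem eta_smul_left (l : Fin 3) {c : ℝ} (hc : c ≠ 0) (y u : HH) :
    eta l (c • y) u = c⁻¹ * eta l y u := by
  rw [eta, eta, norm_smul, map_smul, real_inner_smul_left, mul_pow, Real.norm_eq_abs, sq_abs]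
  field_simp

theorem om_smul_left (l : Fin 3) {c : ℝ} (hc : c ≠ 0) (y u v : HH) :
    om l (c • y) u v = (c⁻¹) ^ 2 * om l y u v := by
  simp only [om, eta_smul_left _ hc, norm_smul, map_smul, real_inner_smul_left, mul_pow,
    Real.norm_eq_abs, sq_abs]
  field_simp

theorem radialExt_apply {k : ℕ} (α : Form k) {y : HH} (hy : y ≠ 0) (v : Fin k → HH) :
    radialExt α y v = (‖y‖⁻¹) ^ k * α (radial y hy) v := by
  rw [radialExt, dif_neg hy]; rfl

theorem eta_radial (l : Fin 3) {y : HH} (hy : y ≠ 0) (u : HH) :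
    eDual (Fin.castAdd 4 l) (act ((transport (radial y hy))⁻¹ : Sp2) u) = ‖y‖ * eta l y u := by
  have h : ‖y‖ ≠ 0 := norm_ne_zero_iff.2 hy
  rw [← coframe_apply, ← eta_eq_coframe]
  exact (eta_smul_left l (inv_ne_zero h) y u).trans (by rw [inv_inv])

theorem om_radial (l : Fin 3) {y : HH} (hy : y ≠ 0) (u v : HH) :
    omCoord l (fun a => eDual a (act ((transport (radial y hy))⁻¹ : Sp2) u))
      (fun a => eDual a (act ((transport (radial y hy))⁻¹ : Sp2) v)) = ‖y‖ ^ 2 * om l y u v := by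
  have h : ‖y‖ ≠ 0 := norm_ne_zero_iff.2 hy
  simp only [← coframe_apply]
  rw [← om_eq_coframe]
  exact (om_smul_left l (inv_ne_zero h) y u v).trans (by rw [inv_inv])

theorem radialExt_eOmega (j i : Fin 3) {y : HH} (hy : y ≠ 0) (v : Fin 3 → HH) :
    radialExt (invForm (eOmega (Fin.castAdd 4 j) i)) y v
      = wedge12 (fun n => eta j y (v n)) (fun n m => om i y (v n) (v m)) := by
  have h : ‖y‖ ≠ 0 := norm_ne_zero_iff.2 hy
  rw [radialExt_apply _ hy, invForm_apply, eOmega_apply]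
  simp only [om_radial, eta_radial, wedge12]
  field_simp

theorem radialExt_eeOmega (j k i : Fin 3) {y : HH} (hy : y ≠ 0) (v : Fin 4 → HH) :
    radialExt (invForm (eeOmega (Fin.castAdd 4 j) (Fin.castAdd 4 k) i)) y v
      = wedge112 (fun n => eta j y (v n)) (fun n => eta k y (v n))
        (fun n m => om i y (v n) (v m)) := by
  have h : ‖y‖ ≠ 0 := norm_ne_zero_iff.2 hy
  rw [radialExt_apply _ hy, invForm_apply, eeOmega_apply]
  simp only [om_radial, eta_radial, wedge112]
  field_simp

theorem radialExt_horizontal {y : HH} (hy : y ≠ 0) (v : Fin 4 → HH) :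
    radialExt (invForm (eForm ![3, 4, 5, 6])) y v = wedge22 (fun n m => om 2 y (v n) (v m)) := by
  have h : ‖y‖ ≠ 0 := norm_ne_zero_iff.2 hy
  rw [radialExt_apply _ hy, invForm_apply, eForm_horizontal_apply]
  simp only [om_radial, wedge22]
  rw [inv_pow]
  field_simp

theorem radialExt_vertical {y : HH} (hy : y ≠ 0) (v : Fin 3 → HH) :
    radialExt (invForm (eForm ![0, 1, 2])) y v
      = (Matrix.of fun a b : Fin 3 => eta b y (v a)).det := by
  have h : ‖y‖ ≠ 0 := norm_ne_zero_iff.2 hy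
  rw [radialExt_apply _ hy, invForm_apply, eForm_vertical_apply]
  simp only [eta_radial, Matrix.det_fin_three, Matrix.of_apply]
  rw [inv_pow]
  field_simp

theorem contDiffOn_eta (l : Fin 3) (u : HH) : ContDiffOn ℝ ∞ (fun y => eta l y u) {0}ᶜ := by
  have h : ∀ y ∈ ({0}ᶜ : Set HH), ‖y‖ ^ 2 ≠ 0 := fun y hy => pow_ne_zero _ (norm_ne_zero_iff.2 hy)
  unfold eta
  refine ContDiffOn.mul (ContDiffOn.inv (contDiff_norm_sq ℝ).contDiffOn h) ?_
  exact ((rmul l).contDiff.inner ℝ contDiff_const).contDiffOn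

theorem contDiffOn_om (l : Fin 3) (u v : HH) : ContDiffOn ℝ ∞ (fun y => om l y u v) {0}ᶜ := by
  have h : ∀ y ∈ ({0}ᶜ : Set HH), ‖y‖ ^ 2 ≠ 0 := fun y hy => pow_ne_zero _ (norm_ne_zero_iff.2 hy)
  have h1 : ContDiffOn ℝ ∞ (fun y : HH => (‖y‖ ^ 2)⁻¹) {0}ᶜ :=
    ContDiffOn.inv (contDiff_norm_sq ℝ).contDiffOn h
  have h2 := contDiffOn_eta
  have h3 : ∀ u : HH, ContDiffOn ℝ ∞ (fun y : HH => ⟪y, u⟫) {0}ᶜ := fun u =>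
    (contDiff_id.inner ℝ contDiff_const).contDiffOn
  have h4 : ∀ u : HH, ContDiffOn ℝ ∞ (fun y : HH => ⟪rmul l y, u⟫) {0}ᶜ := fun u =>
    ((rmul l).contDiff.inner ℝ contDiff_const).contDiffOn
  unfold om
  exact contDiffOn_const.mul ((h1.mul (contDiffOn_const.sub
    (h1.mul (((h3 u).mul (h4 v)).sub ((h3 v).mul (h4 u)))))).add
    (((h2 _ u).mul (h2 _ v)).sub ((h2 _ u).mul (h2 _ v))))

/-- An injective linear map has a linear left inverse, which is continuous because it is defined on
a finite-dimensional space. -/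
theorem contDiffOn_of_injective_comp {E W V : Type*} [NormedAddCommGroup E] [NormedSpace ℝ E]
    [NormedAddCommGroup W] [NormedSpace ℝ W] [NormedAddCommGroup V] [NormedSpace ℝ V]
    [FiniteDimensional ℝ V] (T : W →ₗ[ℝ] V) (hT : Function.Injective T) {f : E → W} {s : Set E}
    (h : ContDiffOn ℝ ∞ (fun y => T (f y)) s) : ContDiffOn ℝ ∞ f s := by
  obtain ⟨L, hL⟩ := T.exists_leftInverse_of_injective (LinearMap.ker_eq_bot.2 hT)
  have h1 : f = fun y => LinearMap.toContinuousLinearMap L (T (f y)) := by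
    funext y
    exact (LinearMap.congr_fun hL (f y)).symm
  rw [h1]
  exact (LinearMap.toContinuousLinearMap L).contDiff.comp_contDiffOn h

/-- The values of an alternating form on the vectors of a basis. -/
def basisValues (k : ℕ) :
    (HH [⋀^Fin k]→L[ℝ] ℝ) →ₗ[ℝ] ((Fin k → Fin (Module.finrank ℝ HH)) → ℝ) where
  toFun α n := α fun i => Module.finBasis ℝ HH (n i)
  map_add' _ _ := rfl
  map_smul' _ _ := rfl

theorem basisValues_injective (k : ℕ) : Function.Injective (basisValues k) := by
  intro α β hαβ
  refine ContinuousAlternatingMap.toAlternatingMap_injective ?_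
  exact Module.Basis.ext_alternating (Module.finBasis ℝ HH) fun n _ => congrFun hαβ n

/-- Smoothness of a family of alternating forms may be tested on vectors. -/
theorem contDiffOn_of_apply {E : Type*} [NormedAddCommGroup E] [NormedSpace ℝ E] {k : ℕ}
    {f : E → HH [⋀^Fin k]→L[ℝ] ℝ} {s : Set E}
    (h : ∀ v, ContDiffOn ℝ ∞ (fun y => f y v) s) : ContDiffOn ℝ ∞ f s :=
  contDiffOn_of_injective_comp (basisValues k) (basisValues_injective k)
    (contDiffOn_pi.2 fun _ => h _)

theorem contDiffOn_radialExt {k : ℕ} {α : Form k} {f : HH → (Fin k → HH) → ℝ}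
    (hα : ∀ y, y ≠ 0 → ∀ v, radialExt α y v = f y v)
    (hf : ∀ v, ContDiffOn ℝ ∞ (fun y => f y v) {0}ᶜ) : ContDiffOn ℝ ∞ (radialExt α) {0}ᶜ :=
  contDiffOn_of_apply fun v => (hf v).congr fun y hy => hα y hy v

theorem contDiffOn_eOmega (j i : Fin 3) :
    ContDiffOn ℝ ∞ (radialExt (invForm (eOmega (Fin.castAdd 4 j) i))) {0}ᶜ := by
  refine contDiffOn_radialExt (fun y hy v => radialExt_eOmega j i hy v) fun v => ?_
  have h1 := contDiffOn_eta
  have h2 := contDiffOn_om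
  unfold wedge12
  fun_prop

theorem contDiffOn_eeOmega (j k i : Fin 3) : ContDiffOn ℝ ∞
    (radialExt (invForm (eeOmega (Fin.castAdd 4 j) (Fin.castAdd 4 k) i))) {0}ᶜ := by
  refine contDiffOn_radialExt (fun y hy v => radialExt_eeOmega j k i hy v) fun v => ?_
  have h1 := contDiffOn_eta
  have h2 := contDiffOn_om
  unfold wedge112
  fun_prop

theorem contDiffOn_horizontal :
    ContDiffOn ℝ ∞ (radialExt (invForm (eForm ![3, 4, 5, 6]))) {0}ᶜ := by
  refine contDiffOn_radialExt (fun y hy v => radialExt_horizontal hy v) fun v => ?_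
  have h2 := contDiffOn_om
  unfold wedge22
  fun_prop

theorem contDiffOn_vertical :
    ContDiffOn ℝ ∞ (radialExt (invForm (eForm ![0, 1, 2]))) {0}ᶜ := by
  refine contDiffOn_radialExt (fun y hy v => radialExt_vertical hy v) fun v => ?_
  have h1 := contDiffOn_eta
  simp only [Matrix.det_fin_three, Matrix.of_apply]
  fun_prop

/-! ### The exterior derivative -/

theorem radialExt_add {k : ℕ} (α β : Form k) : radialExt (α + β) = radialExt α + radialExt β := by
  funext y
  by_cases hy : y = 0 <;> simp [radialExt, hy]

theorem radialExt_smul {k : ℕ} (c : ℝ) (α : Form k) :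
    radialExt (c • α) = c • radialExt α := by
  funext y
  by_cases hy : y = 0 <;> simp [radialExt, hy, smul_comm c]

theorem coe_ne_zero (x : S7) : (x : HH) ≠ 0 := by
  rw [← norm_ne_zero_iff, norm_coe]; exact one_ne_zero

theorem differentiableAt_radialExt {k : ℕ} {α : Form k}
    (h : ContDiffOn ℝ ∞ (radialExt α) {0}ᶜ) (x : S7) : DifferentiableAt ℝ (radialExt α) x :=
  (h.contDiffAt (isOpen_compl_singleton.mem_nhds (coe_ne_zero x))).differentiableAt (by simp)

theorem d_add {k : ℕ} {α β : Form k} (hα : ContDiffOn ℝ ∞ (radialExt α) {0}ᶜ)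
    (hβ : ContDiffOn ℝ ∞ (radialExt β) {0}ᶜ) : d (α + β) = d α + d β := by
  funext x
  rw [d, radialExt_add, extDeriv_add (differentiableAt_radialExt hα x)
    (differentiableAt_radialExt hβ x)]
  rfl

theorem d_smul {k : ℕ} (c : ℝ) (α : Form k) : d (c • α) = c • d α := by
  funext x
  rw [d, radialExt_smul, extDeriv_smul]
  rfl

theorem d_zero {k : ℕ} : d (0 : Form k) = 0 := by
  rw [← zero_smul ℝ (0 : Form k), d_smul, zero_smul]

theorem contDiffOn_sum {k : ℕ} {ι : Type*} (s : Finset ι) {α : ι → Form k}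
    (hα : ∀ i ∈ s, ContDiffOn ℝ ∞ (radialExt (α i)) {0}ᶜ) :
    ContDiffOn ℝ ∞ (radialExt (∑ i ∈ s, α i)) {0}ᶜ := by
  classical
  induction s using Finset.induction_on with
  | empty =>
    refine (contDiffOn_const (c := (0 : HH [⋀^Fin k]→L[ℝ] ℝ))).congr fun y _ => ?_
    simp [radialExt]
  | insert i s hi ih =>
    rw [Finset.sum_insert hi, radialExt_add]
    exact (hα i (Finset.mem_insert_self i s)).add
      (ih fun j hj => hα j (Finset.mem_insert_of_mem hj))

theorem d_sum {k : ℕ} {ι : Type*} (s : Finset ι) {α : ι → Form k}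
    (hα : ∀ i ∈ s, ContDiffOn ℝ ∞ (radialExt (α i)) {0}ᶜ) :
    d (∑ i ∈ s, α i) = ∑ i ∈ s, d (α i) := by
  classical
  induction s using Finset.induction_on with
  | empty => simp [d_zero]
  | insert i s hi ih =>
    have h := fun j hj => hα j (Finset.mem_insert_of_mem hj)
    rw [Finset.sum_insert hi, Finset.sum_insert hi, d_add (hα i (Finset.mem_insert_self i s))
      (contDiffOn_sum s h), ih h]

/-- On a vector space the exterior derivative is the alternating sum of directional derivatives with
the other arguments held constant. So derivatives of scalar functions along lines suffice, and these
lines avoid the origin near x. -/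
theorem d_apply_of_hasDerivAt {k : ℕ} {α : Form k} (hα : ContDiffOn ℝ ∞ (radialExt α) {0}ᶜ)
    {f : HH → (Fin k → HH) → ℝ} (hf : ∀ y, y ≠ 0 → ∀ v, radialExt α y v = f y v) (x : S7)
    {f' : HH → (Fin k → HH) → ℝ}
    (hf' : ∀ w v, HasDerivAt (fun t : ℝ => f (x + t • w) v) (f' w v) 0) (v : Fin (k + 1) → HH) :
    d α x v = ∑ i : Fin (k + 1), (-1) ^ (i : ℕ) * f' (v i) (i.removeNth v) := by
  have hd := differentiableAt_radialExt hα x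
  rw [d, extDeriv_apply hd]
  refine Finset.sum_congr rfl fun i _ => ?_
  have h1 : DifferentiableAt ℝ (fun y => radialExt α y (i.removeNth v)) x :=
    hd.continuousAlternatingMap_apply_const _
  have h2 := h1.hasFDerivAt.hasLineDerivAt (v i)
  have h3 : HasLineDerivAt ℝ (fun y => radialExt α y (i.removeNth v))
      (f' (v i) (i.removeNth v)) x (v i) := by
    refine (hf' (v i) (i.removeNth v)).congr_of_eventuallyEq ?_
    have hc : ContinuousAt (fun t : ℝ => (x : HH) + t • v i) 0 := by fun_prop
    have hne : ∀ᶠ t : ℝ in nhds 0, (x : HH) + t • v i ≠ 0 :=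
      hc.eventually_ne (by simpa using coe_ne_zero x)
    filter_upwards [hne] with t ht using hf _ ht _
  rw [h2.lineDeriv.symm.trans h3.lineDeriv, zsmul_eq_mul]
  push_cast
  rfl

/-! ### The structure equations -/

/-- The derivative of `eta l` at `x` in the direction `w`. -/
def derivEta (l : Fin 3) (x w u : HH) : ℝ := ⟪rmul l w, u⟫ - 2 * ⟪x, w⟫ * ⟪rmul l x, u⟫

/-- The derivative of `om l` at `x` in the direction `w`. -/
def derivOm (l : Fin 3) (x w u v : HH) : ℝ :=
  2 * eps l * (-2 * ⟪x, w⟫ * (⟪rmul l u, v⟫ - (⟪x, u⟫ * ⟪rmul l x, v⟫ - ⟪x, v⟫ * ⟪rmul l x, u⟫))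
      - (-2 * ⟪x, w⟫ * (⟪x, u⟫ * ⟪rmul l x, v⟫ - ⟪x, v⟫ * ⟪rmul l x, u⟫)
        + (⟪w, u⟫ * ⟪rmul l x, v⟫ + ⟪x, u⟫ * ⟪rmul l w, v⟫
          - (⟪w, v⟫ * ⟪rmul l x, u⟫ + ⟪x, v⟫ * ⟪rmul l w, u⟫)))
    + (derivEta (l + 1) x w u * eta (l + 2) x v + eta (l + 1) x u * derivEta (l + 2) x w v
      - (derivEta (l + 2) x w u * eta (l + 1) x v + eta (l + 2) x u * derivEta (l + 1) x w v)))

theorem hasDerivAt_line (x w : HH) : HasDerivAt (fun t : ℝ => x + t • w) w 0 := by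
  simpa using ((hasDerivAt_id (0 : ℝ)).smul_const w).const_add x

theorem hasDerivAt_inner_line (x w u : HH) :
    HasDerivAt (fun t : ℝ => ⟪x + t • w, u⟫) ⟪w, u⟫ 0 := by
  simp only [inner_add_left, real_inner_smul_left]
  simpa using ((hasDerivAt_id (0 : ℝ)).mul_const ⟪w, u⟫).const_add ⟪x, u⟫

theorem hasDerivAt_rmul_line (l : Fin 3) (x w u : HH) :
    HasDerivAt (fun t : ℝ => ⟪rmul l (x + t • w), u⟫) ⟪rmul l w, u⟫ 0 := by
  simp only [map_add, map_smul]
  exact hasDerivAt_inner_line _ _ _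

theorem hasDerivAt_norm_sq_inv {x : HH} (hx : ‖x‖ = 1) (w : HH) :
    HasDerivAt (fun t : ℝ => (‖x + t • w‖ ^ 2)⁻¹) (-2 * ⟪x, w⟫) 0 := by
  have h := ((hasDerivAt_line x w).norm_sq).inv (by simp [hx])
  convert! h using 1
  simp [hx]

theorem hasDerivAt_eta {x : HH} (hx : ‖x‖ = 1) (l : Fin 3) (w u : HH) :
    HasDerivAt (fun t : ℝ => eta l (x + t • w) u) (derivEta l x w u) 0 := by
  have h := (hasDerivAt_norm_sq_inv hx w).mul (hasDerivAt_rmul_line l x w u)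
  refine h.congr_deriv ?_
  simp [hx, derivEta]
  ring

theorem hasDerivAt_om {x : HH} (hx : ‖x‖ = 1) (l : Fin 3) (w u v : HH) :
    HasDerivAt (fun t : ℝ => om l (x + t • w) u v) (derivOm l x w u v) 0 := by
  have hn := hasDerivAt_norm_sq_inv hx w
  have hi := hasDerivAt_inner_line x w
  have hr := hasDerivAt_rmul_line l x w
  have he := fun l u => hasDerivAt_eta hx l w u
  have h := ((hn.mul ((hasDerivAt_const (0 : ℝ) ⟪rmul l u, v⟫).sub
    (hn.mul (((hi u).mul (hr v)).sub ((hi v).mul (hr u)))))).add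
    (((he (l + 1) u).mul (he (l + 2) v)).sub ((he (l + 2) u).mul (he (l + 1) v)))).const_mul
    (2 * eps l)
  refine h.congr_deriv ?_
  simp [hx, derivOm]
  left
  ring

theorem eps_mul_self (l : Fin 3) : eps l * eps l = 1 := by
  fin_cases l <;> simp [eps]

theorem eps_mul_om {x : HH} (hx : ‖x‖ = 1) (l : Fin 3) (u v : HH) :
    eps l * om l x u v = 2 * (⟪rmul l u, v⟫
      - (⟪x, u⟫ * ⟪rmul l x, v⟫ - ⟪x, v⟫ * ⟪rmul l x, u⟫)
      + (⟪rmul (l + 1) x, u⟫ * ⟪rmul (l + 2) x, v⟫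
        - ⟪rmul (l + 2) x, u⟫ * ⟪rmul (l + 1) x, v⟫)) := by
  have := eps_mul_self l
  simp only [om, eta, hx]
  linear_combination (2 * (⟪rmul l u, v⟫
      - (⟪x, u⟫ * ⟪rmul l x, v⟫ - ⟪x, v⟫ * ⟪rmul l x, u⟫)
      + (⟪rmul (l + 1) x, u⟫ * ⟪rmul (l + 2) x, v⟫
        - ⟪rmul (l + 2) x, u⟫ * ⟪rmul (l + 1) x, v⟫))) * this

/-- The structure equation for `deˡ`. -/
theorem derivEta_sub {x : HH} (hx : ‖x‖ = 1) (l : Fin 3) (u v : HH) :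
    derivEta l x u v - derivEta l x v u = eps l * om l x u v
      - 2 * (eta (l + 1) x u * eta (l + 2) x v - eta (l + 2) x u * eta (l + 1) x v) := by
  rw [eps_mul_om hx]
  simp only [derivEta, eta, hx, inner_rmul_comm l v u]
  ring

/-- The structure equation for `dωₗ`. -/
theorem derivOm_sub_add {x : HH} (hx : ‖x‖ = 1) (l : Fin 3) (u v w : HH) :
    derivOm l x u v w - derivOm l x v u w + derivOm l x w u v
      = 2 * eps l * (eta (l + 2) x u * (eps (l + 1) * om (l + 1) x v w)
          - eta (l + 2) x v * (eps (l + 1) * om (l + 1) x u w)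
          + eta (l + 2) x w * (eps (l + 1) * om (l + 1) x u v)
        - (eta (l + 1) x u * (eps (l + 2) * om (l + 2) x v w)
          - eta (l + 1) x v * (eps (l + 2) * om (l + 2) x u w)
          + eta (l + 1) x w * (eps (l + 2) * om (l + 2) x u v))) := by
  have i1 : l + 1 + 1 = l + 2 := by fin_cases l <;> rfl
  have i2 : l + 1 + 2 = l := by fin_cases l <;> rfl
  have i3 : l + 2 + 1 = l := by fin_cases l <;> rfl
  have i4 : l + 2 + 2 = l + 1 := by fin_cases l <;> rfl
  simp only [eps_mul_om hx, i1, i2, i3, i4, derivOm, derivEta, eta, hx,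
    real_inner_comm u v, real_inner_comm u w, real_inner_comm v w]
  -- Skew symmetry of right multiplication brings all inner products to one order of u, v, w, after
  -- which the identity is polynomial.
  rw [inner_rmul_comm l v u, inner_rmul_comm l w u, inner_rmul_comm l w v,
    inner_rmul_comm (l + 1) v u, inner_rmul_comm (l + 1) w u, inner_rmul_comm (l + 1) w v,
    inner_rmul_comm (l + 2) v u, inner_rmul_comm (l + 2) w u, inner_rmul_comm (l + 2) w v]
  ring

/-! ### Exterior derivatives of the invariant forms -/

section Wedge

variable {R : Type*} [CommRing R]

/-- The value of the wedge product of two `2`-forms. -/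
def wedge2and2 (w w' : Fin 4 → Fin 4 → R) : R :=
  w 0 1 * w' 2 3 - w 0 2 * w' 1 3 + w 0 3 * w' 1 2 + w 1 2 * w' 0 3 - w 1 3 * w' 0 2
    + w 2 3 * w' 0 1

/-- The value of the wedge product of a `1`-form and a `3`-form. -/
def wedge1and3 (a : Fin 4 → R) (t : Fin 4 → Fin 4 → Fin 4 → R) : R :=
  a 0 * t 1 2 3 - a 1 * t 0 2 3 + a 2 * t 0 1 3 - a 3 * t 0 1 2

/-- The value of the wedge product of a `2`-form and a `3`-form. -/
def wedge2and3 (w : Fin 5 → Fin 5 → R) (t : Fin 5 → Fin 5 → Fin 5 → R) : R :=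
  w 0 1 * t 2 3 4 - w 0 2 * t 1 3 4 + w 0 3 * t 1 2 4 - w 0 4 * t 1 2 3 + w 1 2 * t 0 3 4
    - w 1 3 * t 0 2 4 + w 1 4 * t 0 2 3 + w 2 3 * t 0 1 4 - w 2 4 * t 0 1 3 + w 3 4 * t 0 1 2

/-- The value of the wedge product of a `1`-form and a `4`-form. -/
def wedge1and4 (a : Fin 5 → R) (f : Fin 5 → Fin 5 → Fin 5 → Fin 5 → R) : R :=
  a 0 * f 1 2 3 4 - a 1 * f 0 2 3 4 + a 2 * f 0 1 3 4 - a 3 * f 0 1 2 4 + a 4 * f 0 1 2 3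

end Wedge

/-- The value of `deˡ`. -/
def dEta (l : Fin 3) (x u v : HH) : ℝ :=
  eps l * om l x u v - 2 * (eta (l + 1) x u * eta (l + 2) x v - eta (l + 2) x u * eta (l + 1) x v)

/-- The value of `dωₗ`. -/
def dOm (l : Fin 3) (x u v w : HH) : ℝ :=
  2 * eps l * (eta (l + 2) x u * (eps (l + 1) * om (l + 1) x v w)
      - eta (l + 2) x v * (eps (l + 1) * om (l + 1) x u w)
      + eta (l + 2) x w * (eps (l + 1) * om (l + 1) x u v)
    - (eta (l + 1) x u * (eps (l + 2) * om (l + 2) x v w)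
      - eta (l + 1) x v * (eps (l + 2) * om (l + 2) x u w)
      + eta (l + 1) x w * (eps (l + 2) * om (l + 2) x u v)))

theorem d_vertical_apply (x : S7) (v : Fin 4 → HH) :
    d (invForm (eForm ![0, 1, 2])) x v
      = ∑ l : Fin 3, wedge2and2 (fun n m => dEta l x (v n) (v m)) (fun n m =>
        eta (l + 1) x (v n) * eta (l + 2) x (v m) - eta (l + 2) x (v n) * eta (l + 1) x (v m)) := by
  have he := fun l w u => hasDerivAt_eta (norm_coe x) l w u
  have hs := fun l u v => derivEta_sub (norm_coe x) l u v
  rw [d_apply_of_hasDerivAt contDiffOn_vertical (fun y hy v => radialExt_vertical hy v) x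
    (f' := fun w u =>
      derivEta 0 x w (u 0) * (eta 1 x (u 1) * eta 2 x (u 2) - eta 2 x (u 1) * eta 1 x (u 2))
      + eta 0 x (u 0) * (derivEta 1 x w (u 1) * eta 2 x (u 2) + eta 1 x (u 1) * derivEta 2 x w (u 2)
        - (derivEta 2 x w (u 1) * eta 1 x (u 2) + eta 2 x (u 1) * derivEta 1 x w (u 2)))
      - (derivEta 0 x w (u 1) * (eta 1 x (u 0) * eta 2 x (u 2) - eta 2 x (u 0) * eta 1 x (u 2))
      + eta 0 x (u 1) * (derivEta 1 x w (u 0) * eta 2 x (u 2) + eta 1 x (u 0) * derivEta 2 x w (u 2)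
        - (derivEta 2 x w (u 0) * eta 1 x (u 2) + eta 2 x (u 0) * derivEta 1 x w (u 2))))
      + (derivEta 0 x w (u 2) * (eta 1 x (u 0) * eta 2 x (u 1) - eta 2 x (u 0) * eta 1 x (u 1))
      + eta 0 x (u 2) * (derivEta 1 x w (u 0) * eta 2 x (u 1) + eta 1 x (u 0) * derivEta 2 x w (u 1)
        - (derivEta 2 x w (u 0) * eta 1 x (u 1) + eta 2 x (u 0) * derivEta 1 x w (u 1)))))]
  · refine (Fin.sum_univ_four _).trans ?_
    simp only [Fin.sum_univ_three, Fin.removeNth, wedge2and2, dEta, ← hs]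
    simp [Fin.succAbove]
    ring
  · intro w u
    have h := (((he 0 w (u 0)).mul (((he 1 w (u 1)).mul (he 2 w (u 2))).sub
      ((he 2 w (u 1)).mul (he 1 w (u 2))))).sub
      ((he 0 w (u 1)).mul (((he 1 w (u 0)).mul (he 2 w (u 2))).sub
      ((he 2 w (u 0)).mul (he 1 w (u 2)))))).add
      ((he 0 w (u 2)).mul (((he 1 w (u 0)).mul (he 2 w (u 1))).sub
      ((he 2 w (u 0)).mul (he 1 w (u 1)))))
    convert! h using 1
    · funext t
      simp [Matrix.det_fin_three]
      ring
    · simp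

/-- Leibniz rule d(eʲ ∧ ωᵢ) = deʲ ∧ ωᵢ − eʲ ∧ dωᵢ: the alternated derivatives combine into the
structure equations. -/
theorem d_eOmega_apply (j i : Fin 3) (x : S7) (v : Fin 4 → HH) :
    d (invForm (eOmega (Fin.castAdd 4 j) i)) x v
      = wedge2and2 (fun n m => dEta j x (v n) (v m)) (fun n m => om i x (v n) (v m))
        - wedge1and3 (fun n => eta j x (v n)) (fun n m k => dOm i x (v n) (v m) (v k)) := by
  have he := fun l w u => hasDerivAt_eta (norm_coe x) l w u
  have ho := fun l w u v => hasDerivAt_om (norm_coe x) l w u v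
  have hs := fun l u v => derivEta_sub (norm_coe x) l u v
  have hs' := fun l u v w => derivOm_sub_add (norm_coe x) l u v w
  rw [d_apply_of_hasDerivAt (contDiffOn_eOmega j i) (fun y hy v => radialExt_eOmega j i hy v) x
    (f' := fun w u =>
      derivEta j x w (u 0) * om i x (u 1) (u 2) + eta j x (u 0) * derivOm i x w (u 1) (u 2)
      - (derivEta j x w (u 1) * om i x (u 0) (u 2) + eta j x (u 1) * derivOm i x w (u 0) (u 2))
      + (derivEta j x w (u 2) * om i x (u 0) (u 1) + eta j x (u 2) * derivOm i x w (u 0) (u 1)))]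
  · refine (Fin.sum_univ_four _).trans ?_
    simp only [Fin.removeNth, wedge2and2, wedge1and3, dEta, dOm, ← hs, ← hs']
    simp [Fin.succAbove]
    ring
  · intro w u
    have h := (((he j w (u 0)).mul (ho i w (u 1) (u 2))).sub
      ((he j w (u 1)).mul (ho i w (u 0) (u 2)))).add ((he j w (u 2)).mul (ho i w (u 0) (u 1)))
    convert! h using 1
    simp

/-- Since e⁴⁵⁶⁷ = ½ ω₃ ∧ ω₃, its derivative is ω₃ ∧ dω₃. -/
theorem d_horizontal_apply (x : S7) (v : Fin 5 → HH) :
    d (invForm (eForm ![3, 4, 5, 6])) x v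
      = wedge2and3 (fun n m => om 2 x (v n) (v m)) (fun n m k => dOm 2 x (v n) (v m) (v k)) := by
  have ho := fun l w u v => hasDerivAt_om (norm_coe x) l w u v
  have hs' := fun l u v w => derivOm_sub_add (norm_coe x) l u v w
  rw [d_apply_of_hasDerivAt contDiffOn_horizontal (fun y hy v => radialExt_horizontal hy v) x
    (f' := fun w u =>
      derivOm 2 x w (u 0) (u 1) * om 2 x (u 2) (u 3)
        + om 2 x (u 0) (u 1) * derivOm 2 x w (u 2) (u 3)
      - (derivOm 2 x w (u 0) (u 2) * om 2 x (u 1) (u 3)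
        + om 2 x (u 0) (u 2) * derivOm 2 x w (u 1) (u 3))
      + (derivOm 2 x w (u 0) (u 3) * om 2 x (u 1) (u 2)
        + om 2 x (u 0) (u 3) * derivOm 2 x w (u 1) (u 2)))]
  · refine (Fin.sum_univ_five _).trans ?_
    simp only [Fin.removeNth, wedge2and3, dOm, ← hs']
    simp [Fin.succAbove]
    ring
  · intro w u
    have h := (((ho 2 w (u 0) (u 1)).mul (ho 2 w (u 2) (u 3))).sub
      ((ho 2 w (u 0) (u 2)).mul (ho 2 w (u 1) (u 3)))).add
      ((ho 2 w (u 0) (u 3)).mul (ho 2 w (u 1) (u 2)))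
    convert! h using 1
    simp

theorem d_eeOmega_apply (j k i : Fin 3) (x : S7) (v : Fin 5 → HH) :
    d (invForm (eeOmega (Fin.castAdd 4 j) (Fin.castAdd 4 k) i)) x v
      = wedge2and3 (fun n m => dEta j x (v n) (v m)) (fun n m p => wedge12
          ![eta k x (v n), eta k x (v m), eta k x (v p)]
          (fun a b => om i x (v (![n, m, p] a)) (v (![n, m, p] b))))
        - wedge2and3 (fun n m => dEta k x (v n) (v m)) (fun n m p => wedge12
          ![eta j x (v n), eta j x (v m), eta j x (v p)]
          (fun a b => om i x (v (![n, m, p] a)) (v (![n, m, p] b))))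
        + wedge2and3 (fun n m => eta j x (v n) * eta k x (v m) - eta j x (v m) * eta k x (v n))
          (fun n m p => dOm i x (v n) (v m) (v p)) := by
  have he := fun l w u => hasDerivAt_eta (norm_coe x) l w u
  have ho := fun l w u v => hasDerivAt_om (norm_coe x) l w u v
  have hs := fun l u v => derivEta_sub (norm_coe x) l u v
  have hs' := fun l u v w => derivOm_sub_add (norm_coe x) l u v w
  have term : ∀ w u₀ u₁ u₂ u₃ : HH, HasDerivAt (fun t : ℝ =>
      (eta j (x + t • w) u₀ * eta k (x + t • w) u₁ - eta j (x + t • w) u₁ * eta k (x + t • w) u₀)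
        * om i (x + t • w) u₂ u₃)
      ((derivEta j x w u₀ * eta k x u₁ + eta j x u₀ * derivEta k x w u₁
        - (derivEta j x w u₁ * eta k x u₀ + eta j x u₁ * derivEta k x w u₀)) * om i x u₂ u₃
        + (eta j x u₀ * eta k x u₁ - eta j x u₁ * eta k x u₀) * derivOm i x w u₂ u₃) 0 := by
    intro w u₀ u₁ u₂ u₃
    have h := (((he j w u₀).mul (he k w u₁)).sub ((he j w u₁).mul (he k w u₀))).mul (ho i w u₂ u₃)
    convert! h using 1
    simp
  -- `T` is the derivative of one summand; eʲ ∧ eᵏ ∧ ωᵢ is the signed sum over the six ways to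
  -- distribute four vectors into two pairs.
  obtain ⟨T, hT⟩ : ∃ T : HH → HH → HH → HH → HH → ℝ, T = fun w u₀ u₁ u₂ u₃ =>
      ((derivEta j x w u₀ * eta k x u₁ + eta j x u₀ * derivEta k x w u₁
        - (derivEta j x w u₁ * eta k x u₀ + eta j x u₁ * derivEta k x w u₀)) * om i x u₂ u₃
        + (eta j x u₀ * eta k x u₁ - eta j x u₁ * eta k x u₀) * derivOm i x w u₂ u₃) := ⟨_, rfl⟩
  rw [d_apply_of_hasDerivAt (contDiffOn_eeOmega j k i)
    (fun y hy v => radialExt_eeOmega j k i hy v) x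
    (f' := fun w u => T w (u 0) (u 1) (u 2) (u 3) - T w (u 0) (u 2) (u 1) (u 3)
      + T w (u 0) (u 3) (u 1) (u 2) + T w (u 1) (u 2) (u 0) (u 3) - T w (u 1) (u 3) (u 0) (u 2)
      + T w (u 2) (u 3) (u 0) (u 1))]
  · refine (Fin.sum_univ_five _).trans ?_
    simp only [Fin.removeNth, wedge2and3, wedge12, dEta, dOm, ← hs, ← hs', hT]
    simp [Fin.succAbove]
    ring
  · intro w u
    rw [hT]
    exact (((((term w (u 0) (u 1) (u 2) (u 3)).sub (term w (u 0) (u 2) (u 1) (u 3))).add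
      (term w (u 0) (u 3) (u 1) (u 2))).add (term w (u 1) (u 2) (u 0) (u 3))).sub
      (term w (u 1) (u 3) (u 0) (u 2))).add (term w (u 2) (u 3) (u 0) (u 1))

/-! ### Exterior derivatives in terms of the coframe -/

/-- The value of `e^j ∧ e^k ∧ ωᵢ` in terms of the coordinates of the vectors. -/
def eeCoord (j k i : Fin 3) (p : Fin 4 → Fin 7 → ℝ) : ℝ :=
  wedge112 (fun n => p n (Fin.castAdd 4 j)) (fun n => p n (Fin.castAdd 4 k))
    (fun n m => omCoord i (p n) (p m))

/-- The value of `e^m ∧ e⁴⁵⁶⁷ + εₘ e¹²³ ∧ ωₘ` in terms of the coordinates of the vectors. -/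
def fiveCoord (m : Fin 3) (p : Fin 5 → Fin 7 → ℝ) : ℝ :=
  wedge1and4 (fun n => p n (Fin.castAdd 4 m)) (fun a b c e => det4 3 4 5 6 (p a) (p b) (p c) (p e))
    + eps m * wedge2and3 (fun n k => omCoord m (p n) (p k))
      (fun a b c => det3 0 1 2 (p a) (p b) (p c))

theorem castAdd_zero : Fin.castAdd 4 (0 : Fin 3) = (0 : Fin 7) := rfl
theorem castAdd_one : Fin.castAdd 4 (1 : Fin 3) = (1 : Fin 7) := rfl
theorem castAdd_two : Fin.castAdd 4 (2 : Fin 3) = (2 : Fin 7) := rfl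

/-- The part −2eˡ⁺¹ ∧ eˡ⁺² of deˡ is annihilated by eˡ⁺¹ ∧ eˡ⁺²; only εₗωₗ survives. -/
theorem d_vertical_coframe (x : S7) (v : Fin 4 → HH) :
    d (invForm (eForm ![0, 1, 2])) x v
      = ∑ l : Fin 3, eps l * eeCoord (l + 1) (l + 2) l (fun n a => coframe x a (v n)) := by
  rw [d_vertical_apply]
  simp only [dEta, eta_eq_coframe, om_eq_coframe]
  refine Finset.sum_congr rfl fun l _ => ?_
  obtain ⟨p, hp⟩ : ∃ p : Fin 4 → Fin 7 → ℝ, ∀ n a, coframe x a (v n) = p n a := ⟨_, fun _ _ => rfl⟩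
  simp only [hp, wedge2and2, eeCoord, wedge112]
  ring

theorem wedge2and2_omCoord (i j : Fin 3) (p : Fin 4 → Fin 7 → ℝ) :
    wedge2and2 (fun n m => omCoord i (p n) (p m)) (fun n m => omCoord j (p n) (p m))
      = if j = i then 2 * det4 3 4 5 6 (p 0) (p 1) (p 2) (p 3) else 0 := by
  fin_cases i <;> fin_cases j <;> simp [wedge2and2, omCoord, det4, det3] <;> ring

theorem d_eOmega_coframe (j i : Fin 3) (x : S7) (v : Fin 4 → HH) {p : Fin 4 → Fin 7 → ℝ}
    (hp : ∀ n a, coframe x a (v n) = p n a) :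
    d (invForm (eOmega (Fin.castAdd 4 j) i)) x v
      = eps j * (if i = j then 2 * det4 3 4 5 6 (p 0) (p 1) (p 2) (p 3) else 0)
        - 2 * eeCoord (j + 1) (j + 2) i p
        - 2 * eps i * (eps (i + 1) * eeCoord j (i + 2) (i + 1) p
          - eps (i + 2) * eeCoord j (i + 1) (i + 2) p) := by
  rw [d_eOmega_apply, ← wedge2and2_omCoord]
  simp only [dEta, dOm, eta_eq_coframe, om_eq_coframe, hp, wedge2and2, wedge1and3, eeCoord,
    wedge112]
  ring

/-- dω₃ involves only e¹ ∧ ω₂ and e² ∧ ω₁, and ω₃ ∧ ω₁ = ω₃ ∧ ω₂ = 0. -/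
theorem d_horizontal_eq_zero : d (invForm (eForm ![3, 4, 5, 6])) = 0 := by
  funext x
  ext v
  obtain ⟨p, hp⟩ : ∃ p : Fin 5 → Fin 7 → ℝ, ∀ n a, coframe x a (v n) = p n a := ⟨_, fun _ _ => rfl⟩
  rw [d_horizontal_apply]
  simp only [dOm, eta_eq_coframe, om_eq_coframe, hp]
  simp [wedge2and3, eps, castAdd_zero, castAdd_one, omCoord]
  ring

theorem wedge1and4_wedge2and2_omCoord (a : Fin 5 → ℝ) (i j : Fin 3) (p : Fin 5 → Fin 7 → ℝ) :
    wedge1and4 a (fun s t u w => wedge2and2 (fun n m => omCoord i (![p s, p t, p u, p w] n)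
      (![p s, p t, p u, p w] m)) (fun n m => omCoord j (![p s, p t, p u, p w] n)
      (![p s, p t, p u, p w] m)))
      = if j = i then
        2 * wedge1and4 a (fun s t u w => det4 3 4 5 6 (p s) (p t) (p u) (p w)) else 0 := by
  simp only [wedge2and2_omCoord]
  split_ifs
  · simp only [wedge1and4, Matrix.cons_val]
    ring
  · simp [wedge1and4]

set_option maxHeartbeats 400000 in
theorem d_eeOmega_coframe (l i : Fin 3) (x : S7) (v : Fin 5 → HH) {p : Fin 5 → Fin 7 → ℝ}
    (hp : ∀ n a, coframe x a (v n) = p n a) :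
    d (invForm (eeOmega (Fin.castAdd 4 (l + 1)) (Fin.castAdd 4 (l + 2)) i)) x v
      = 2 * eps i * ((if i = l + 1 then fiveCoord (l + 2) p else 0)
        - (if i = l + 2 then fiveCoord (l + 1) p else 0)) := by
  have h1 := wedge1and4_wedge2and2_omCoord (fun n => p n (Fin.castAdd 4 (l + 2))) (l + 1) i p
  have h2 := wedge1and4_wedge2and2_omCoord (fun n => p n (Fin.castAdd 4 (l + 1))) (l + 2) i p
  rw [d_eeOmega_apply]
  simp only [dEta, dOm, eta_eq_coframe, om_eq_coframe, hp]
  simp only [wedge1and4, wedge2and2, Matrix.cons_val] at h1 h2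
  simp only [wedge2and3, wedge12, Matrix.cons_val, fiveCoord, wedge1and4, det3]
  -- The 4 × 4 minors occur linearly and are matched through `h1` and `h2`, so they stay opaque in
  -- the polynomial identity.
  generalize det4 3 4 5 6 (p 0) (p 1) (p 2) (p 3) = d0 at *
  generalize det4 3 4 5 6 (p 0) (p 1) (p 2) (p 4) = d1 at *
  generalize det4 3 4 5 6 (p 0) (p 1) (p 3) (p 4) = d2 at *
  generalize det4 3 4 5 6 (p 0) (p 2) (p 3) (p 4) = d3 at *
  generalize det4 3 4 5 6 (p 1) (p 2) (p 3) (p 4) = d4 at *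
  fin_cases l
  · fin_cases i <;> simp [eps, castAdd_zero, castAdd_one, castAdd_two] at h1 h2 ⊢ <;>
      linear_combination h1 + h2
  · fin_cases i <;> simp [eps, castAdd_zero, castAdd_one, castAdd_two] at h1 h2 ⊢ <;>
      linear_combination h2 - h1
  · fin_cases i <;> simp [eps, castAdd_zero, castAdd_one, castAdd_two] at h1 h2 ⊢ <;>
      linear_combination -h1 - h2

/-! ### The invariant `3`- and `4`-forms -/

/-- The form `c e¹²³ + ∑ᵢⱼ Cᵢⱼ eʲ ∧ ωᵢ`. -/
def formAt (c : ℝ) (C : Matrix (Fin 3) (Fin 3) ℝ) : HH [⋀^Fin 3]→L[ℝ] ℝ :=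
  c • eForm ![0, 1, 2] + ∑ i : Fin 3, ∑ j : Fin 3, C i j • eOmega (Fin.castAdd 4 j) i

/-- The form `s e⁴⁵⁶⁷ + ∑ᵢₗ Bᵢₗ eˡ⁺¹ ∧ eˡ⁺² ∧ ωᵢ`. -/
def fourAt (s : ℝ) (B : Matrix (Fin 3) (Fin 3) ℝ) : HH [⋀^Fin 4]→L[ℝ] ℝ :=
  s • eForm ![3, 4, 5, 6] + ∑ i : Fin 3, ∑ l : Fin 3,
    B i l • eeOmega (Fin.castAdd 4 (l + 1)) (Fin.castAdd 4 (l + 2)) i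

theorem PhiAt_eq_formAt (a : ℝ) (D : Matrix (Fin 3) (Fin 3) ℝ) :
    PhiAt a D = formAt (a ^ 3) D⁻¹ := rfl

/-- The coordinates of the tangential part of a vector in the frame at `x`. -/
def coord (x : S7) (v : HH) : Fin 7 → ℝ := fun a => coframe x a v

/-- The value of `formAt` in terms of the coordinates of the vectors. -/
def formCoord (c : ℝ) (C : Matrix (Fin 3) (Fin 3) ℝ) (p : Fin 3 → Fin 7 → ℝ) : ℝ :=
  c * det3 0 1 2 (p 0) (p 1) (p 2) + ∑ i : Fin 3, ∑ j : Fin 3,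
    C i j * wedge12 (fun n => p n (Fin.castAdd 4 j)) (fun n m => omCoord i (p n) (p m))

/-- The value of `fourAt` in terms of the coordinates of the vectors. -/
def fourCoord (s : ℝ) (B : Matrix (Fin 3) (Fin 3) ℝ) (p : Fin 4 → Fin 7 → ℝ) : ℝ :=
  s * det4 3 4 5 6 (p 0) (p 1) (p 2) (p 3) + ∑ i : Fin 3, ∑ l : Fin 3,
    B i l * eeCoord (l + 1) (l + 2) i p

theorem formAt_apply (c : ℝ) (C : Matrix (Fin 3) (Fin 3) ℝ) (v : Fin 3 → HH) :
    formAt c C v = formCoord c C (fun n a => eDual a (v n)) := by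
  simp only [formAt, formCoord, ContinuousAlternatingMap.add_apply,
    ContinuousAlternatingMap.smul_apply, ContinuousAlternatingMap.sum_apply, eForm_three,
    eOmega_apply, smul_eq_mul]

theorem fourAt_apply (s : ℝ) (B : Matrix (Fin 3) (Fin 3) ℝ) (v : Fin 4 → HH) :
    fourAt s B v = fourCoord s B (fun n a => eDual a (v n)) := by
  simp only [fourAt, fourCoord, ContinuousAlternatingMap.add_apply,
    ContinuousAlternatingMap.smul_apply, ContinuousAlternatingMap.sum_apply, eForm_four,
    eeOmega_apply, smul_eq_mul, eeCoord]

theorem invForm_formAt_apply (c : ℝ) (C : Matrix (Fin 3) (Fin 3) ℝ) (x : S7) (v : Fin 3 → HH) :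
    invForm (formAt c C) x v = formCoord c C (fun n => coord x (v n)) := by
  rw [invForm_apply, formAt_apply]; rfl

theorem invForm_fourAt_apply (s : ℝ) (B : Matrix (Fin 3) (Fin 3) ℝ) (x : S7) (v : Fin 4 → HH) :
    invForm (fourAt s B) x v = fourCoord s B (fun n => coord x (v n)) := by
  rw [invForm_apply, fourAt_apply]; rfl

theorem invForm_add {k : ℕ} (α β : HH [⋀^Fin k]→L[ℝ] ℝ) :
    invForm (α + β) = invForm α + invForm β := rfl

theorem invForm_smul {k : ℕ} (c : ℝ) (α : HH [⋀^Fin k]→L[ℝ] ℝ) :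
    invForm (c • α) = c • invForm α := rfl

theorem invForm_sum {k : ℕ} {ι : Type*} (s : Finset ι) (α : ι → HH [⋀^Fin k]→L[ℝ] ℝ) :
    invForm (∑ i ∈ s, α i) = ∑ i ∈ s, invForm (α i) := by
  classical
  induction s using Finset.induction_on with
  | empty => funext x; ext v; simp [invForm_apply]
  | insert i s hi ih => rw [Finset.sum_insert hi, Finset.sum_insert hi, invForm_add, ih]

theorem contDiffOn_smul {k : ℕ} (c : ℝ) {α : Form k}
    (hα : ContDiffOn ℝ ∞ (radialExt α) {0}ᶜ) : ContDiffOn ℝ ∞ (radialExt (c • α)) {0}ᶜ := by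
  rw [radialExt_smul]; exact hα.const_smul c

theorem contDiffOn_add {k : ℕ} {α β : Form k} (hα : ContDiffOn ℝ ∞ (radialExt α) {0}ᶜ)
    (hβ : ContDiffOn ℝ ∞ (radialExt β) {0}ᶜ) : ContDiffOn ℝ ∞ (radialExt (α + β)) {0}ᶜ := by
  rw [radialExt_add]; exact hα.add hβ

theorem contDiffOn_formAt (c : ℝ) (C : Matrix (Fin 3) (Fin 3) ℝ) :
    ContDiffOn ℝ ∞ (radialExt (invForm (formAt c C))) {0}ᶜ := by
  simp only [formAt, invForm_add, invForm_smul, invForm_sum]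
  exact contDiffOn_add (contDiffOn_smul _ contDiffOn_vertical) (contDiffOn_sum _ fun i _ =>
    contDiffOn_sum _ fun j _ => contDiffOn_smul _ (contDiffOn_eOmega j i))

/-- With E = diag(ε) and t = tr(EC) the coefficient matrix is E((c + 2t)·1 − 2EC − 2(EC)ᵀ), so it
depends only on c and the symmetric part of EC. The term in e⁴⁵⁶⁷ comes from εⱼωⱼ ∧ ωⱼ. -/
theorem d_formAt (c : ℝ) (C : Matrix (Fin 3) (Fin 3) ℝ) :
    d (invForm (formAt c C)) = invForm (fourAt (2 * ∑ j, eps j * C j j)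
      (Matrix.of fun i l => eps i * ((if i = l then c + 2 * ∑ j, eps j * C j j else 0)
        - 2 * (eps i * C i l) - 2 * (eps l * C l i)))) := by
  have h1 : ∀ i : Fin 3, ContDiffOn ℝ ∞ (radialExt
      (∑ j : Fin 3, C i j • invForm (eOmega (Fin.castAdd 4 j) i))) {0}ᶜ := fun i =>
    contDiffOn_sum _ fun j _ => contDiffOn_smul _ (contDiffOn_eOmega j i)
  have h2 : d (invForm (formAt c C)) = c • d (invForm (eForm ![0, 1, 2])) + ∑ i : Fin 3,
      ∑ j : Fin 3, C i j • d (invForm (eOmega (Fin.castAdd 4 j) i)) := by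
    simp only [formAt, invForm_add, invForm_smul, invForm_sum]
    rw [d_add (contDiffOn_smul _ contDiffOn_vertical) (contDiffOn_sum _ fun i _ => h1 i), d_smul,
      d_sum _ fun i _ => h1 i]
    congr 1
    refine Finset.sum_congr rfl fun i _ => ?_
    rw [d_sum _ fun j _ => contDiffOn_smul _ (contDiffOn_eOmega j i)]
    exact Finset.sum_congr rfl fun j _ => d_smul _ _
  funext x
  ext v
  obtain ⟨p, hp⟩ : ∃ p : Fin 4 → Fin 7 → ℝ, ∀ n a, coframe x a (v n) = p n a := ⟨_, fun _ _ => rfl⟩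
  have hc : (fun n => coord x (v n)) = p := funext fun n => funext fun a => hp n a
  have anti : ∀ j k i, eeCoord j k i p = -eeCoord k j i p := fun j k i => by
    simp only [eeCoord, wedge112]; ring
  have self : ∀ j i, eeCoord j j i p = 0 := fun j i => by
    simp only [eeCoord, wedge112]; ring
  rw [invForm_fourAt_apply, hc, h2]
  simp only [Pi.add_apply, Pi.smul_apply, Finset.sum_apply, ContinuousAlternatingMap.add_apply,
    ContinuousAlternatingMap.smul_apply, ContinuousAlternatingMap.sum_apply, d_vertical_coframe,
    d_eOmega_coframe _ _ x v hp, hp, fourCoord]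
  simp only [Fin.sum_univ_three]
  simp [eps, self]
  simp only [anti 1 0, anti 2 1, anti 0 2]
  ring

/-- Counterpart of `d_formAt`: the form e⁴⁵⁶⁷ is closed, and only the antisymmetric part of diag(ε)B
contributes, one coefficient for each of the three 5-forms `fiveCoord m`. -/
theorem d_fourAt_apply (s : ℝ) (B : Matrix (Fin 3) (Fin 3) ℝ) (x : S7) (v : Fin 5 → HH) :
    d (invForm (fourAt s B)) x v
      = ∑ m : Fin 3, 2 * (eps (m + 2) * B (m + 2) (m + 1) - eps (m + 1) * B (m + 1) (m + 2))
        * fiveCoord m (fun n => coord x (v n)) := by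
  have h1 : ∀ i : Fin 3, ContDiffOn ℝ ∞ (radialExt (∑ l : Fin 3, B i l •
      invForm (eeOmega (Fin.castAdd 4 (l + 1)) (Fin.castAdd 4 (l + 2)) i))) {0}ᶜ := fun i =>
    contDiffOn_sum _ fun l _ => contDiffOn_smul _ (contDiffOn_eeOmega _ _ i)
  have h2 : d (invForm (fourAt s B)) = ∑ i : Fin 3, ∑ l : Fin 3,
      B i l • d (invForm (eeOmega (Fin.castAdd 4 (l + 1)) (Fin.castAdd 4 (l + 2)) i)) := by
    simp only [fourAt, invForm_add, invForm_smul, invForm_sum]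
    rw [d_add (contDiffOn_smul _ contDiffOn_horizontal) (contDiffOn_sum _ fun i _ => h1 i), d_smul,
      d_sum _ fun i _ => h1 i, d_horizontal_eq_zero, smul_zero, zero_add]
    refine Finset.sum_congr rfl fun i _ => ?_
    rw [d_sum _ fun l _ => contDiffOn_smul _ (contDiffOn_eeOmega _ _ i)]
    exact Finset.sum_congr rfl fun j _ => d_smul _ _
  have hp : ∀ n a, coframe x a (v n) = (fun n => coord x (v n)) n a := fun _ _ => rfl
  rw [h2]
  simp only [Finset.sum_apply, Pi.smul_apply, ContinuousAlternatingMap.smul_apply,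
    ContinuousAlternatingMap.sum_apply, d_eeOmega_coframe _ _ x v hp]
  simp only [Fin.sum_univ_three]
  simp [eps]
  ring

theorem coord_smul (x : S7) (c : ℝ) (v : HH) : coord x (c • v) = c • coord x v := by
  funext a; simp [coord]

theorem coord_sum (x : S7) {ι : Type*} (s : Finset ι) (f : ι → HH) :
    coord x (∑ i ∈ s, f i) = ∑ i ∈ s, coord x (f i) := by
  funext a; simp [coord]

theorem coord_self (x : S7) : coord x x = 0 := funext fun a => coframe_self x a

theorem coord_frame (x : S7) (i : Fin 7) : coord x (frame x i) = Pi.single i 1 := by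
  funext a
  rw [coord, coframe_frame, Pi.single_apply]

theorem eq_of_coord_eq (x : S7) {u v : HH} (hu : ⟪(x : HH), u⟫ = 0) (hv : ⟪(x : HH), v⟫ = 0)
    (h : coord x u = coord x v) : u = v := by
  rw [eq_sum_frame x hu, eq_sum_frame x hv]
  exact Finset.sum_congr rfl fun a _ => by rw [show coframe x a u = coframe x a v from congrFun h a]

theorem eForm_eq_zero {k : ℕ} (i : Fin k → Fin 7) (v : Fin k → HH) (h : ∃ n, v n = o) :
    eForm i v = 0 := by
  obtain ⟨n, hn⟩ := h
  rw [eForm_apply]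
  refine Matrix.det_eq_zero_of_row_eq_zero n fun b => ?_
  rw [Matrix.of_apply, hn, eDual_o]

theorem eOmega_eq_zero (j : Fin 7) (i : Fin 3) (v : Fin 3 → HH) (h : ∃ n, v n = o) :
    eOmega j i v = 0 := by
  fin_cases i <;> simp [eOmega, eForm_eq_zero _ _ h]

theorem eeOmega_eq_zero (j k : Fin 7) (i : Fin 3) (v : Fin 4 → HH) (h : ∃ n, v n = o) :
    eeOmega j k i v = 0 := by
  fin_cases i <;> simp [eeOmega, eForm_eq_zero _ _ h]

theorem tangential_invForm {k : ℕ} {α : HH [⋀^Fin k]→L[ℝ] ℝ}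
    (hα : ∀ v : Fin k → HH, (∃ n, v n = o) → α v = 0) : Tangential (invForm α) := by
  rintro x v ⟨n, hn⟩
  rw [invForm_apply]
  exact hα _ ⟨n, by rw [hn, act_transport_inv]⟩

theorem tangential_formAt (c : ℝ) (C : Matrix (Fin 3) (Fin 3) ℝ) :
    Tangential (invForm (formAt c C)) := by
  refine tangential_invForm fun v h => ?_
  simp only [formAt, ContinuousAlternatingMap.add_apply, ContinuousAlternatingMap.smul_apply,
    ContinuousAlternatingMap.sum_apply, eForm_eq_zero _ _ h, eOmega_eq_zero _ _ _ h, smul_zero,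
    Finset.sum_const_zero, add_zero]

theorem tangential_fourAt (s : ℝ) (B : Matrix (Fin 3) (Fin 3) ℝ) :
    Tangential (invForm (fourAt s B)) := by
  refine tangential_invForm fun v h => ?_
  simp only [fourAt, ContinuousAlternatingMap.add_apply, ContinuousAlternatingMap.smul_apply,
    ContinuousAlternatingMap.sum_apply, eForm_eq_zero _ _ h, eeOmega_eq_zero _ _ _ _ h, smul_zero,
    Finset.sum_const_zero, add_zero]

theorem isSmoothForm_formAt (c : ℝ) (C : Matrix (Fin 3) (Fin 3) ℝ) :
    IsSmoothForm (invForm (formAt c C)) :=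
  ⟨tangential_formAt c C, contDiffOn_formAt c C⟩

/-- The values involve only e¹, e², e³ and the ωₗ, which are invariant under Sp(2), whereas the full
coframe depends on the choice of `transport`. -/
theorem invariant_formAt (c : ℝ) (C : Matrix (Fin 3) (Fin 3) ℝ) :
    Invariant (invForm (formAt c C)) := by
  intro A x y hy v
  have h1 : ∀ (l : Fin 3) u, coord y (act A u) (Fin.castAdd 4 l) = coord x u (Fin.castAdd 4 l) :=
    fun l u => by
      change coframe y _ _ = coframe x _ _
      rw [← eta_eq_coframe, ← eta_eq_coframe, hy, eta_act]
  have h2 : ∀ l u v, omCoord l (coord y (act A u)) (coord y (act A v))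
      = omCoord l (coord x u) (coord x v) := fun l u v => by
    have h := om_act A l x u v
    rw [← hy, om_eq_coframe, om_eq_coframe] at h
    exact h
  have h10 := h1 0
  have h11 := h1 1
  have h12 := h1 2
  rw [castAdd_zero] at h10
  rw [castAdd_one] at h11
  rw [castAdd_two] at h12
  rw [invForm_formAt_apply, invForm_formAt_apply]
  simp only [formCoord, h1, h2, det3, h10, h11, h12]

/-! ### Coframes in which a `3`-form is standard -/

theorem PhiAt_eVec (i j k : Fin 7) : PhiAt 1 1 ![eVec i, eVec j, eVec k]
    = phi0 (Pi.single i 1) (Pi.single j 1) (Pi.single k (1 : ℝ)) := by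
  have h : (fun n a => eDual a ((![eVec i, eVec j, eVec k] : Fin 3 → HH) n))
      = (![Pi.single i 1, Pi.single j 1, Pi.single k 1] : Fin 3 → Fin 7 → ℝ) := by
    funext n a
    fin_cases n <;> simp [eDual_eVec, Pi.single_apply]
  rw [PhiAt_eq_formAt, formAt_apply, h]
  simp [formCoord, phi0, Fin.sum_univ_three, Matrix.one_apply, wedge12, omCoord, castAdd_zero,
    castAdd_one, castAdd_two, det3]
  ring

/-- `K` identifies `T_x S⁷` with `ℝ⁷` such that `φ` corresponds to `φ₀`. -/
structure IsCoframe (φ : Form 3) (x : S7) (K : HH →ₗ[ℝ] Fin 7 → ℝ) : Prop where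
  map_self : K x = 0
  eq_zero : ∀ v, ⟪(x : HH), v⟫ = 0 → K v = 0 → v = 0
  apply : ∀ v, φ x v = phi0 (K (v 0)) (K (v 1)) (K (v 2))

theorem IsCoframe.adapted {φ : Form 3} {x : S7} {K : HH →ₗ[ℝ] Fin 7 → ℝ} (h : IsCoframe φ x K)
    {f : Fin 7 → HH} (hx : ∀ i, ⟪(x : HH), f i⟫ = 0) (hf : ∀ i, K (f i) = Pi.single i 1) :
    Adapted φ x f where
  tangent := hx
  linearIndependent := by
    refine LinearIndependent.of_comp K ?_
    have : K ∘ f = fun i => Pi.single i (1 : ℝ) := funext hf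
    rw [this]
    exact Pi.linearIndependent_single_one (Fin 7) ℝ
  coeff i j k := by rw [h.apply, PhiAt_eVec]; simp [hf]

theorem IsCoframe.of_adapted_phi0 {φ : Form 3} {x : S7} {K : HH →ₗ[ℝ] Fin 7 → ℝ}
    (h : IsCoframe φ x K) {b : Fin 7 → HH} (hb : Adapted φ x b) (i j k : Fin 7) :
    phi0 (K (b i)) (K (b j)) (K (b k))
      = phi0 (Pi.single i 1) (Pi.single j 1) (Pi.single k (1 : ℝ)) := by
  have := hb.coeff i j k
  rw [h.apply, PhiAt_eVec] at this
  exact this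

theorem IsCoframe.det_ne_zero {φ : Form 3} {x : S7} {K : HH →ₗ[ℝ] Fin 7 → ℝ} (h : IsCoframe φ x K)
    {b : Fin 7 → HH} (hb : Adapted φ x b) :
    (Matrix.of fun i => K (b i)).det ≠ 0 := by
  intro h0
  obtain ⟨u, hu, h1⟩ := Matrix.exists_vecMul_eq_zero_iff.2 h0
  have h2 : K (∑ i, u i • b i) = 0 := by
    rw [map_sum, ← h1]
    funext a
    simp [Matrix.vecMul, dotProduct]
  have h3 := h.eq_zero _ (by
    rw [inner_sum]
    exact Finset.sum_eq_zero fun i _ => by rw [inner_smul_right, hb.tangent, mul_zero]) h2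
  exact hu (funext fun i => Fintype.linearIndependent_iff.1 hb.linearIndependent u h3 i)

/-- In a coframe that makes φ standard, an adapted basis becomes a matrix preserving φ₀. It
therefore lies in SO(7), and metric and dual do not depend on the adapted basis. -/
theorem IsCoframe.mul_transpose {φ : Form 3} {x : S7} {K : HH →ₗ[ℝ] Fin 7 → ℝ}
    (h : IsCoframe φ x K) {b : Fin 7 → HH} (hb : Adapted φ x b) :
    (Matrix.of fun i => K (b i)) * (Matrix.of fun i => K (b i)).transpose = 1 :=
  mul_transpose_of_phi0 _ (h.det_ne_zero hb) (h.of_adapted_phi0 hb)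

theorem IsCoframe.det_eq_one {φ : Form 3} {x : S7} {K : HH →ₗ[ℝ] Fin 7 → ℝ}
    (h : IsCoframe φ x K) {b : Fin 7 → HH} (hb : Adapted φ x b) :
    (Matrix.of fun i => K (b i)).det = 1 :=
  det_eq_one_of_phi0 _ (h.det_ne_zero hb) (h.of_adapted_phi0 hb)

theorem IsCoframe.dotProduct {φ : Form 3} {x : S7} {K : HH →ₗ[ℝ] Fin 7 → ℝ}
    (h : IsCoframe φ x K) {b : Fin 7 → HH} (hb : Adapted φ x b) (i j : Fin 7) :
    K (b i) ⬝ᵥ K (b j) = if i = j then 1 else 0 := by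
  have := congrFun (congrFun (h.mul_transpose hb) i) j
  rw [Matrix.one_apply] at this
  exact this

theorem finrank_HH : Module.finrank ℝ HH = 8 := by
  rw [← Module.finrank_mul_finrank ℝ ℍ[ℝ] HH]
  rw [Quaternion.finrank_eq_four, LinearEquiv.finrank_eq (WithLp.linearEquiv 2 ℍ[ℝ] (Fin 2 → ℍ[ℝ]))]
  simp

/-- A basis of `T_x S⁷`, completed by the normal vector to a basis of `ℍ²`. -/
theorem Adapted.exists_basis {φ : Form 3} {x : S7} {b : Fin 7 → HH} (hb : Adapted φ x b) :
    ∃ e : Module.Basis (Fin 8) ℝ HH, e 0 = x ∧ ∀ i, e (Fin.succ i) = b i := by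
  have hl : LinearIndependent ℝ (Fin.cons (x : HH) b : Fin 8 → HH) := by
    rw [linearIndependent_finCons]
    refine ⟨hb.linearIndependent, fun hx => ?_⟩
    have h : ∀ v ∈ Submodule.span ℝ (Set.range b), ⟪(x : HH), v⟫ = 0 := by
      intro v hv
      induction hv using Submodule.span_induction with
      | mem v hv => obtain ⟨i, rfl⟩ := hv; exact hb.tangent i
      | zero => exact inner_zero_right _
      | add u v _ _ hu hv => rw [inner_add_right, hu, hv, add_zero]
      | smul c v _ hv => rw [inner_smul_right, hv, mul_zero]
    have := h _ hx
    rw [real_inner_self_eq_norm_sq, norm_coe] at this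
    norm_num at this
  refine ⟨basisOfLinearIndependentOfCardEqFinrank hl (by simp [finrank_HH]), ?_, fun i => ?_⟩ <;>
    simp

/-- The metric of a `G₂`-structure at `x` is the standard one in any coframe. -/
theorem IsCoframe.metric_eq {φ : Form 3} {x : S7} {K : HH →ₗ[ℝ] Fin 7 → ℝ}
    (h : IsCoframe φ x K) {m : Tensor2} (hm : IsMetricOf φ m) (v w : HH) :
    m x v w = K v ⬝ᵥ K w := by
  obtain ⟨hx, b, hb, hbm⟩ := hm x
  obtain ⟨e, he0, he⟩ := hb.exists_basis
  let K' : LinearMap.BilinForm ℝ HH := (dotProductBilin ℝ ℝ).compl₁₂ K K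
  suffices m x = K' by rw [this]; rfl
  refine LinearMap.BilinForm.ext_basis e fun i j => ?_
  change m x (e i) (e j) = K (e i) ⬝ᵥ K (e j)
  refine Fin.cases ?_ (fun i => ?_) i
  · rw [he0, (hx _).1, h.map_self, zero_dotProduct]
  · refine Fin.cases ?_ (fun j => ?_) j
    · rw [he0, (hx _).2, h.map_self, dotProduct_zero]
    · rw [he, he, hbm, h.dotProduct hb]

theorem IsCoframe.dual_apply {φ : Form 3} {x : S7} {K : HH →ₗ[ℝ] Fin 7 → ℝ}
    (h : IsCoframe φ x K) {b : Fin 7 → HH} (hb : Adapted φ x b) (σ : Equiv.Perm (Fin 7)) :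
    psi0 (K (b (σ 3))) (K (b (σ 4))) (K (b (σ 5))) (K (b (σ 6)))
      = (Equiv.Perm.sign σ : ℝ) * φ x ![b (σ 0), b (σ 1), b (σ 2)] := by
  have ho : (Matrix.of fun i => K (b i)).submatrix σ id
      * ((Matrix.of fun i => K (b i)).submatrix σ id).transpose = 1 := by
    rw [Matrix.transpose_submatrix, ← Matrix.submatrix_mul _ _ _ _ _ Function.bijective_id,
      h.mul_transpose hb, Matrix.submatrix_one_equiv]
  have hp := psi0_eq_phi0 _ ho
  rw [Matrix.det_permute, h.det_eq_one hb, mul_one] at hp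
  rw [h.apply]
  exact hp

/-- Shows that `IsDual` has at most one solution at x, namely the pullback of ψ₀. -/
theorem IsCoframe.dual_eq {φ : Form 3} {x : S7} {K : HH →ₗ[ℝ] Fin 7 → ℝ}
    (h : IsCoframe φ x K) {ψ : Form 4} (hψ : IsDual φ ψ) {β : HH [⋀^Fin 4]→L[ℝ] ℝ}
    (hβ : ∀ v, β v = psi0 (K (v 0)) (K (v 1)) (K (v 2)) (K (v 3))) : ψ x = β := by
  obtain ⟨b, hb, hbψ⟩ := hψ.2 x
  obtain ⟨e, he0, he⟩ := hb.exists_basis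
  have h0 : ∀ v : Fin 4 → HH, (∃ n, v n = x) → β v = 0 := by
    rintro v ⟨n, hn⟩
    rw [hβ]
    fin_cases n <;> simp at hn <;> simp [hn, h.map_self, psi0, det4, det3]
  have key : (ψ x).toAlternatingMap = β.toAlternatingMap := by
    refine Module.Basis.ext_alternating e fun w hw => ?_
    change ψ x (fun i => e (w i)) = β fun i => e (w i)
    by_cases hz : ∃ n, w n = 0
    · obtain ⟨n, hn⟩ := hz
      rw [hψ.1 _ _ ⟨n, by rw [hn, he0]⟩, h0 _ ⟨n, by rw [hn, he0]⟩]
    · rw [not_exists] at hz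
      choose w' hw' using fun n => Fin.exists_succ_eq.2 (hz n)
      have hinj : Function.Injective w' := fun a c hac => hw (by rw [← hw', ← hw', hac])
      -- The symmetric group on seven points is 4-transitive, so any four distinct basis vectors are
      -- the last four of a permuted basis, where `IsDual` prescribes the value of ψ.
      obtain ⟨σ, hσ⟩ := (Equiv.Perm.isMultiplyPretransitive (Fin 7) 4).exists_smul_eq
        ⟨fun n => Fin.natAdd 3 n, Fin.natAdd_injective 4 3⟩ ⟨w', hinj⟩
      have hσ' : ∀ n : Fin 4, σ (Fin.natAdd 3 n) = w' n := fun n => DFunLike.congr_fun hσ n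
      have hv : (fun i => e (w i)) = ![b (σ 3), b (σ 4), b (σ 5), b (σ 6)] := by
        funext n
        rw [← hw' n, he, ← hσ' n]
        fin_cases n <;> rfl
      rw [hv, hbψ, hβ]
      exact (h.dual_apply hb σ).symm
  exact ContinuousAlternatingMap.toAlternatingMap_injective key

/-! ### The coframe of `Φ(r, D)` -/

/-- The coframe `r ∑ⱼ Cᵢⱼ eʲ, s e⁴, …, s e⁷`. -/
def theta (r s : ℝ) (C : Matrix (Fin 3) (Fin 3) ℝ) : Matrix (Fin 7) (Fin 7) ℝ :=
  (Matrix.fromBlocks (r • C) 0 0 (s • (1 : Matrix (Fin 4) (Fin 4) ℝ))).submatrix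
    (finSumFinEquiv (m := 3) (n := 4)).symm (finSumFinEquiv (m := 3) (n := 4)).symm

theorem det_theta (r s : ℝ) (C : Matrix (Fin 3) (Fin 3) ℝ) :
    (theta r s C).det = r ^ 3 * s ^ 4 * C.det := by
  rw [theta, Matrix.det_submatrix_equiv_self, Matrix.det_fromBlocks_zero₂₁, Matrix.det_smul,
    Matrix.det_smul]
  simp
  ring

theorem theta_mulVec (r s : ℝ) (C : Matrix (Fin 3) (Fin 3) ℝ) (p : Fin 7 → ℝ) :
    (theta r s C).mulVec p = ![r * (C 0 0 * p 0 + C 0 1 * p 1 + C 0 2 * p 2),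
      r * (C 1 0 * p 0 + C 1 1 * p 1 + C 1 2 * p 2),
      r * (C 2 0 * p 0 + C 2 1 * p 1 + C 2 2 * p 2), s * p 3, s * p 4, s * p 5, s * p 6] := by
  have h : theta r s C = !![r * C 0 0, r * C 0 1, r * C 0 2, 0, 0, 0, 0;
      r * C 1 0, r * C 1 1, r * C 1 2, 0, 0, 0, 0;
      r * C 2 0, r * C 2 1, r * C 2 2, 0, 0, 0, 0;
      0, 0, 0, s, 0, 0, 0; 0, 0, 0, 0, s, 0, 0; 0, 0, 0, 0, 0, s, 0; 0, 0, 0, 0, 0, 0, s] := by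
    have e0 : (finSumFinEquiv (m := 3) (n := 4)).symm (0 : Fin 7) = Sum.inl 0 := rfl
    have e1 : (finSumFinEquiv (m := 3) (n := 4)).symm (1 : Fin 7) = Sum.inl 1 := rfl
    have e2 : (finSumFinEquiv (m := 3) (n := 4)).symm (2 : Fin 7) = Sum.inl 2 := rfl
    have e3 : (finSumFinEquiv (m := 3) (n := 4)).symm (3 : Fin 7) = Sum.inr 0 := rfl
    have e4 : (finSumFinEquiv (m := 3) (n := 4)).symm (4 : Fin 7) = Sum.inr 1 := rfl
    have e5 : (finSumFinEquiv (m := 3) (n := 4)).symm (5 : Fin 7) = Sum.inr 2 := rfl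
    have e6 : (finSumFinEquiv (m := 3) (n := 4)).symm (6 : Fin 7) = Sum.inr 3 := rfl
    refine Matrix.ext fun i j => ?_
    fin_cases i <;> fin_cases j <;> simp [theta, e0, e1, e2, e3, e4, e5, e6]
  rw [h]
  funext i
  fin_cases i <;> simp [Matrix.mulVec, dotProduct, Fin.sum_univ_seven] <;> ring

/-- Passing to the new coframe multiplies e¹²³ by r³ det C and each product of one vertical and two
horizontal factors by rs² = 1. -/
theorem formCoord_eq_phi0 (r s c : ℝ) (C : Matrix (Fin 3) (Fin 3) ℝ) (hrs : r * s ^ 2 = 1)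
    (hc : c = r ^ 3 * C.det) (p : Fin 3 → Fin 7 → ℝ) :
    formCoord c C p = phi0 ((theta r s C).mulVec (p 0)) ((theta r s C).mulVec (p 1))
      ((theta r s C).mulVec (p 2)) := by
  have h : phi0 ((theta r s C).mulVec (p 0)) ((theta r s C).mulVec (p 1))
      ((theta r s C).mulVec (p 2)) = formCoord (r ^ 3 * C.det) ((r * s ^ 2) • C) p := by
    simp only [theta_mulVec, phi0, det3, formCoord, Fin.sum_univ_three, wedge12, omCoord,
      castAdd_zero, castAdd_one, castAdd_two, Matrix.smul_apply, Matrix.det_fin_three, smul_eq_mul,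
      Matrix.cons_val]
    ring
  rw [h, hrs, one_smul, hc]

/-- The adjugate of a rotation is its transpose; cyclic indices absorb the cofactor signs. -/
theorem cofactor_eq {C : Matrix (Fin 3) (Fin 3) ℝ}
    (hC : C ∈ Matrix.specialOrthogonalGroup (Fin 3) ℝ) (i l : Fin 3) :
    C (i + 1) (l + 1) * C (i + 2) (l + 2) - C (i + 1) (l + 2) * C (i + 2) (l + 1) = C i l := by
  rw [Matrix.mem_specialOrthogonalGroup_iff, Matrix.mem_orthogonalGroup_iff] at hC
  have h : C.adjugate = C.transpose := by
    have h1 : C * C.transpose = 1 := hC.1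
    calc C.adjugate = C.adjugate * (C * C.transpose) := by rw [h1, mul_one]
      _ = C.transpose := by rw [← Matrix.mul_assoc, Matrix.adjugate_mul, hC.2, one_smul, one_mul]
  have h2 := congrFun (congrFun h l) i
  rw [Matrix.adjugate_fin_three] at h2
  rw [Matrix.transpose_apply] at h2
  fin_cases i <;> fin_cases l <;> simp at h2 ⊢ <;> linarith

-- In ψ₀ the products of two vertical covectors produce the 2 × 2 minors of C, which for a rotation
-- are the entries of C; the scale is r²s² = r.
set_option maxRecDepth 10000 in
theorem fourCoord_eq_psi0 (r s : ℝ) {C : Matrix (Fin 3) (Fin 3) ℝ} (hrs : r * s ^ 2 = 1)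
    (hC : C ∈ Matrix.specialOrthogonalGroup (Fin 3) ℝ) (p : Fin 4 → Fin 7 → ℝ) :
    fourCoord (s ^ 4) (r • C) p = psi0 ((theta r s C).mulVec (p 0)) ((theta r s C).mulVec (p 1))
      ((theta r s C).mulVec (p 2)) ((theta r s C).mulVec (p 3)) := by
  have h : psi0 ((theta r s C).mulVec (p 0)) ((theta r s C).mulVec (p 1))
      ((theta r s C).mulVec (p 2)) ((theta r s C).mulVec (p 3)) = fourCoord (s ^ 4)
      ((r ^ 2 * s ^ 2) • Matrix.of fun i l : Fin 3 =>
        C (i + 1) (l + 1) * C (i + 2) (l + 2) - C (i + 1) (l + 2) * C (i + 2) (l + 1)) p := by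
    simp only [theta_mulVec, psi0, det4, det3, fourCoord, Fin.sum_univ_three, eeCoord, wedge112,
      omCoord, Matrix.smul_apply, smul_eq_mul, Matrix.of_apply,
      Matrix.cons_val, Fin.reduceAdd, castAdd_zero, castAdd_one, castAdd_two]
    ring
  rw [h, show r ^ 2 * s ^ 2 = r by rw [sq r, mul_assoc, hrs, mul_one]]
  congr 2
  exact Matrix.ext fun i l => (cofactor_eq hC i l).symm

/-! ### The metric and the orientation of `Φ(r, D)` -/

/-- The linear map `coord x`. -/
def coordL (x : S7) : HH →ₗ[ℝ] Fin 7 → ℝ := LinearMap.pi fun a => (coframe x a : HH →ₗ[ℝ] ℝ)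

theorem coordL_apply (x : S7) (v : HH) : coordL x v = coord x v := rfl

theorem isCoframe_formAt {r s c : ℝ} {C : Matrix (Fin 3) (Fin 3) ℝ} (hrs : r * s ^ 2 = 1)
    (hc : c = r ^ 3 * C.det) (hC : C.det ≠ 0) (x : S7) :
    IsCoframe (invForm (formAt c C)) x ((theta r s C).mulVecLin ∘ₗ coordL x) where
  map_self := by simp [coordL_apply, coord_self]
  eq_zero v hv h := by
    have hd : (theta r s C).det ≠ 0 := by
      rw [det_theta]
      have hr : r ≠ 0 := by rintro rfl; simp at hrs
      have hs : s ≠ 0 := by rintro rfl; simp at hrs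
      positivity
    have h1 : coord x v = 0 := Matrix.eq_zero_of_mulVec_eq_zero hd h
    exact eq_of_coord_eq x hv (inner_zero_right _) (by rw [h1]; funext a; simp [coord])
  apply v := by rw [invForm_formAt_apply, formCoord_eq_phi0 r s c C hrs hc]; rfl

theorem g_apply (r : ℝ) (x : S7) (v w : HH) :
    g r x v w = ∑ i : Fin 7, (if i < 3 then r ^ 2 else r⁻¹) * (coord x v i * coord x w i) := by
  simp only [g, gAt, LinearMap.compl₁₂_apply, LinearMap.sum_apply, LinearMap.smul_apply, coord,
    coframe_apply]
  refine Finset.sum_congr rfl fun i _ => ?_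
  simp

/-- An orthogonal change of e¹, e², e³ is invisible to the metric, which is why all of SO(3) yields
the same g_r. -/
theorem g_eq_dotProduct {r s : ℝ} {C : Matrix (Fin 3) (Fin 3) ℝ} (hrs : r * s ^ 2 = 1)
    (hC : C ∈ Matrix.orthogonalGroup (Fin 3) ℝ) (x : S7) (v w : HH) :
    g r x v w = (theta r s C).mulVec (coord x v) ⬝ᵥ (theta r s C).mulVec (coord x w) := by
  have hs : s ^ 2 = r⁻¹ := eq_inv_of_mul_eq_one_right hrs
  rw [Matrix.mem_orthogonalGroup_iff'] at hC
  have h : ∀ i j, C 0 i * C 0 j + C 1 i * C 1 j + C 2 i * C 2 j = if i = j then 1 else 0 := by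
    intro i j
    rw [← Matrix.one_apply, ← hC, Matrix.mul_apply, Fin.sum_univ_three]
    rfl
  have h00 := h 0 0
  have h01 := h 0 1
  have h02 := h 0 2
  have h11 := h 1 1
  have h12 := h 1 2
  have h22 := h 2 2
  simp only [↓reduceIte, Fin.reduceEq] at h00 h01 h02 h11 h12 h22
  generalize hp : coord x v = p
  generalize hq : coord x w = q
  rw [g_apply, hp, hq, theta_mulVec, theta_mulVec]
  simp only [Fin.sum_univ_seven, dotProduct, Matrix.cons_val, Fin.reduceLT, if_true, if_false,
    ← hs]
  linear_combination -(r ^ 2 * (p 0 * q 0)) * h00 - (r ^ 2 * (p 1 * q 1)) * h11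
    - (r ^ 2 * (p 2 * q 2)) * h22 - (r ^ 2 * (p 0 * q 1 + p 1 * q 0)) * h01
    - (r ^ 2 * (p 0 * q 2 + p 2 * q 0)) * h02 - (r ^ 2 * (p 1 * q 2 + p 2 * q 1)) * h12

theorem invForm_formAt_o (c : ℝ) (C : Matrix (Fin 3) (Fin 3) ℝ) :
    invForm (formAt c C) o = formAt c C := by
  ext v
  rw [← invariant_formAt c C (transport o) o o (act_transport o).symm v, invForm_apply]
  simp only [act_inv_act]

/-- At the base point the coframe is needed in terms of `eDual`, since the orientation is given by
`eVec`, while `frame o` involves a chosen element of the stabiliser. -/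
theorem isCoframe_formAt_o {r s c : ℝ} {C : Matrix (Fin 3) (Fin 3) ℝ} (hrs : r * s ^ 2 = 1)
    (hc : c = r ^ 3 * C.det) (hC : C.det ≠ 0) :
    IsCoframe (invForm (formAt c C)) o
      ((theta r s C).mulVecLin ∘ₗ LinearMap.pi fun a => (eDual a : HH →ₗ[ℝ] ℝ)) where
  map_self := by
    have : (LinearMap.pi fun a => (eDual a : HH →ₗ[ℝ] ℝ)) (o : HH) = 0 :=
      funext fun a => eDual_o a
    rw [LinearMap.comp_apply, this, map_zero]
  eq_zero v hv h := by
    have hd : (theta r s C).det ≠ 0 := by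
      rw [det_theta]
      have hr : r ≠ 0 := by rintro rfl; simp at hrs
      have hs : s ≠ 0 := by rintro rfl; simp at hrs
      positivity
    have h1 : (fun a => eDual a v) = 0 := Matrix.eq_zero_of_mulVec_eq_zero hd h
    rw [eq_sum_eDual v, hv, zero_smul, zero_add]
    exact Finset.sum_eq_zero fun a _ => by rw [show eDual a v = 0 from congrFun h1 a, zero_smul]
  apply v := by rw [invForm_formAt_o, formAt_apply, formCoord_eq_phi0 r s c C hrs hc]; rfl

theorem exists_mul_sq_eq_one {r : ℝ} (hr : 0 < r) : ∃ s : ℝ, 0 < s ∧ r * s ^ 2 = 1 :=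
  ⟨(√r)⁻¹, by positivity, by rw [inv_pow, Real.sq_sqrt hr.le, mul_inv_cancel₀ hr.ne']⟩

theorem exists_adapted_formAt {r s c : ℝ} {C : Matrix (Fin 3) (Fin 3) ℝ} (hrs : r * s ^ 2 = 1)
    (hc : c = r ^ 3 * C.det) (hC : C.det ≠ 0) (x : S7) :
    ∃ b, Adapted (invForm (formAt c C)) x b := by
  have hd : (theta r s C).det ≠ 0 := by
    rw [det_theta]
    have hr : r ≠ 0 := by rintro rfl; simp at hrs
    have hs : s ≠ 0 := by rintro rfl; simp at hrs
    positivity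
  -- The frame dual to the coframe `theta`.
  refine ⟨fun i => ∑ a, (theta r s C)⁻¹ a i • frame x a,
    (isCoframe_formAt hrs hc hC x).adapted (fun i => ?_) (fun i => ?_)⟩
  · rw [inner_sum]
    exact Finset.sum_eq_zero fun a _ => by rw [inner_smul_right, inner_frame, mul_zero]
  · have h : coord x (∑ a, (theta r s C)⁻¹ a i • frame x a)
        = (theta r s C)⁻¹.mulVec (Pi.single i 1) := by
      simp only [coord_sum, coord_smul, coord_frame]
      funext b
      simp [Finset.sum_apply, Pi.single_apply]
    rw [LinearMap.comp_apply, coordL_apply, h, Matrix.mulVecLin_apply, Matrix.mulVec_mulVec,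
      Matrix.mul_nonsing_inv _ (isUnit_iff_ne_zero.2 hd), Matrix.one_mulVec]

theorem positivelyOriented_formAt {r c : ℝ} {C : Matrix (Fin 3) (Fin 3) ℝ} (hr : 0 < r)
    (hc : c = r ^ 3 * C.det) (hC : 0 < C.det) : PositivelyOriented (invForm (formAt c C)) := by
  obtain ⟨s, hs, hrs⟩ := exists_mul_sq_eq_one hr
  have hd : 0 < (theta r s C).det := by
    rw [det_theta]
    positivity
  refine ⟨fun i => ∑ a, (theta r s C)⁻¹ a i • eVec a,
    (isCoframe_formAt_o hrs hc hC.ne').adapted (fun i => ?_) (fun i => ?_),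
    (theta r s C)⁻¹.transpose, ?_, fun i => rfl⟩
  · rw [inner_sum]
    exact Finset.sum_eq_zero fun a _ => by rw [inner_smul_right, inner_o_eVec, mul_zero]
  · have h : (LinearMap.pi fun a => (eDual a : HH →ₗ[ℝ] ℝ))
        (∑ a, (theta r s C)⁻¹ a i • eVec a) = (theta r s C)⁻¹.mulVec (Pi.single i 1) := by
      funext b
      simp [eDual_eVec]
    rw [LinearMap.comp_apply, h, Matrix.mulVecLin_apply, Matrix.mulVec_mulVec,
      Matrix.mul_nonsing_inv _ (isUnit_iff_ne_zero.2 hd.ne'), Matrix.one_mulVec]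
  · rw [Matrix.det_transpose, Matrix.det_nonsing_inv, Ring.inverse_eq_inv']
    exact inv_pos.2 hd

theorem inv_mem_specialOrthogonalGroup {D : Matrix (Fin 3) (Fin 3) ℝ}
    (hD : D ∈ Matrix.specialOrthogonalGroup (Fin 3) ℝ) :
    D⁻¹ ∈ Matrix.specialOrthogonalGroup (Fin 3) ℝ := by
  rw [Matrix.mem_specialOrthogonalGroup_iff, Matrix.mem_orthogonalGroup_iff] at hD ⊢
  have h : D⁻¹ = D.transpose := Matrix.inv_eq_right_inv hD.1
  rw [h, Matrix.det_transpose]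
  exact ⟨mul_eq_one_comm.1 hD.1, hD.2⟩

theorem isMetricOf_formAt {r : ℝ} (hr : 0 < r) {C : Matrix (Fin 3) (Fin 3) ℝ}
    (hC : C ∈ Matrix.specialOrthogonalGroup (Fin 3) ℝ) :
    IsMetricOf (invForm (formAt (r ^ 3) C)) (g r) := by
  obtain ⟨s, hs, hrs⟩ := exists_mul_sq_eq_one hr
  have h1 := (Matrix.mem_specialOrthogonalGroup_iff.1 hC).2
  have hc : r ^ 3 = r ^ 3 * C.det := by rw [h1, mul_one]
  have h0 : C.det ≠ 0 := by rw [h1]; exact one_ne_zero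
  intro x
  refine ⟨fun v => ?_, ?_⟩
  · rw [g_apply, g_apply, coord_self]
    simp
  · obtain ⟨b, hb⟩ := exists_adapted_formAt hrs hc h0 x
    refine ⟨b, hb, fun i j => ?_⟩
    rw [g_eq_dotProduct hrs (Matrix.mem_specialOrthogonalGroup_iff.1 hC).1]
    exact (isCoframe_formAt hrs hc h0 x).dotProduct hb i j

theorem formAt_mem_InvG2 {r : ℝ} (hr : 0 < r) {C : Matrix (Fin 3) (Fin 3) ℝ}
    (hC : C ∈ Matrix.specialOrthogonalGroup (Fin 3) ℝ) :
    invForm (formAt (r ^ 3) C) ∈ InvG2 := by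
  obtain ⟨s, hs, hrs⟩ := exists_mul_sq_eq_one hr
  have h1 := (Matrix.mem_specialOrthogonalGroup_iff.1 hC).2
  have hc : r ^ 3 = r ^ 3 * C.det := by rw [h1, mul_one]
  have h0 : 0 < C.det := by rw [h1]; exact one_pos
  exact ⟨⟨isSmoothForm_formAt _ _, exists_adapted_formAt hrs hc h0.ne'⟩, invariant_formAt _ _,
    positivelyOriented_formAt hr hc h0⟩

/-- The Hodge dual of `Φ(r, D)`. -/
def dualForm (r : ℝ) (C : Matrix (Fin 3) (Fin 3) ℝ) : Form 4 :=
  invForm (fourAt ((r ^ 2)⁻¹) (r • C))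

theorem dualForm_apply {r s : ℝ} (hrs : r * s ^ 2 = 1) {C : Matrix (Fin 3) (Fin 3) ℝ}
    (hC : C ∈ Matrix.specialOrthogonalGroup (Fin 3) ℝ) (x : S7) (v : Fin 4 → HH) :
    dualForm r C x v = psi0 ((theta r s C).mulVec (coord x (v 0)))
      ((theta r s C).mulVec (coord x (v 1))) ((theta r s C).mulVec (coord x (v 2)))
      ((theta r s C).mulVec (coord x (v 3))) := by
  have hs : (r ^ 2)⁻¹ = s ^ 4 := by
    rw [← inv_pow, ← eq_inv_of_mul_eq_one_right hrs]; ring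
  rw [dualForm, invForm_fourAt_apply, hs, fourCoord_eq_psi0 r s hrs hC]

/-- Replaces the existential over ψ in the torsion classes by one explicit form. -/
theorem isDual_formAt_iff {r : ℝ} (hr : 0 < r) {C : Matrix (Fin 3) (Fin 3) ℝ}
    (hC : C ∈ Matrix.specialOrthogonalGroup (Fin 3) ℝ) (ψ : Form 4) :
    IsDual (invForm (formAt (r ^ 3) C)) ψ ↔ ψ = dualForm r C := by
  obtain ⟨s, hs, hrs⟩ := exists_mul_sq_eq_one hr
  have h1 := (Matrix.mem_specialOrthogonalGroup_iff.1 hC).2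
  have hc : r ^ 3 = r ^ 3 * C.det := by rw [h1, mul_one]
  have h0 : C.det ≠ 0 := by rw [h1]; exact one_ne_zero
  constructor
  · intro h
    funext x
    exact (isCoframe_formAt hrs hc h0 x).dual_eq h (dualForm_apply hrs hC x)
  · rintro rfl
    refine ⟨tangential_fourAt _ _, fun x => ?_⟩
    obtain ⟨b, hb⟩ := exists_adapted_formAt hrs hc h0 x
    refine ⟨b, hb, fun σ => ?_⟩
    rw [dualForm_apply hrs hC]
    exact (isCoframe_formAt hrs hc h0 x).dual_apply hb σ

/-! ### Invariant `3`-forms -/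

theorem theta_one : theta 1 1 1 = 1 := by
  rw [theta, one_smul, one_smul, Matrix.fromBlocks_one, Matrix.submatrix_one_equiv]

/-- A `G₂`-structure has a coframe at each point. -/
theorem Adapted.exists_isCoframe {φ : Form 3} (hφ : Tangential φ) {x : S7} {b : Fin 7 → HH}
    (hb : Adapted φ x b) : ∃ K, IsCoframe φ x K ∧ ∀ i, K (b i) = Pi.single i 1 := by
  obtain ⟨e, he0, he⟩ := hb.exists_basis
  let K : HH →ₗ[ℝ] Fin 7 → ℝ := LinearMap.pi fun i => e.coord i.succ
  have hK : ∀ i, K (b i) = Pi.single i 1 := by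
    intro i
    funext j
    change e.coord j.succ (b i) = _
    rw [← he, Module.Basis.coord_apply, Module.Basis.repr_self, Finsupp.single_apply,
      Pi.single_apply]
    simp [eq_comm]
  have hx : K x = 0 := by
    funext j
    change e.coord j.succ x = 0
    rw [← he0, Module.Basis.coord_apply, Module.Basis.repr_self, Finsupp.single_apply]
    simp [(Fin.succ_ne_zero j).symm]
  refine ⟨K, ⟨hx, fun v hv h => ?_, ?_⟩, hK⟩
  · have h1 := e.sum_repr v
    rw [Fin.sum_univ_succ, he0] at h1
    have h2 : ∑ i : Fin 7, e.repr v i.succ • e i.succ = 0 :=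
      Finset.sum_eq_zero fun i _ => by
        rw [show e.repr v i.succ = 0 from congrFun h i, zero_smul]
    rw [h2, add_zero] at h1
    rw [← h1, inner_smul_right, real_inner_self_eq_norm_sq, norm_coe, one_pow, mul_one] at hv
    rw [← h1, hv, zero_smul]
  -- The map that gives v the coordinates K v in the frame at `o`; pulling back the standard form by
  -- it produces a globally multilinear candidate for φ x.
  · let A : HH →L[ℝ] HH := ∑ i, ((LinearMap.proj i ∘ₗ K).toContinuousLinearMap).smulRight (eVec i)
    have hA : ∀ v, (fun a => eDual a (A v)) = K v := by
      intro v
      funext a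
      simp [A, eDual_eVec]
    let β : HH [⋀^Fin 3]→L[ℝ] ℝ := (formAt 1 1).compContinuousLinearMap A
    have hβ : ∀ v, β v = phi0 (K (v 0)) (K (v 1)) (K (v 2)) := by
      intro v
      change formAt 1 1 (fun n => A (v n)) = _
      rw [formAt_apply, formCoord_eq_phi0 1 1 1 1 (by norm_num) (by simp), theta_one,
        Matrix.one_mulVec, Matrix.one_mulVec, Matrix.one_mulVec, hA, hA, hA]
    suffices φ x = β by rw [this]; exact hβ
    have key : (φ x).toAlternatingMap = β.toAlternatingMap := by
      refine Module.Basis.ext_alternating e fun w _ => ?_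
      change φ x (fun i => e (w i)) = β fun i => e (w i)
      by_cases hz : ∃ n, w n = 0
      · obtain ⟨n, hn⟩ := hz
        rw [hφ _ _ ⟨n, by rw [hn, he0]⟩, hβ]
        fin_cases n <;> simp at hn <;> simp [hn, he0, hx, phi0, det3]
      · rw [not_exists] at hz
        choose w' hw' using fun n => Fin.exists_succ_eq.2 (hz n)
        have hv : (fun i => e (w i)) = ![b (w' 0), b (w' 1), b (w' 2)] := by
          funext n
          rw [← hw' n, he]
          fin_cases n <;> rfl
        rw [hv, hb.coeff, PhiAt_eVec, hβ]
        simp [hK]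
    exact ContinuousAlternatingMap.toAlternatingMap_injective key

/-! ### The isotropy group Sp(1) at the base point -/

theorem invForm_eq_of_invariant {k : ℕ} {α : Form k} (hα : Invariant α) : α = invForm (α o) := by
  funext x
  ext v
  rw [invForm_apply, ← hα (transport x) o x (act_transport x).symm]
  simp only [act_act_inv]

/-- The elements `diag(q, 1)` of the stabiliser of the base point. -/
def stab (q : ℍ[ℝ]) (h : q * star q = 1) : Sp2 :=
  ⟨!![q, 0; 0, 1], by
    have h' : star q * q = 1 := by rw [Quaternion.star_mul_self, ← Quaternion.self_mul_star, h]
    constructor <;>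
    · refine Matrix.ext fun a b => ?_
      fin_cases a <;> fin_cases b <;> simp [Matrix.mul_apply, h, h']⟩

theorem act_stab_o (q : ℍ[ℝ]) (h : q * star q = 1) : act (stab q h) o = (o : HH) := by
  ext1 a
  fin_cases a <;> simp [act_apply, stab, o]

theorem act_stab (q : ℍ[ℝ]) (h : q * star q = 1) (v : HH) :
    act (stab q h) v = WithLp.toLp 2 ![q * v 0, v 1] := by
  ext1 a
  fin_cases a <;> simp [act_apply, stab]

theorem qI_mul_star : qI * star qI = 1 := by ext <;> simp

theorem qJ_mul_star : qJ * star qJ = 1 := by ext <;> simp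

theorem act_stab_neg_one (i : Fin 7) :
    act (stab (-1) (by simp)) (eVec i) = (if i < 3 then (1 : ℝ) else -1) • eVec i := by
  rw [act_stab]
  ext1 a
  fin_cases i <;> fin_cases a <;> simp [eVec_apply, pBasis]

theorem act_stab_qI (i : Fin 7) :
    act (stab qI qI_mul_star) (eVec i)
      = ![eVec 0, eVec 1, eVec 2, -eVec 6, eVec 5, -eVec 4, eVec 3] i := by
  rw [act_stab]
  ext1 a
  fin_cases i <;> fin_cases a <;> simp [eVec_apply, pBasis] <;> ext <;> simp

theorem act_stab_qJ (i : Fin 7) :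
    act (stab qJ qJ_mul_star) (eVec i)
      = ![eVec 0, eVec 1, eVec 2, -eVec 5, -eVec 6, eVec 3, eVec 4] i := by
  rw [act_stab]
  ext1 a
  fin_cases i <;> fin_cases a <;> simp [eVec_apply, pBasis] <;> ext <;> simp

theorem exists_basis_eVec :
    ∃ e : Module.Basis (Fin 8) ℝ HH, e 0 = o ∧ ∀ i, e (Fin.succ i) = eVec i := by
  have h0 : (1 : Matrix (Fin 3) (Fin 3) ℝ).det ≠ 0 := by simp
  refine Adapted.exists_basis (φ := invForm (formAt 1 1)) (x := o)
    ((isCoframe_formAt_o (r := 1) (s := 1) (c := 1) (by norm_num) (by simp) h0).adapted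
      inner_o_eVec fun i => ?_)
  rw [theta_one]
  funext a
  simp [eDual_eVec, Pi.single_apply]

theorem apply_perm_three {β : HH [⋀^Fin 3]→L[ℝ] ℝ} (u v w : HH) :
    β ![v, u, w] = -β ![u, v, w] ∧ β ![u, w, v] = -β ![u, v, w] := by
  constructor
  · refine Eq.trans ?_ (β.toAlternatingMap.map_swap ![u, v, w] (i := 0) (j := 1) (by decide))
    change β _ = β _
    congr 1
    funext n
    fin_cases n <;> rfl
  · refine Eq.trans ?_ (β.toAlternatingMap.map_swap ![u, v, w] (i := 1) (j := 2) (by decide))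
    change β _ = β _
    congr 1
    funext n
    fin_cases n <;> rfl

/-- An alternating `3`-form that vanishes on `o` and on increasing triples of the `eVec i` is
zero. -/
theorem eq_zero_of_apply_eVec {β : HH [⋀^Fin 3]→L[ℝ] ℝ}
    (ho : ∀ v : Fin 3 → HH, (∃ n, v n = o) → β v = 0)
    (h : ∀ i j k : Fin 7, i < j → j < k → β ![eVec i, eVec j, eVec k] = 0) : β = 0 := by
  obtain ⟨e, he0, he⟩ := exists_basis_eVec
  have hs1 : ∀ i j k : Fin 7, i < k → j < k → i ≠ j → β ![eVec i, eVec j, eVec k] = 0 := by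
    intro i j k hi hj hij
    rcases lt_or_gt_of_ne hij with h1 | h1
    · exact h i j k h1 hj
    · rw [(apply_perm_three _ _ _).1, h j i k h1 hi, neg_zero]
  have hs2 : ∀ i j k : Fin 7, i ≠ j → j ≠ k → i ≠ k → β ![eVec i, eVec j, eVec k] = 0 := by
    intro i j k hij hjk hik
    by_cases h1 : i < k ∧ j < k
    · exact hs1 i j k h1.1 h1.2 hij
    · by_cases h2 : i < j ∧ k < j
      · rw [(apply_perm_three _ _ _).2, hs1 i k j h2.1 h2.2 hik, neg_zero]
      · rw [(apply_perm_three _ _ _).1, (apply_perm_three _ _ _).2,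
          hs1 j k i (by omega) (by omega) hjk]
        simp
  have key : β.toAlternatingMap = (0 : HH [⋀^Fin 3]→L[ℝ] ℝ).toAlternatingMap := by
    refine Module.Basis.ext_alternating e fun w hw => ?_
    change β (fun i => e (w i)) = 0
    by_cases hz : ∃ n, w n = 0
    · obtain ⟨n, hn⟩ := hz
      exact ho _ ⟨n, by rw [hn, he0]⟩
    · rw [not_exists] at hz
      choose w' hw' using fun n => Fin.exists_succ_eq.2 (hz n)
      have hinj : Function.Injective w' := fun a c hac => hw (by rw [← hw', ← hw', hac])
      have hv : (fun i => e (w i)) = ![eVec (w' 0), eVec (w' 1), eVec (w' 2)] := by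
        funext n
        rw [← hw' n, he]
        fin_cases n <;> rfl
      rw [hv]
      exact hs2 _ _ _ (hinj.ne (by decide)) (hinj.ne (by decide)) (hinj.ne (by decide))
  exact ContinuousAlternatingMap.toAlternatingMap_injective key

theorem formAt_eVec (c : ℝ) (C : Matrix (Fin 3) (Fin 3) ℝ) (i j k : Fin 7) :
    formAt c C ![eVec i, eVec j, eVec k]
      = formCoord c C ![Pi.single i 1, Pi.single j 1, Pi.single k 1] := by
  rw [formAt_apply]
  congr 1
  funext n a
  fin_cases n <;> simp [eDual_eVec, Pi.single_apply]

theorem apply_three_act_stab {φ : Form 3} (hφ : Invariant φ) (q : ℍ[ℝ]) (h : q * star q = 1)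
    (u v w : HH) :
    φ o ![act (stab q h) u, act (stab q h) v, act (stab q h) w] = φ o ![u, v, w] := by
  rw [← hφ (stab q h) o o (act_stab_o q h).symm ![u, v, w]]
  congr 1
  funext n
  fin_cases n <;> rfl

theorem map_smul_three (β : HH [⋀^Fin 3]→L[ℝ] ℝ) (a b c : ℝ) (u v w : HH) :
    β ![a • u, b • v, c • w] = a * b * c * β ![u, v, w] := by
  have h := β.toAlternatingMap.map_smul_univ ![a, b, c] ![u, v, w]
  rw [Fin.prod_univ_three] at h
  refine Eq.trans ?_ h
  change β _ = β _
  congr 1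
  funext n
  fin_cases n <;> rfl

theorem map_neg_three (β : HH [⋀^Fin 3]→L[ℝ] ℝ) (u v w : HH) :
    β ![u, -v, w] = -β ![u, v, w] ∧ β ![u, v, -w] = -β ![u, v, w] := by
  have h1 := map_smul_three β 1 (-1) 1 u v w
  have h2 := map_smul_three β 1 1 (-1) u v w
  simp only [one_smul, neg_smul] at h1 h2
  exact ⟨by rw [h1]; ring, by rw [h2]; ring⟩

/-- The `Sp(1)`-invariant `3`-forms. -/
theorem Invariant.eq_formAt {φ : Form 3} (ht : Tangential φ) (hφ : Invariant φ) :
    ∃ c C, φ = invForm (formAt c C) := by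
  obtain ⟨β, hβ⟩ : ∃ β, β = φ o := ⟨_, rfl⟩
  -- Among the 2-forms e⁴⁷, e⁴⁶, e⁴⁵ each occurs in exactly one of ω₁, ω₂, ω₃, with coefficient 1,
  -- so these components give the coefficients.
  obtain ⟨C, hC⟩ : ∃ C : Matrix (Fin 3) (Fin 3) ℝ, C = Matrix.of
    ![fun j => β ![eVec (Fin.castAdd 4 j), eVec 3, eVec 6],
      fun j => β ![eVec (Fin.castAdd 4 j), eVec 3, eVec 5],
      fun j => β ![eVec (Fin.castAdd 4 j), eVec 3, eVec 4]] := ⟨_, rfl⟩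
  obtain ⟨c, hc⟩ : ∃ c, c = β ![eVec 0, eVec 1, eVec 2] := ⟨_, rfl⟩
  suffices h : β - formAt c C = 0 by
    refine ⟨c, C, ?_⟩
    rw [invForm_eq_of_invariant hφ, ← hβ, sub_eq_zero.1 h]
  -- The element −1 of Sp(1) changes the sign of each horizontal vector and so kills every component
  -- with an odd number of horizontal indices.
  have hneg : ∀ i j k : Fin 7, β ![eVec i, eVec j, eVec k]
      = (if i < 3 then 1 else -1) * (if j < 3 then 1 else -1) * (if k < 3 then 1 else -1)
        * β ![eVec i, eVec j, eVec k] := by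
    intro i j k
    rw [← map_smul_three, ← act_stab_neg_one, ← act_stab_neg_one, ← act_stab_neg_one, hβ,
      apply_three_act_stab hφ]
  have hI : ∀ u v w, β ![act (stab qI qI_mul_star) u, act (stab qI qI_mul_star) v,
      act (stab qI qI_mul_star) w] = β ![u, v, w] := by
    rw [hβ]; exact apply_three_act_stab hφ _ _
  have hJ : ∀ u v w, β ![act (stab qJ qJ_mul_star) u, act (stab qJ qJ_mul_star) v,
      act (stab qJ qJ_mul_star) w] = β ![u, v, w] := by
    rw [hβ]; exact apply_three_act_stab hφ _ _
  -- The elements i and j tie the six horizontal pairs together two by two, exactly as they occur in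
  -- the ωᵢ. So −1, i, j already cut out the invariant forms.
  have e56 : ∀ l : Fin 3, β ![eVec (Fin.castAdd 4 l), eVec 5, eVec 6]
      = β ![eVec (Fin.castAdd 4 l), eVec 3, eVec 4] := by
    intro l
    rw [← hI _ (eVec 3), act_stab_qI, act_stab_qI, act_stab_qI]
    fin_cases l <;> simp [castAdd_zero, castAdd_one, castAdd_two, map_neg_three] <;>
      rw [(apply_perm_three _ _ _).2]
  have e46 : ∀ l : Fin 3, β ![eVec (Fin.castAdd 4 l), eVec 4, eVec 6]
      = -β ![eVec (Fin.castAdd 4 l), eVec 3, eVec 5] := by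
    intro l
    rw [← hI _ (eVec 3), act_stab_qI, act_stab_qI, act_stab_qI]
    fin_cases l <;> simp [castAdd_zero, castAdd_one, castAdd_two, map_neg_three] <;>
      rw [(apply_perm_three _ _ _).2]
  have e45 : ∀ l : Fin 3, β ![eVec (Fin.castAdd 4 l), eVec 4, eVec 5]
      = β ![eVec (Fin.castAdd 4 l), eVec 3, eVec 6] := by
    intro l
    rw [← hJ _ (eVec 3), act_stab_qJ, act_stab_qJ, act_stab_qJ]
    fin_cases l <;> simp [castAdd_zero, castAdd_one, castAdd_two, map_neg_three] <;>
      rw [(apply_perm_three _ _ _).2]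
  refine eq_zero_of_apply_eVec (fun v hv => ?_) fun i j k hij hjk => ?_
  · have h1 := tangential_formAt c C o v hv
    rw [invForm_formAt_o] at h1
    rw [ContinuousAlternatingMap.sub_apply, h1, hβ, ht o v hv, sub_zero]
  -- Increasing triples by number of horizontal indices: three or one, none, two.
  · have hd : ∀ i j k : Fin 7, i < j → j < k →
        (3 ≤ i ∨ (j < 3 ∧ 3 ≤ k)) ∨ (i = 0 ∧ j = 1 ∧ k = 2) ∨ ∃ l : Fin 3, i = Fin.castAdd 4 l ∧
          (j = 3 ∧ k = 4 ∨ j = 3 ∧ k = 5 ∨ j = 3 ∧ k = 6 ∨ j = 4 ∧ k = 5 ∨ j = 4 ∧ k = 6 ∨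
            j = 5 ∧ k = 6) := by decide
    have hP : ∀ i j k : Fin 7, i < j → j < k → (3 ≤ i ∨ (j < 3 ∧ 3 ≤ k)) →
        formCoord c C ![Pi.single i 1, Pi.single j 1, Pi.single k 1] = 0 := by
      intro i j k h1 h2 h
      have hd' : ∀ i j k : Fin 7, i < j → j < k → (3 ≤ i ∨ (j < 3 ∧ 3 ≤ k)) →
        (i = 3 ∧ j = 4 ∧ k = 5) ∨ (i = 3 ∧ j = 4 ∧ k = 6) ∨ (i = 3 ∧ j = 5 ∧ k = 6) ∨
        (i = 4 ∧ j = 5 ∧ k = 6) ∨ (((i = 0 ∧ j = 1) ∨ (i = 0 ∧ j = 2) ∨ (i = 1 ∧ j = 2)) ∧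
          (k = 3 ∨ k = 4 ∨ k = 5 ∨ k = 6)) := by decide
      rcases hd' i j k h1 h2 h with ⟨rfl, rfl, rfl⟩ | ⟨rfl, rfl, rfl⟩ | ⟨rfl, rfl, rfl⟩ |
        ⟨rfl, rfl, rfl⟩ | ⟨⟨rfl, rfl⟩ | ⟨rfl, rfl⟩ | ⟨rfl, rfl⟩, rfl | rfl | rfl | rfl⟩ <;>
      simp [formCoord, Fin.sum_univ_three, wedge12, omCoord, det3, castAdd_zero, castAdd_one,
        castAdd_two]
    rw [ContinuousAlternatingMap.sub_apply, formAt_eVec, sub_eq_zero]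
    rcases hd i j k hij hjk with h | ⟨rfl, rfl, rfl⟩ | ⟨l, rfl, h⟩
    · rw [hP i j k hij hjk h]
      have := hneg i j k
      rcases h with h | ⟨h, h'⟩
      · rw [if_neg (by omega), if_neg (by omega), if_neg (by omega)] at this
        linarith
      · rw [if_pos (by omega), if_pos (by omega), if_neg (by omega)] at this
        linarith
    · rw [← hc]
      simp [formCoord, Fin.sum_univ_three, wedge12, omCoord, det3, castAdd_zero, castAdd_one,
        castAdd_two]
    · rcases h with ⟨rfl, rfl⟩ | ⟨rfl, rfl⟩ | ⟨rfl, rfl⟩ | ⟨rfl, rfl⟩ | ⟨rfl, rfl⟩ | ⟨rfl, rfl⟩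
      all_goals
        try simp only [e45, e46, e56]
        fin_cases l <;> simp [hC, formCoord, Fin.sum_univ_three, wedge12, omCoord, det3,
          castAdd_zero, castAdd_one, castAdd_two]

/-! ### Invariant `G₂`-structures with metric `g_r` -/

theorem formCoord_smul (c r s : ℝ) (C : Matrix (Fin 3) (Fin 3) ℝ) (hrs : r * s ^ 2 = 1)
    (p : Fin 3 → Fin 7 → ℝ) :
    formCoord c C (fun n a => (if a < 3 then r else s) * p n a) = formCoord (r ^ 3 * c) C p := by
  have h : formCoord c C (fun n a => (if a < 3 then r else s) * p n a)
      = formCoord (r ^ 3 * c) ((r * s ^ 2) • C) p := by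
    simp only [formCoord, Fin.sum_univ_three, wedge12, omCoord, det3, castAdd_zero, castAdd_one,
      castAdd_two, Fin.reduceLT, if_true, if_false, Matrix.smul_apply, smul_eq_mul, Matrix.cons_val]
    ring
  rw [h, hrs, one_smul]

/-- `φ` has the components of `formAt γ C` in an oriented orthonormal frame. -/
structure HasComponents (N : Matrix (Fin 7) (Fin 7) ℝ) (γ : ℝ) (C : Matrix (Fin 3) (Fin 3) ℝ) :
    Prop where
  mul_transpose : N * N.transpose = 1
  det_eq_one : N.det = 1
  apply : ∀ i j k, phi0 (N i) (N j) (N k)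
    = formCoord γ C ![Pi.single i 1, Pi.single j 1, Pi.single k 1]

section MetricOfForm

variable {N : Matrix (Fin 7) (Fin 7) ℝ} {γ : ℝ} {C : Matrix (Fin 3) (Fin 3) ℝ}

/-- The contraction identity for φ₀ in an oriented orthonormal frame. The left side is quadratic in
γ and C; by `psi0_perm` the ψ₀-term on four distinct rows is a single component, up to sign. -/
theorem HasComponents.sum_mul (h : HasComponents N γ C) (i j k l : Fin 7) :
    ∑ a, formCoord γ C ![Pi.single a 1, Pi.single i 1, Pi.single j 1]
      * formCoord γ C ![Pi.single a 1, Pi.single k 1, Pi.single l 1]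
      = (if i = k then 1 else 0) * (if j = l then 1 else 0)
        - (if i = l then 1 else 0) * (if j = k then 1 else 0)
        + psi0 (N i) (N j) (N k) (N l) := by
  have hdot : ∀ i j, N i ⬝ᵥ N j = if i = j then 1 else 0 := fun i j => by
    rw [← Matrix.one_apply, ← h.mul_transpose]; rfl
  rw [← hdot, ← hdot, ← hdot, ← hdot, ← sum_phi0_mul_phi0,
    ← phi0_sum_mul_phi0 _ _ _ _ N h.mul_transpose]
  simp only [h.apply]

theorem HasComponents.psi0_perm (h : HasComponents N γ C) (σ : Equiv.Perm (Fin 7)) :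
    psi0 (N (σ 3)) (N (σ 4)) (N (σ 5)) (N (σ 6)) = (Equiv.Perm.sign σ : ℝ) * formCoord γ C
        ![Pi.single (σ 0) 1, Pi.single (σ 1) 1, Pi.single (σ 2) 1] := by
  have ho' : N.submatrix σ id * (N.submatrix σ id).transpose = 1 := by
    rw [Matrix.transpose_submatrix, ← Matrix.submatrix_mul _ _ _ _ _ Function.bijective_id,
      h.mul_transpose, Matrix.submatrix_one_equiv]
  have hp := psi0_eq_phi0 _ ho'
  rw [Matrix.det_permute, h.det_eq_one, mul_one] at hp
  rw [← h.apply]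
  exact hp

/-- The components of `formAt` with one vertical index. -/
theorem formCoord_single (γ : ℝ) (C : Matrix (Fin 3) (Fin 3) ℝ) (p q : Fin 7 → ℝ) :
    (∀ j : Fin 3, formCoord γ C ![Pi.single (Fin.castAdd 4 j) 1, p, q]
      = γ * det3 0 1 2 (Pi.single (Fin.castAdd 4 j) 1) p q + ∑ i, C i j * omCoord i p q) ∧
    formCoord γ C ![Pi.single 3 1, p, q] = ∑ i, ∑ j : Fin 3, C i j *
      (q (Fin.castAdd 4 j) * omCoord i (Pi.single 3 1) p
        - p (Fin.castAdd 4 j) * omCoord i (Pi.single 3 1) q) ∧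
    formCoord γ C ![Pi.single 4 1, p, q] = ∑ i, ∑ j : Fin 3, C i j *
      (q (Fin.castAdd 4 j) * omCoord i (Pi.single 4 1) p
        - p (Fin.castAdd 4 j) * omCoord i (Pi.single 4 1) q) ∧
    formCoord γ C ![Pi.single 5 1, p, q] = ∑ i, ∑ j : Fin 3, C i j *
      (q (Fin.castAdd 4 j) * omCoord i (Pi.single 5 1) p
        - p (Fin.castAdd 4 j) * omCoord i (Pi.single 5 1) q) ∧
    formCoord γ C ![Pi.single 6 1, p, q] = ∑ i, ∑ j : Fin 3, C i j *
      (q (Fin.castAdd 4 j) * omCoord i (Pi.single 6 1) p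
        - p (Fin.castAdd 4 j) * omCoord i (Pi.single 6 1) q) := by
  refine ⟨fun j => ?_, ?_, ?_, ?_, ?_⟩
  · fin_cases j <;>
    simp [formCoord, Fin.sum_univ_three, wedge12, omCoord, det3, castAdd_zero, castAdd_one,
      castAdd_two]
  all_goals
    simp [formCoord, Fin.sum_univ_three, wedge12, omCoord, det3, castAdd_zero, castAdd_one,
      castAdd_two]
    ring

-- Repeating the horizontal index 3 makes the ψ₀-term vanish, so the contraction identity becomes a
-- relation between the columns of C.
set_option maxRecDepth 10000 in
theorem HasComponents.column (h : HasComponents N γ C) (i j : Fin 3) :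
    C 0 i * C 0 j + C 1 i * C 1 j + C 2 i * C 2 j = if i = j then 1 else 0 := by
  have h1 := h.sum_mul 3 (Fin.castAdd 4 i) 3 (Fin.castAdd 4 j)
  have h2 : psi0 (N 3) (N (Fin.castAdd 4 i)) (N 3) (N (Fin.castAdd 4 j)) = 0 := by
    simp only [psi0, det4, det3]; ring
  obtain ⟨f0, f3, f4, f5, f6⟩ := formCoord_single γ C (Pi.single 3 1)
    (Pi.single (Fin.castAdd 4 i) 1)
  obtain ⟨g0, g3, g4, g5, g6⟩ := formCoord_single γ C (Pi.single 3 1)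
    (Pi.single (Fin.castAdd 4 j) 1)
  have f00 := f0 0
  have f01 := f0 1
  have f02 := f0 2
  have g00 := g0 0
  have g01 := g0 1
  have g02 := g0 2
  rw [castAdd_zero] at f00 g00
  rw [castAdd_one] at f01 g01
  rw [castAdd_two] at f02 g02
  rw [h2, Fin.sum_univ_seven, f00, f01, f02, f3, f4, f5, f6, g00, g01, g02, g3, g4, g5, g6] at h1
  clear f00 f01 f02 f3 f4 f5 f6 g00 g01 g02 g3 g4 g5 g6 f0 g0
  fin_cases i <;> fin_cases j <;>
    simp [Fin.sum_univ_three, omCoord, det3, castAdd_zero, castAdd_one, castAdd_two] at h1 ⊢ <;>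
    linarith

theorem HasComponents.transpose_mul (h : HasComponents N γ C) : C.transpose * C = 1 := by
  refine Matrix.ext fun i j => ?_
  rw [Matrix.mul_apply, Fin.sum_univ_three, Matrix.one_apply, ← h.column i j]
  rfl

theorem HasComponents.row (h : HasComponents N γ C) (i j : Fin 3) :
    C i 0 * C j 0 + C i 1 * C j 1 + C i 2 * C j 2 = if i = j then 1 else 0 := by
  rw [← Matrix.one_apply, ← mul_eq_one_comm.1 h.transpose_mul, Matrix.mul_apply,
    Fin.sum_univ_three]
  rfl

-- For four distinct horizontal indices the metric terms vanish. What remains is that the squared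
-- length of a row of C equals the ψ₀-term, which is γ.
set_option maxRecDepth 10000 in
theorem HasComponents.eq_one (h : HasComponents N γ C) : γ = 1 := by
  have h1 := h.sum_mul 3 4 5 6
  have h2 := h.psi0_perm 1
  simp only [Equiv.Perm.coe_one, id_eq, Equiv.Perm.sign_one] at h2
  have f0 := (formCoord_single γ C (Pi.single 3 1) (Pi.single 4 1)).1
  have f1 := (formCoord_single γ C (Pi.single 5 1) (Pi.single 6 1)).1
  obtain ⟨-, f3, f4, f5, f6⟩ := formCoord_single γ C (Pi.single 3 1) (Pi.single 4 1)
  have f00 := f0 0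
  have f01 := f0 1
  have f02 := f0 2
  have f10 := f1 0
  have f11 := f1 1
  have f12 := f1 2
  rw [castAdd_zero] at f00 f10
  rw [castAdd_one] at f01 f11
  rw [castAdd_two] at f02 f12
  have f012 := (formCoord_single γ C (Pi.single 1 1) (Pi.single 2 1)).1 0
  rw [castAdd_zero] at f012
  rw [h2, Fin.sum_univ_seven, f00, f01, f02, f10, f11, f12, f3, f4, f5, f6, f012] at h1
  clear f00 f01 f02 f3 f4 f5 f6 f10 f11 f12 f0 f1 f012
  simp [Fin.sum_univ_three, omCoord, det3, castAdd_zero, castAdd_one, castAdd_two] at h1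
  rw [← h1, h.row]
  simp

-- Two vertical and two horizontal indices, all distinct, equate a 2 × 2 minor of C with the entry
-- dual to it. This and the next two lemmas say that the third column of C is the cross product of
-- the first two, which excludes determinant −1.
set_option maxRecDepth 10000 in
theorem HasComponents.cofactor_two_two (h : HasComponents N γ C) :
    C 0 0 * C 1 1 - C 0 1 * C 1 0 = C 2 2 := by
  have h1 := h.sum_mul 0 3 1 4
  have h2 := h.psi0_perm ⟨![2, 5, 6, 0, 3, 1, 4], ![3, 5, 0, 4, 6, 1, 2], by decide, by decide⟩
  rw [show Equiv.Perm.sign _ = -1 by decide] at h2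
  simp only [Equiv.coe_fn_mk, Matrix.cons_val] at h2
  obtain ⟨f0, f3, f4, f5, f6⟩ := formCoord_single γ C (Pi.single 0 1) (Pi.single 3 1)
  obtain ⟨g0, g3, g4, g5, g6⟩ := formCoord_single γ C (Pi.single 1 1) (Pi.single 4 1)
  have f00 := f0 0
  have f01 := f0 1
  have f02 := f0 2
  have g00 := g0 0
  have g01 := g0 1
  have g02 := g0 2
  have k := (formCoord_single γ C (Pi.single 5 1) (Pi.single 6 1)).1 2
  rw [castAdd_zero] at f00 g00
  rw [castAdd_one] at f01 g01
  rw [castAdd_two] at f02 g02 k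
  rw [h2, Fin.sum_univ_seven, f00, f01, f02, g00, g01, g02, f3, f4, f5, f6, g3, g4, g5, g6, k] at h1
  clear f00 f01 f02 f3 f4 f5 f6 g00 g01 g02 g3 g4 g5 g6 f0 g0 k
  simp [Fin.sum_univ_three, omCoord, det3, castAdd_zero, castAdd_one, castAdd_two] at h1
  linarith

set_option maxRecDepth 10000 in
theorem HasComponents.cofactor_one_two (h : HasComponents N γ C) :
    C 2 0 * C 0 1 - C 0 0 * C 2 1 = C 1 2 := by
  have h1 := h.sum_mul 0 3 1 5
  have h2 := h.psi0_perm ⟨![2, 4, 6, 0, 3, 1, 5], ![3, 5, 0, 4, 1, 6, 2], by decide, by decide⟩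
  rw [show Equiv.Perm.sign _ = 1 by decide] at h2
  simp only [Equiv.coe_fn_mk, Matrix.cons_val] at h2
  obtain ⟨f0, f3, f4, f5, f6⟩ := formCoord_single γ C (Pi.single 0 1) (Pi.single 3 1)
  obtain ⟨g0, g3, g4, g5, g6⟩ := formCoord_single γ C (Pi.single 1 1) (Pi.single 5 1)
  have f00 := f0 0
  have f01 := f0 1
  have f02 := f0 2
  have g00 := g0 0
  have g01 := g0 1
  have g02 := g0 2
  have k := (formCoord_single γ C (Pi.single 4 1) (Pi.single 6 1)).1 2
  rw [castAdd_zero] at f00 g00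
  rw [castAdd_one] at f01 g01
  rw [castAdd_two] at f02 g02 k
  rw [h2, Fin.sum_univ_seven, f00, f01, f02, g00, g01, g02, f3, f4, f5, f6, g3, g4, g5, g6, k] at h1
  clear f00 f01 f02 f3 f4 f5 f6 g00 g01 g02 g3 g4 g5 g6 f0 g0 k
  simp [Fin.sum_univ_three, omCoord, det3, castAdd_zero, castAdd_one, castAdd_two] at h1
  linarith

set_option maxRecDepth 10000 in
theorem HasComponents.cofactor_zero_two (h : HasComponents N γ C) :
    C 1 0 * C 2 1 - C 2 0 * C 1 1 = C 0 2 := by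
  have h1 := h.sum_mul 0 3 1 6
  have h2 := h.psi0_perm ⟨![2, 4, 5, 0, 3, 1, 6], ![3, 5, 0, 4, 1, 2, 6], by decide, by decide⟩
  rw [show Equiv.Perm.sign _ = -1 by decide] at h2
  simp only [Equiv.coe_fn_mk, Matrix.cons_val] at h2
  obtain ⟨f0, f3, f4, f5, f6⟩ := formCoord_single γ C (Pi.single 0 1) (Pi.single 3 1)
  obtain ⟨g0, g3, g4, g5, g6⟩ := formCoord_single γ C (Pi.single 1 1) (Pi.single 6 1)
  have f00 := f0 0
  have f01 := f0 1
  have f02 := f0 2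
  have g00 := g0 0
  have g01 := g0 1
  have g02 := g0 2
  have k := (formCoord_single γ C (Pi.single 4 1) (Pi.single 5 1)).1 2
  rw [castAdd_zero] at f00 g00
  rw [castAdd_one] at f01 g01
  rw [castAdd_two] at f02 g02 k
  rw [h2, Fin.sum_univ_seven, f00, f01, f02, g00, g01, g02, f3, f4, f5, f6, g3, g4, g5, g6, k] at h1
  clear f00 f01 f02 f3 f4 f5 f6 g00 g01 g02 g3 g4 g5 g6 f0 g0 k
  simp [Fin.sum_univ_three, omCoord, det3, castAdd_zero, castAdd_one, castAdd_two] at h1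
  linarith

theorem HasComponents.mem_specialOrthogonalGroup (h : HasComponents N γ C) :
    C ∈ Matrix.specialOrthogonalGroup (Fin 3) ℝ := by
  refine Matrix.mem_specialOrthogonalGroup_iff.2
    ⟨(Matrix.mem_orthogonalGroup_iff' _ _).2 h.transpose_mul, ?_⟩
  have h1 := h.column 2 2
  rw [if_pos rfl] at h1
  rw [Matrix.det_fin_three, ← h1]
  linear_combination C 2 2 * h.cofactor_two_two + C 1 2 * h.cofactor_one_two
    + C 0 2 * h.cofactor_zero_two

theorem mem_B_iff {r : ℝ} (φ : Form 3) : φ ∈ B r ↔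
    ∃ C ∈ Matrix.specialOrthogonalGroup (Fin 3) ℝ, φ = invForm (formAt (r ^ 3) C) := by
  constructor
  · rintro ⟨D, hD, rfl⟩
    exact ⟨D⁻¹, inv_mem_specialOrthogonalGroup hD, by rw [Phi, PhiAt_eq_formAt]⟩
  · rintro ⟨C, hC, rfl⟩
    refine ⟨C⁻¹, inv_mem_specialOrthogonalGroup hC, ?_⟩
    have hC' : IsUnit C.det := by
      rw [(Matrix.mem_specialOrthogonalGroup_iff.1 hC).2]
      exact isUnit_one
    rw [Phi, PhiAt_eq_formAt, Matrix.nonsing_inv_nonsing_inv _ hC']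

theorem Adapted.act {φ : Form 3} (hφ : Invariant φ) {x y : S7} {b : Fin 7 → HH}
    (hb : Adapted φ x b) (A : Sp2) (hA : (y : HH) = G2Sphere.act A x) :
    Adapted φ y (fun i => G2Sphere.act A (b i)) where
  tangent i := by rw [hA, inner_act_act, hb.tangent]
  linearIndependent := by
    refine hb.linearIndependent.map' (G2Sphere.act A : HH →ₗ[ℝ] HH) ?_
    exact LinearMap.ker_eq_bot.2 (Function.LeftInverse.injective (act_inv_act A))
  coeff i j k := by
    rw [← hb.coeff i j k, ← hφ A x y hA ![b i, b j, b k]]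
    congr 1
    funext n
    fin_cases n <;> rfl

theorem mem_B_of_isMetricOf {r : ℝ} (hr : 0 < r) {φ : Form 3} (h : φ ∈ InvG2)
    (hm : IsMetricOf φ (g r)) : φ ∈ B r := by
  obtain ⟨⟨hs, -⟩, hi, b, hb, M, hM, hbM⟩ := h
  obtain ⟨c, C, hφ⟩ := hi.eq_formAt hs.tangential
  -- `transport o` fixes `o` but need not be the identity; moving the adapted basis by it expresses
  -- that basis in `frame o` with the same matrix M.
  have hb' := hb.act hi (transport o) (act_transport o).symm
  obtain ⟨K, hK, hKb⟩ := hb'.exists_isCoframe hs.tangential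
  obtain ⟨s, hs0, hrs⟩ := exists_mul_sq_eq_one hr
  -- Inverse lengths of the frame vectors for g_r: r for vertical and s for horizontal ones, as s² =
  -- r⁻¹. The rows of N below are the normalised frame in the coframe K.
  obtain ⟨ℓ, hℓ⟩ : ∃ ℓ : Fin 7 → ℝ, ℓ = fun a => if a < 3 then r⁻¹ else s⁻¹ := ⟨_, rfl⟩
  have hℓ0 : ∀ a, 0 < ℓ a := fun a => by rw [hℓ]; dsimp only; split_ifs <;> positivity
  obtain ⟨N, hN⟩ : ∃ N : Matrix (Fin 7) (Fin 7) ℝ, N = fun a => K (ℓ a • frame o a) := ⟨_, rfl⟩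
  have hcoord : ∀ i, coord o (ℓ i • frame o i)
      = fun a => (if a < 3 then r⁻¹ else s⁻¹) * (Pi.single i 1 : Fin 7 → ℝ) a := by
    intro i
    rw [coord_smul, coord_frame, hℓ]
    funext a
    by_cases hia : a = i
    · subst hia; simp
    · simp [hia]
  have ho : N * N.transpose = 1 := by
    refine Matrix.ext fun i j => ?_
    have h1 : (N * N.transpose) i j = N i ⬝ᵥ N j := rfl
    rw [h1, hN, ← hK.metric_eq hm, g_apply, hcoord, hcoord, Matrix.one_apply]
    by_cases hij : i = j
    · subst hij
      rw [Finset.sum_eq_single i (fun a _ ha => by simp [ha]) (by simp)]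
      by_cases h3 : i < 3
      · simp [h3]
        field_simp
      · simp [h3]
        rw [← mul_inv, ← mul_inv, ← sq, hrs, inv_one]
    · rw [if_neg hij]
      refine Finset.sum_eq_zero fun a _ => ?_
      by_cases hia : a = i
      · subst hia; simp [hij]
      · simp [hia]
  have hNℓ : N = Matrix.diagonal ℓ * Matrix.of fun a => K (frame o a) := by
    refine Matrix.ext fun i j => ?_
    rw [Matrix.diagonal_mul, hN]
    simp
  have hMN : M * (Matrix.of fun a => K (frame o a)) = 1 := by
    refine Matrix.ext fun i j => ?_
    have h1 := hKb i
    rw [hbM i, map_sum, map_sum] at h1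
    rw [Matrix.one_apply, show (if i = j then (1 : ℝ) else 0) = (Pi.single i 1 : Fin 7 → ℝ) j by
      rw [Pi.single_apply]; simp [eq_comm], ← h1, Finset.sum_apply, Matrix.mul_apply]
    refine Finset.sum_congr rfl fun a _ => ?_
    rw [map_smul, map_smul]
    rfl
  -- Orthogonality leaves ±1. The sign comes from N = diag(ℓ)M⁻¹, where M has positive determinant
  -- by the orientation.
  have hd : N.det = 1 := by
    have h1 : N.det * N.det = 1 := by simpa using congrArg Matrix.det ho
    have h2 := congrArg Matrix.det hMN
    rw [Matrix.det_mul, Matrix.det_one] at h2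
    have h3 : 0 < N.det := by
      rw [hNℓ, Matrix.det_mul, Matrix.det_diagonal]
      exact mul_pos (Finset.prod_pos fun a _ => hℓ0 a) (pos_of_mul_pos_right (h2 ▸ one_pos) hM.le)
    nlinarith
  have hF : ∀ i j k, phi0 (N i) (N j) (N k)
      = formCoord (r⁻¹ ^ 3 * c) C ![Pi.single i 1, Pi.single j 1, Pi.single k 1] := by
    intro i j k
    have h1 := hK.apply ![ℓ i • frame o i, ℓ j • frame o j, ℓ k • frame o k]
    have h2 : r⁻¹ * s⁻¹ ^ 2 = 1 := by rw [inv_pow, ← mul_inv, hrs, inv_one]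
    rw [← formCoord_smul c r⁻¹ s⁻¹ C h2, hN]
    refine h1.symm.trans ?_
    rw [hφ, invForm_formAt_apply]
    congr 1
    funext n
    fin_cases n
    · exact hcoord i
    · exact hcoord j
    · exact hcoord k
  have hcomp : HasComponents N (r⁻¹ ^ 3 * c) C := ⟨ho, hd, hF⟩
  have hc := hcomp.eq_one
  refine (mem_B_iff φ).2 ⟨C, hcomp.mem_specialOrthogonalGroup, ?_⟩
  rw [hφ]
  congr 2
  field_simp at hc
  exact hc

end MetricOfForm

/-! ### The isometric classes -/

theorem B_eq {r : ℝ} (hr : 0 < r) : B r = {φ | φ ∈ InvG2 ∧ IsMetricOf φ (g r)} := by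
  ext φ
  refine ⟨fun h => ?_, fun h => mem_B_of_isMetricOf hr h.1 h.2⟩
  obtain ⟨C, hC, rfl⟩ := (mem_B_iff φ).1 h
  exact ⟨formAt_mem_InvG2 hr hC, isMetricOf_formAt hr hC⟩

/-- A `G₂`-structure determines its metric. -/
theorem IsMetricOf.unique {φ : Form 3} (hφ : Tangential φ) {m m' : Tensor2} (hm : IsMetricOf φ m)
    (hm' : IsMetricOf φ m') : m = m' := by
  funext x
  obtain ⟨-, b, hb, -⟩ := hm x
  obtain ⟨K, hK, -⟩ := hb.exists_isCoframe hφ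
  refine LinearMap.ext fun v => LinearMap.ext fun w => ?_
  rw [hK.metric_eq hm, hK.metric_eq hm']

theorem isometricClass_eq {r : ℝ} (hr : 0 < r) {φ : Form 3} (hφ : φ ∈ B r) :
    isometricClass φ = B r := by
  have h := hφ
  rw [B_eq hr] at h
  ext φ'
  constructor
  · rintro ⟨h1, m, hm, hm'⟩
    rw [hm.unique h.1.1.isSmoothForm.tangential h.2] at hm'
    exact mem_B_of_isMetricOf hr h1 hm'
  · intro h'
    rw [B_eq hr] at h'
    exact ⟨h'.1, g r, h.2, h'.2⟩

theorem formAt_injective {c c' : ℝ} {C C' : Matrix (Fin 3) (Fin 3) ℝ}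
    (h : formAt c C = formAt c' C') : c = c' ∧ C = C' := by
  have key : ∀ i j k, formCoord c C ![Pi.single i 1, Pi.single j 1, Pi.single k 1]
      = formCoord c' C' ![Pi.single i 1, Pi.single j 1, Pi.single k 1] := fun i j k => by
    rw [← formAt_eVec, h, formAt_eVec]
  constructor
  · have := key 0 1 2
    simpa [formCoord, Fin.sum_univ_three, wedge12, omCoord, det3, castAdd_zero, castAdd_one,
      castAdd_two] using this
  · refine Matrix.ext fun i j => ?_
    have h6 := key (Fin.castAdd 4 j) 3 6
    have h5 := key (Fin.castAdd 4 j) 3 5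
    have h4 := key (Fin.castAdd 4 j) 3 4
    simp only [(formCoord_single _ _ _ _).1 j] at h4 h5 h6
    clear key
    simp [Fin.sum_univ_three, omCoord, det3] at h4 h5 h6
    fin_cases i
    exacts [h6, h5, h4]

theorem disjoint_B {r s : ℝ} (hr : 0 < r) (hs : 0 < s) (hrs : r ≠ s) : Disjoint (B r) (B s) := by
  refine Set.disjoint_left.2 fun φ h h' => hrs ?_
  obtain ⟨C, -, rfl⟩ := (mem_B_iff φ).1 h
  obtain ⟨C', -, hC⟩ := (mem_B_iff _).1 h'
  have h1 := congrFun hC o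
  rw [invForm_formAt_o, invForm_formAt_o] at h1
  exact (pow_left_inj₀ hr.le hs.le (by norm_num)).1 (formAt_injective h1).1

/-! ### The round and the squashed metric -/

/-- In ℍ² the vectors e₄, …, e₇ have length 1/√2, hence the weight 1/2. Comparison with the weights
r² and r⁻¹ of g_r explains the constants r³ = 2 and r³ = 2/5. -/
theorem inner_eq_coord (x : S7) (v : HH) {w : HH} (hw : ⟪(x : HH), w⟫ = 0) :
    ⟪v, w⟫ = ∑ i : Fin 7, (if i < 3 then 1 else 2⁻¹) * (coord x v i * coord x w i) := by
  have h : ∀ u v : HH, ⟪(o : HH), v⟫ = 0 → ⟪u, v⟫ =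
      ∑ i : Fin 7, (if i < 3 then 1 else 2⁻¹) * (eDual i u * eDual i v) := by
    intro u v hv
    have h2 : ∀ a b : ℝ, 2⁻¹ * (√2 * a * (√2 * b)) = a * b := fun a b => by
      rw [mul_mul_mul_comm, Real.mul_self_sqrt (by norm_num)]
      ring
    rw [inner_o] at hv
    rw [inner_eq_sum]
    simp only [Fin.sum_univ_seven, eDual_apply, Matrix.cons_val, Fin.reduceLT, if_true, if_false,
      h2, hv]
    ring
  rw [← inner_act_act (transport x)⁻¹, h]
  · rfl
  · rw [← act_transport_inv x, inner_act_act, hw]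

theorem isRound_g {r : ℝ} (hr : 0 < r) (h : r ^ 3 = 2) : IsRound (g r) := by
  refine ⟨r ^ 2, by positivity, fun x v w _ hw => ?_⟩
  have h1 : r⁻¹ = r ^ 2 * 2⁻¹ := by field_simp; linarith
  rw [inner_eq_coord x v hw, g_apply, Finset.mul_sum]
  refine Finset.sum_congr rfl fun i _ => ?_
  split_ifs
  · ring
  · rw [h1]; ring

theorem inner_hopf (x : S7) (l : Fin 3) (v : HH) :
    ⟪hopf x l, v⟫ = coord x v (Fin.castAdd 4 l) := by
  rw [coord, ← eta_eq_coframe, eta, norm_coe, hopf_eq]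
  simp

theorem isSquashed_g {r : ℝ} (hr : 0 < r) (h : r ^ 3 = 2 / 5) : IsSquashed (g r) := by
  -- The factor 2/r matches the horizontal parts; vertically r² = (2/r)(1 − 4/5) is then the
  -- condition r³ = 2/5.
  refine ⟨2 / r, by positivity, fun x v w _ hw => ?_⟩
  have h1 : r ^ 2 = 2 / r * (1 / 5) := by field_simp; linarith
  rw [inner_eq_coord x v hw, g_apply, Fin.sum_univ_seven, Fin.sum_univ_seven, Fin.sum_univ_three]
  simp only [inner_hopf, castAdd_zero, castAdd_one, castAdd_two, Fin.reduceLT, if_true,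
    if_false, h1]
  ring

/-! ### Wedge products with a `1`-form -/

theorem apply_perm_four (β : HH [⋀^Fin 4]→L[ℝ] ℝ) (v : Fin 4 → HH) (σ : Equiv.Perm (Fin 4)) :
    β (fun i => v (σ i)) = (Equiv.Perm.sign σ : ℝ) * β v := by
  have h := β.toAlternatingMap.map_perm v σ
  rw [Units.smul_def, zsmul_eq_mul] at h
  exact h

/-- A permutation of five indices is the choice of its first value together with a permutation of
the rest. The latter does not change the summand, so 24 equal terms cancel 4!. -/
theorem wedge_one_four (τ : HH [⋀^Fin 1]→L[ℝ] ℝ) (β : HH [⋀^Fin 4]→L[ℝ] ℝ) (v : Fin 5 → HH) :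
    wedge τ β v = wedge1and4 (fun n => τ ![v n]) (fun a b c e => β ![v a, v b, v c, v e]) := by
  have h1 : ∀ (p : Fin 5) (e : Equiv.Perm (Fin 4)),
      (Equiv.Perm.sign (Equiv.Perm.decomposeFin.symm (p, e)) : ℝ)
        * (τ (fun i => v (Equiv.Perm.decomposeFin.symm (p, e) (Fin.castAdd 4 i)))
          * β (fun j => v (Equiv.Perm.decomposeFin.symm (p, e) (Fin.natAdd 1 j))))
      = (if p = 0 then 1 else -1) * (τ ![v p] * β fun j => v (Equiv.swap 0 p j.succ)) := by
    intro p e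
    have e1 : (fun i : Fin 1 => v (Equiv.Perm.decomposeFin.symm (p, e) (Fin.castAdd 4 i)))
        = ![v p] := by
      funext i
      fin_cases i
      exact congrArg v (Equiv.Perm.decomposeFin_symm_apply_zero p e)
    have e2 : (fun j : Fin 4 => v (Equiv.Perm.decomposeFin.symm (p, e) (Fin.natAdd 1 j)))
        = fun j => (fun j => v (Equiv.swap 0 p j.succ)) (e j) := by
      funext j
      have : Fin.natAdd 1 j = j.succ := by ext; simp [add_comm]
      rw [this]
      exact congrArg v (Equiv.Perm.decomposeFin_symm_apply_succ e p j)
    have hs : (Equiv.Perm.sign e : ℝ) * (Equiv.Perm.sign e : ℝ) = 1 := by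
      rw [← Int.cast_mul, ← Units.val_mul, Int.units_mul_self]; simp
    rw [e1, e2, apply_perm_four β (fun j => v (Equiv.swap 0 p j.succ)) e,
      Equiv.Perm.decomposeFin.symm_sign]
    split_ifs
    · rw [one_mul]
      linear_combination (τ ![v p] * β fun j => v (Equiv.swap 0 p j.succ)) * hs
    · rw [Units.val_mul, Int.cast_mul]
      push_cast
      linear_combination -(τ ![v p] * β fun j => v (Equiv.swap 0 p j.succ)) * hs
  have h2 : wedge τ β v = ((Nat.factorial 1 : ℝ) * Nat.factorial 4)⁻¹ *
      ∑ q : Fin 5 × Equiv.Perm (Fin 4), (if q.1 = 0 then 1 else -1)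
        * (τ ![v q.1] * β fun j => v (Equiv.swap 0 q.1 j.succ)) := by
    rw [wedge]
    congr 1
    refine (Equiv.sum_comp (Equiv.Perm.decomposeFin (n := 4)).symm _).symm.trans ?_
    exact Finset.sum_congr rfl fun q _ => h1 q.1 q.2
  rw [h2, Fintype.sum_prod_type]
  simp only [Finset.sum_const, Finset.card_univ, Fin.sum_univ_five]
  have k : ∀ (p : Fin 5) (w : Fin 4 → HH) (σ : Equiv.Perm (Fin 4)),
      (∀ j, v (Equiv.swap 0 p j.succ) = w (σ j)) →
      (β fun j => v (Equiv.swap 0 p j.succ)) = (Equiv.Perm.sign σ : ℝ) * β w := by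
    intro p w σ h
    rw [← apply_perm_four]
    exact congrArg β (funext h)
  -- Exchanging 0 and p leaves the remaining vectors out of order; sorting them costs a cycle of
  -- length p, which together with the sign of the exchange yields (−1)ᵖ.
  rw [k 0 ![v 1, v 2, v 3, v 4] 1 (by intro j; fin_cases j <;> rfl),
    k 1 ![v 0, v 2, v 3, v 4] 1 (by intro j; fin_cases j <;> rfl),
    k 2 ![v 0, v 1, v 3, v 4] ⟨![1, 0, 2, 3], ![1, 0, 2, 3], by decide, by decide⟩
      (by intro j; fin_cases j <;> rfl),
    k 3 ![v 0, v 1, v 2, v 4] ⟨![1, 2, 0, 3], ![2, 0, 1, 3], by decide, by decide⟩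
      (by intro j; fin_cases j <;> rfl),
    k 4 ![v 0, v 1, v 2, v 3] ⟨![1, 2, 3, 0], ![3, 0, 1, 2], by decide, by decide⟩
      (by intro j; fin_cases j <;> rfl),
    show Equiv.Perm.sign (⟨![1, 0, 2, 3], ![1, 0, 2, 3], _, _⟩ : Equiv.Perm (Fin 4)) = -1 by decide,
    show Equiv.Perm.sign (⟨![1, 2, 0, 3], ![2, 0, 1, 3], _, _⟩ : Equiv.Perm (Fin 4)) = 1 by decide,
    show Equiv.Perm.sign (⟨![1, 2, 3, 0], ![3, 0, 1, 2], _, _⟩ : Equiv.Perm (Fin 4)) = -1 by decide]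
  have hc : (Fintype.card (Equiv.Perm (Fin 4)) : ℝ) = 24 := by
    rw [Fintype.card_eq_nat_card, Nat.card_perm]
    simp [Nat.factorial]
  simp [wedge1and4, Nat.factorial, hc]
  ring

/-- Wedging with eᵐ annihilates eˡ⁺¹ ∧ eˡ⁺² ∧ ωᵢ unless l = m, when it produces e¹²³ ∧ ωᵢ. -/
theorem wedge1and4_fourCoord (s : ℝ) (B : Matrix (Fin 3) (Fin 3) ℝ) (m : Fin 3)
    (p : Fin 5 → Fin 7 → ℝ) :
    wedge1and4 (fun n => p n (Fin.castAdd 4 m))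
      (fun a b c e => fourCoord s B ![p a, p b, p c, p e])
      = s * wedge1and4 (fun n => p n (Fin.castAdd 4 m))
        (fun a b c e => det4 3 4 5 6 (p a) (p b) (p c) (p e))
        + ∑ i : Fin 3, B i m * wedge2and3 (fun n k => omCoord i (p n) (p k))
          (fun a b c => det3 0 1 2 (p a) (p b) (p c)) := by
  have h : ∀ i l : Fin 3, wedge1and4 (fun n => p n (Fin.castAdd 4 m))
      (fun a b c e => eeCoord (l + 1) (l + 2) i ![p a, p b, p c, p e])
      = if l = m then wedge2and3 (fun n k => omCoord i (p n) (p k))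
          (fun a b c => det3 0 1 2 (p a) (p b) (p c)) else 0 := by
    intro i l
    obtain ⟨w, hw⟩ : ∃ w : Fin 5 → Fin 5 → ℝ, ∀ n k, omCoord i (p n) (p k) = w n k :=
      ⟨_, fun _ _ => rfl⟩
    simp only [wedge1and4, eeCoord, wedge112, Matrix.cons_val, hw, wedge2and3]
    clear hw
    fin_cases l <;> fin_cases m <;>
      simp [castAdd_zero, castAdd_one, castAdd_two, det3] <;> ring
  have h' : wedge1and4 (fun n => p n (Fin.castAdd 4 m))
      (fun a b c e => fourCoord s B ![p a, p b, p c, p e])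
      = s * wedge1and4 (fun n => p n (Fin.castAdd 4 m))
        (fun a b c e => det4 3 4 5 6 (p a) (p b) (p c) (p e))
        + ∑ i : Fin 3, ∑ l : Fin 3, B i l * wedge1and4 (fun n => p n (Fin.castAdd 4 m))
      (fun a b c e => eeCoord (l + 1) (l + 2) i ![p a, p b, p c, p e]) := by
    simp only [wedge1and4, fourCoord, Fin.sum_univ_three, Matrix.cons_val]
    ring
  rw [h']
  congr 1
  refine Finset.sum_congr rfl fun i _ => ?_
  simp only [h]
  simp

/-! ### The torsion of `Φ(r, D)` -/

/-- The axial vector of `diag(-1, 1, -1) C`, which is the torsion form `τ₁` up to a factor. -/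
def nu (C : Matrix (Fin 3) (Fin 3) ℝ) (m : Fin 3) : ℝ :=
  eps (m + 2) * C (m + 2) (m + 1) - eps (m + 1) * C (m + 1) (m + 2)

theorem d_dualForm_apply (r : ℝ) (C : Matrix (Fin 3) (Fin 3) ℝ) (x : S7) (v : Fin 5 → HH) :
    d (dualForm r C) x v = ∑ m, 2 * r * nu C m * fiveCoord m (fun n => coord x (v n)) := by
  rw [dualForm, d_fourAt_apply]
  refine Finset.sum_congr rfl fun m _ => ?_
  simp only [nu, Matrix.smul_apply, smul_eq_mul]
  ring

theorem coord_frame_five (x : S7) (a b c e f : Fin 7) :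
    (fun n => coord x ((![frame x a, frame x b, frame x c, frame x e, frame x f] : Fin 5 → HH) n))
      = ![Pi.single a 1, Pi.single b 1, Pi.single c 1, Pi.single e 1, Pi.single f 1] := by
  funext n
  fin_cases n <;> exact coord_frame x _

theorem coord_frame_four (x : S7) (a b c e : Fin 7) :
    (fun n => coord x ((![frame x a, frame x b, frame x c, frame x e] : Fin 4 → HH) n))
      = ![Pi.single a 1, Pi.single b 1, Pi.single c 1, Pi.single e 1] := by
  funext n
  fin_cases n <;> exact coord_frame x _

/-- This choice of vectors isolates the summand eᵐ ∧ e⁴⁵⁶⁷. -/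
theorem fiveCoord_vertical (m l : Fin 3) : fiveCoord m ![Pi.single (Fin.castAdd 4 l) 1,
    Pi.single 3 1, Pi.single 4 1, Pi.single 5 1, Pi.single 6 1] = if m = l then 1 else 0 := by
  fin_cases l <;> fin_cases m <;>
    simp [fiveCoord, wedge1and4, wedge2and3, det4, det3, omCoord, castAdd_zero, castAdd_one,
      castAdd_two]

/-- This choice isolates εₘ e¹²³ ∧ ωₘ; the partner of e⁴ in ω₁, ω₂, ω₃ is e⁷, e⁶, e⁵. -/
theorem fiveCoord_horizontal (m i : Fin 3) : fiveCoord m ![Pi.single 0 1, Pi.single 1 1,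
    Pi.single 2 1, Pi.single 3 1, Pi.single (![6, 5, 4] i) 1] = if m = i then eps m else 0 := by
  fin_cases i <;> fin_cases m <;>
    simp [fiveCoord, wedge1and4, wedge2and3, det4, det3, omCoord, castAdd_zero, castAdd_one,
      castAdd_two]

theorem d_dualForm_vertical (r : ℝ) (C : Matrix (Fin 3) (Fin 3) ℝ) (x : S7) (l : Fin 3) :
    d (dualForm r C) x ![frame x (Fin.castAdd 4 l), frame x 3, frame x 4, frame x 5, frame x 6]
      = 2 * r * nu C l := by
  rw [d_dualForm_apply, coord_frame_five]
  simp only [fiveCoord_vertical]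
  simp

theorem d_dualForm_horizontal (r : ℝ) (C : Matrix (Fin 3) (Fin 3) ℝ) (x : S7) (i : Fin 3) :
    d (dualForm r C) x ![frame x 0, frame x 1, frame x 2, frame x 3, frame x (![6, 5, 4] i)]
      = 2 * r * nu C i * eps i := by
  rw [d_dualForm_apply, coord_frame_five]
  simp only [fiveCoord_horizontal]
  simp

theorem coclosed_formAt_iff {r : ℝ} (hr : 0 < r) {C : Matrix (Fin 3) (Fin 3) ℝ}
    (hC : C ∈ Matrix.specialOrthogonalGroup (Fin 3) ℝ) :
    Coclosed (invForm (formAt (r ^ 3) C)) ↔ nu C = 0 := by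
  simp only [Coclosed, isDual_formAt_iff hr hC, exists_eq_left]
  constructor
  · intro h
    funext l
    have := d_dualForm_vertical r C o l
    rw [h] at this
    have h2 : 2 * r * nu C l = 0 := this.symm
    simpa [hr.ne'] using h2
  · intro h
    funext x
    ext v
    rw [d_dualForm_apply, h]
    simp

theorem fourCoord_horizontal (s : ℝ) (B : Matrix (Fin 3) (Fin 3) ℝ) :
    fourCoord s B ![Pi.single 3 1, Pi.single 4 1, Pi.single 5 1, Pi.single 6 1] = s := by
  simp [fourCoord, det4, det3, Fin.sum_univ_three, eeCoord, wedge112, castAdd_zero, castAdd_one,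
      castAdd_two]

theorem fourCoord_mixed (s : ℝ) (B : Matrix (Fin 3) (Fin 3) ℝ) (i l : Fin 3) :
    fourCoord s B ![Pi.single (Fin.castAdd 4 (l + 1)) 1, Pi.single (Fin.castAdd 4 (l + 2)) 1,
      Pi.single 3 1, Pi.single (![6, 5, 4] i) 1] = B i l := by
  fin_cases i <;> fin_cases l <;>
  simp [fourCoord, det4, det3, Fin.sum_univ_three, eeCoord, wedge112, omCoord, castAdd_zero,
    castAdd_one, castAdd_two]

theorem fourAt_injective {s s' : ℝ} {B B' : Matrix (Fin 3) (Fin 3) ℝ}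
    (h : invForm (fourAt s B) = invForm (fourAt s' B')) : s = s' ∧ B = B' := by
  have key : ∀ a b c e, fourCoord s B ![Pi.single a 1, Pi.single b 1, Pi.single c 1, Pi.single e 1]
      = fourCoord s' B' ![Pi.single a 1, Pi.single b 1, Pi.single c 1, Pi.single e 1] :=
    fun a b c e => by
      rw [← coord_frame_four o, ← invForm_fourAt_apply, h, invForm_fourAt_apply]
  refine ⟨?_, Matrix.ext fun i l => ?_⟩
  · rw [← fourCoord_horizontal s B, key, fourCoord_horizontal]
  · rw [← fourCoord_mixed s B i l, key, fourCoord_mixed]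

theorem fourAt_smul (t s : ℝ) (B : Matrix (Fin 3) (Fin 3) ℝ) :
    fourAt (t * s) (t • B) = t • fourAt s B := by
  simp only [fourAt, smul_add, Finset.smul_sum, Matrix.smul_apply, smul_smul, smul_eq_mul]

/-- Both dφ and τ₀ψ are of the form `fourAt`, whose coefficients are unique, so the equation is
compared coefficient by coefficient. -/
theorem nearlyParallel_formAt_iff {r : ℝ} (hr : 0 < r) {C : Matrix (Fin 3) (Fin 3) ℝ}
    (hC : C ∈ Matrix.specialOrthogonalGroup (Fin 3) ℝ) :
    NearlyParallel (invForm (formAt (r ^ 3) C)) ↔ nu C = 0 ∧ ∃ τ₀ : ℝ, τ₀ ≠ 0 ∧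
      2 * ∑ j, eps j * C j j = τ₀ * (r ^ 2)⁻¹ ∧ ∀ i l, eps i * ((if i = l then
        r ^ 3 + 2 * ∑ j, eps j * C j j else 0) - 2 * (eps i * C i l) - 2 * (eps l * C l i))
        = τ₀ * (r * C i l) := by
  rw [← coclosed_formAt_iff hr hC]
  simp only [Coclosed, NearlyParallel, isDual_formAt_iff hr hC, exists_eq_left]
  refine and_congr_right fun _ => exists_congr fun τ₀ => and_congr_right fun _ => ?_
  rw [d_formAt, dualForm, ← invForm_smul, ← fourAt_smul]
  constructor
  · intro h
    obtain ⟨h1, h2⟩ := fourAt_injective h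
    exact ⟨h1, fun i l => congrFun (congrFun h2 i) l⟩
  · rintro ⟨h1, h2⟩
    rw [← h1]
    congr 2
    exact Matrix.ext h2

theorem dualForm_frame (r : ℝ) (C : Matrix (Fin 3) (Fin 3) ℝ) (x : S7) (a b c e : Fin 7) :
    dualForm r C x ![frame x a, frame x b, frame x c, frame x e] = fourCoord (r ^ 2)⁻¹ (r • C)
      ![Pi.single a 1, Pi.single b 1, Pi.single c 1, Pi.single e 1] := by
  rw [dualForm, invForm_fourAt_apply, coord_frame_four]

theorem wedge_dualForm_vertical (r : ℝ) (C : Matrix (Fin 3) (Fin 3) ℝ) (x : S7)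
    (τ : HH [⋀^Fin 1]→L[ℝ] ℝ) (l : Fin 3) : wedge τ (dualForm r C x)
      ![frame x (Fin.castAdd 4 l), frame x 3, frame x 4, frame x 5, frame x 6]
      = τ ![frame x (Fin.castAdd 4 l)] * (r ^ 2)⁻¹ := by
  rw [wedge_one_four]
  simp only [wedge1and4, Matrix.cons_val, dualForm_frame, fourCoord_horizontal]
  fin_cases l <;>
  simp [fourCoord, det4, det3, Fin.sum_univ_three, eeCoord, wedge112, omCoord, castAdd_zero,
    castAdd_one, castAdd_two]

theorem wedge_dualForm_horizontal (r : ℝ) (C : Matrix (Fin 3) (Fin 3) ℝ) (x : S7)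
    (τ : HH [⋀^Fin 1]→L[ℝ] ℝ) (i : Fin 3) : wedge τ (dualForm r C x)
      ![frame x 0, frame x 1, frame x 2, frame x 3, frame x (![6, 5, 4] i)]
      = r * ∑ l, C i l * τ ![frame x (Fin.castAdd 4 l)] := by
  rw [wedge_one_four]
  simp only [wedge1and4, Matrix.cons_val, dualForm_frame]
  fin_cases i <;>
  simp [fourCoord, det4, det3, Fin.sum_univ_three, eeCoord, wedge112, omCoord, castAdd_zero,
    castAdd_one, castAdd_two] <;> ring

/-- The vertical `1`-form `∑ tₗ eˡ`. -/
def verticalForm (t : Fin 3 → ℝ) : HH [⋀^Fin 1]→L[ℝ] ℝ := ∑ l, t l • eForm ![Fin.castAdd 4 l]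

theorem verticalForm_apply (t : Fin 3 → ℝ) (x : S7) (v : HH) :
    invForm (verticalForm t) x ![v] = ∑ l, t l * coord x v (Fin.castAdd 4 l) := by
  rw [invForm_apply, verticalForm, ContinuousAlternatingMap.sum_apply]
  refine Finset.sum_congr rfl fun l _ => ?_
  rw [ContinuousAlternatingMap.smul_apply, eForm_apply, Matrix.det_fin_one]
  rfl

theorem tangential_verticalForm (t : Fin 3 → ℝ) : Tangential (invForm (verticalForm t)) := by
  refine tangential_invForm fun v h => ?_
  simp [verticalForm, eForm_eq_zero _ _ h]

/-- The hypothesis Cν = Eν says that the rotation EC fixes its axis. The two kinds of components of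
dψ = 4τ₁ ∧ ψ then prescribe the same vertical form τ₁ up to a factor r³. -/
theorem locallyConformallyCoclosed_formAt_iff {r : ℝ} (hr : 0 < r)
    {C : Matrix (Fin 3) (Fin 3) ℝ} (hC : C ∈ Matrix.specialOrthogonalGroup (Fin 3) ℝ)
    (hν : ∀ i, ∑ l, C i l * nu C l = eps i * nu C i) :
    LocallyConformallyCoclosed (invForm (formAt (r ^ 3) C)) ↔
      r = 1 ∨ Coclosed (invForm (formAt (r ^ 3) C)) := by
  rw [coclosed_formAt_iff hr hC]
  simp only [LocallyConformallyCoclosed, isDual_formAt_iff hr hC, exists_eq_left]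
  constructor
  · rintro ⟨τ, -, h⟩
    -- Components along eˡ ∧ e⁴⁵⁶⁷: the vertical part of τ₁ must be r³ν/2.
    have h1 : ∀ l, 2 * τ o ![frame o (Fin.castAdd 4 l)] = r ^ 3 * nu C l := by
      intro l
      have h2 := h o ![frame o (Fin.castAdd 4 l), frame o 3, frame o 4, frame o 5, frame o 6]
      rw [d_dualForm_vertical, wedge_dualForm_vertical] at h2
      field_simp at h2
      linarith
    -- Components along e¹²³ ∧ ωᵢ: 2Cτ₁ = Eν. Insert τ₁ = r³ν/2 and Cν = Eν.
    have h3 : ∀ i, (r ^ 3 - 1) * nu C i = 0 := by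
      intro i
      have h2 := h o ![frame o 0, frame o 1, frame o 2, frame o 3, frame o (![6, 5, 4] i)]
      rw [d_dualForm_horizontal, wedge_dualForm_horizontal] at h2
      have h4 : 2 * ∑ l, C i l * τ o ![frame o (Fin.castAdd 4 l)] = r ^ 3 * (eps i * nu C i) := by
        rw [← hν, Finset.mul_sum, Finset.mul_sum]
        refine Finset.sum_congr rfl fun l _ => ?_
        linear_combination C i l * h1 l
      have h5 : r * ((r ^ 3 - 1) * nu C i) = 0 := by
        have := eps_mul_self i
        linear_combination (-r * eps i) * h4 - eps i / 2 * h2 - (r ^ 4 - r) * nu C i * this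
      exact (mul_eq_zero.1 h5).resolve_left hr.ne'
    by_cases hr1 : r ^ 3 = 1
    · exact Or.inl ((pow_eq_one_iff_of_nonneg hr.le (by norm_num)).1 hr1)
    · exact Or.inr (funext fun i => (mul_eq_zero.1 (h3 i)).resolve_left (sub_ne_zero.2 hr1))
  · rintro (rfl | h)
    -- The value r³ν/2 forced above, at r = 1.
    · refine ⟨invForm (verticalForm fun l => nu C l / 2), tangential_verticalForm _, fun x v => ?_⟩
      obtain ⟨p, hp⟩ : ∃ p : Fin 5 → Fin 7 → ℝ, ∀ n, coord x (v n) = p n := ⟨_, fun _ => rfl⟩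
      have h1 : ∀ a b c e, dualForm 1 C x ![v a, v b, v c, v e]
          = fourCoord 1 C ![p a, p b, p c, p e] := by
        intro a b c e
        rw [dualForm, invForm_fourAt_apply, one_smul, one_pow, inv_one]
        congr 1
        funext n
        fin_cases n <;> exact hp _
      have h2 : wedge1and4 (fun n => ∑ l, nu C l / 2 * p n (Fin.castAdd 4 l))
          (fun a b c e => fourCoord 1 C ![p a, p b, p c, p e])
          = ∑ l, nu C l / 2 * wedge1and4 (fun n => p n (Fin.castAdd 4 l))
          (fun a b c e => fourCoord 1 C ![p a, p b, p c, p e]) := by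
        simp only [wedge1and4, Fin.sum_univ_three]
        ring
      rw [d_dualForm_apply, wedge_one_four]
      simp only [verticalForm_apply, hp, h1]
      rw [h2]
      simp only [wedge1and4_fourCoord, fiveCoord]
      have n0 := hν 0
      have n1 := hν 1
      have n2 := hν 2
      obtain ⟨W, hW⟩ : ∃ W : Fin 3 → ℝ, ∀ i, wedge2and3 (fun n k => omCoord i (p n) (p k))
        (fun a b c => det3 0 1 2 (p a) (p b) (p c)) = W i := ⟨_, fun _ => rfl⟩
      simp only [Fin.sum_univ_three, hW] at n0 n1 n2 ⊢
      linear_combination -2 * W 0 * n0 - 2 * W 1 * n1 - 2 * W 2 * n2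
    · refine ⟨0, fun x v _ => rfl, fun x v => ?_⟩
      rw [d_dualForm_apply, h, wedge_one_four]
      simp [wedge1and4]

/-! ### The wedge product of decomposable forms -/

theorem wedge_invForm {k l : ℕ} (α : HH [⋀^Fin k]→L[ℝ] ℝ) (β : HH [⋀^Fin l]→L[ℝ] ℝ) (x : S7)
    (v : Fin (k + l) → HH) :
    wedge (invForm α x) (invForm β x) v
      = wedge α β (fun n => act ((transport x)⁻¹ : Sp2) (v n)) := by
  simp only [wedge, invForm_apply]

theorem wedge_add_left {k l : ℕ} (α α' : HH [⋀^Fin k]→L[ℝ] ℝ) (β : HH [⋀^Fin l]→L[ℝ] ℝ)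
    (v : Fin (k + l) → HH) : wedge (α + α') β v = wedge α β v + wedge α' β v := by
  simp only [wedge, ContinuousAlternatingMap.add_apply, add_mul, mul_add, Finset.sum_add_distrib]

theorem wedge_add_right {k l : ℕ} (α : HH [⋀^Fin k]→L[ℝ] ℝ) (β β' : HH [⋀^Fin l]→L[ℝ] ℝ)
    (v : Fin (k + l) → HH) : wedge α (β + β') v = wedge α β v + wedge α β' v := by
  simp only [wedge, ContinuousAlternatingMap.add_apply, mul_add, Finset.sum_add_distrib]

theorem wedge_sub_left {k l : ℕ} (α α' : HH [⋀^Fin k]→L[ℝ] ℝ) (β : HH [⋀^Fin l]→L[ℝ] ℝ)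
    (v : Fin (k + l) → HH) : wedge (α - α') β v = wedge α β v - wedge α' β v := by
  simp only [wedge, ContinuousAlternatingMap.sub_apply, sub_mul, mul_sub, Finset.sum_sub_distrib]

theorem wedge_sub_right {k l : ℕ} (α : HH [⋀^Fin k]→L[ℝ] ℝ) (β β' : HH [⋀^Fin l]→L[ℝ] ℝ)
    (v : Fin (k + l) → HH) : wedge α (β - β') v = wedge α β v - wedge α β' v := by
  simp only [wedge, ContinuousAlternatingMap.sub_apply, mul_sub, Finset.sum_sub_distrib]

theorem wedge_smul_left {k l : ℕ} (c : ℝ) (α : HH [⋀^Fin k]→L[ℝ] ℝ) (β : HH [⋀^Fin l]→L[ℝ] ℝ)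
    (v : Fin (k + l) → HH) : wedge (c • α) β v = c * wedge α β v := by
  simp only [wedge, ContinuousAlternatingMap.smul_apply, smul_eq_mul, Finset.mul_sum]
  exact Finset.sum_congr rfl fun σ _ => by ring

theorem wedge_smul_right {k l : ℕ} (c : ℝ) (α : HH [⋀^Fin k]→L[ℝ] ℝ) (β : HH [⋀^Fin l]→L[ℝ] ℝ)
    (v : Fin (k + l) → HH) : wedge α (c • β) v = c * wedge α β v := by
  simp only [wedge, ContinuousAlternatingMap.smul_apply, smul_eq_mul, Finset.mul_sum]
  exact Finset.sum_congr rfl fun σ _ => by ring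

theorem wedge_sum_left {k l : ℕ} {ι : Type*} [Fintype ι] (α : ι → HH [⋀^Fin k]→L[ℝ] ℝ)
    (β : HH [⋀^Fin l]→L[ℝ] ℝ) (v : Fin (k + l) → HH) :
    wedge (∑ i, α i) β v = ∑ i, wedge (α i) β v := by
  simp only [wedge, ContinuousAlternatingMap.sum_apply, Finset.mul_sum, Finset.sum_mul]
  rw [Finset.sum_comm]

theorem wedge_sum_right {k l : ℕ} {ι : Type*} [Fintype ι] (α : HH [⋀^Fin k]→L[ℝ] ℝ)
    (β : ι → HH [⋀^Fin l]→L[ℝ] ℝ) (v : Fin (k + l) → HH) :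
    wedge α (∑ i, β i) v = ∑ i, wedge α (β i) v := by
  simp only [wedge, ContinuousAlternatingMap.sum_apply, Finset.mul_sum]
  rw [Finset.sum_comm]

theorem eForm_eq_sum {k : ℕ} (c : Fin k → Fin 7) (v : Fin k → HH) :
    eForm c v = ∑ σ : Equiv.Perm (Fin k), (Equiv.Perm.sign σ : ℝ) * ∏ i, eDual (c i) (v (σ i)) := by
  rw [eForm_apply, Matrix.det_apply']
  rfl

/-- Both factors expand into sums over permutations π and ρ. For each pair the substitution σ ↦ σ(π
⊕ ρ) turns the sum over σ into the full determinant, so there are k! l! equal terms. -/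
theorem wedge_eForm {k l : ℕ} (a : Fin k → Fin 7) (b : Fin l → Fin 7) (v : Fin (k + l) → HH) :
    wedge (eForm a) (eForm b) v = eForm (Fin.append a b) v := by
  have h : ∀ (π : Equiv.Perm (Fin k)) (ρ : Equiv.Perm (Fin l)),
      ∑ σ : Equiv.Perm (Fin (k + l)), (Equiv.Perm.sign σ : ℝ) *
        (((Equiv.Perm.sign π : ℝ) * ∏ i, eDual (a i) (v (σ (Fin.castAdd l (π i)))))
        * ((Equiv.Perm.sign ρ : ℝ) * ∏ j, eDual (b j) (v (σ (Fin.natAdd k (ρ j))))))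
      = eForm (Fin.append a b) v := by
    intro π ρ
    let κ : Equiv.Perm (Fin (k + l)) := finSumFinEquiv.permCongr (Equiv.Perm.sumCongr π ρ)
    have h1 : ∀ i, κ (Fin.castAdd l i) = Fin.castAdd l (π i) := fun i => by
      simp [κ, Equiv.permCongr_apply]
    have h2 : ∀ j, κ (Fin.natAdd k j) = Fin.natAdd k (ρ j) := fun j => by
      simp [κ, Equiv.permCongr_apply]
    have h3 : Equiv.Perm.sign κ = Equiv.Perm.sign π * Equiv.Perm.sign ρ := by
      rw [Equiv.Perm.sign_permCongr, Equiv.Perm.sign_sumCongr]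
    rw [eForm_eq_sum]
    refine Fintype.sum_equiv (Equiv.mulRight κ) _ _ fun σ => ?_
    rw [Equiv.coe_mulRight, Equiv.Perm.sign_mul, h3, Fin.prod_univ_add]
    simp only [Equiv.Perm.mul_apply, h1, h2, Fin.append_left, Fin.append_right, Units.val_mul,
      Int.cast_mul]
    ring
  have h4 : ∑ σ : Equiv.Perm (Fin (k + l)), (Equiv.Perm.sign σ : ℝ) *
      (eForm a (fun i => v (σ (Fin.castAdd l i))) * eForm b (fun j => v (σ (Fin.natAdd k j))))
      = ∑ π : Equiv.Perm (Fin k), ∑ ρ : Equiv.Perm (Fin l), eForm (Fin.append a b) v := by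
    rw [Finset.sum_congr rfl fun π _ => Finset.sum_congr rfl fun ρ _ => (h π ρ).symm,
      Finset.sum_congr rfl fun π _ => Finset.sum_comm, Finset.sum_comm]
    refine Finset.sum_congr rfl fun σ _ => ?_
    rw [eForm_eq_sum, eForm_eq_sum, Finset.sum_mul_sum, Finset.mul_sum]
    exact Finset.sum_congr rfl fun π _ => by rw [Finset.mul_sum]
  rw [wedge, h4]
  simp only [Finset.sum_const, Finset.card_univ, Fintype.card_perm, Fintype.card_fin, nsmul_eq_mul]
  have := Nat.factorial_ne_zero k
  have := Nat.factorial_ne_zero l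
  field_simp

/-- The components of `e^j ∧ e^k ∧ e^l ∧ e^{abcf}` with vertical `j, k, l` and horizontal
`a, b, c, e`. -/
theorem eForm_eVec_blocks (j k l : Fin 3) (a b c f : Fin 4) :
    eForm (Fin.append ![Fin.castAdd 4 j, Fin.natAdd 3 a, Fin.natAdd 3 b]
      ![Fin.castAdd 4 k, Fin.castAdd 4 l, Fin.natAdd 3 c, Fin.natAdd 3 f]) eVec
      = ((1 : Matrix (Fin 3) (Fin 3) ℝ).submatrix id ![j, k, l]).det
        * ((1 : Matrix (Fin 4) (Fin 4) ℝ).submatrix id ![a, b, c, f]).det := by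
  -- Moves the two vertical indices k, l in front of the two horizontal indices a, b. This is even,
  -- and the matrix becomes block diagonal.
  let σ : Equiv.Perm (Fin 7) := ⟨![0, 3, 4, 1, 2, 5, 6], ![0, 3, 4, 1, 2, 5, 6],
    by decide, by decide⟩
  let e : Fin 3 ⊕ Fin 4 ≃ Fin 7 := finSumFinEquiv
  obtain ⟨idx, hidx⟩ : ∃ idx : Fin 7 → Fin 7, idx
    = Fin.append ![Fin.castAdd 4 j, Fin.natAdd 3 a, Fin.natAdd 3 b]
      ![Fin.castAdd 4 k, Fin.castAdd 4 l, Fin.natAdd 3 c, Fin.natAdd 3 f] := ⟨_, rfl⟩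
  have hl : ∀ n, idx (σ (e (Sum.inl n))) = Fin.castAdd 4 (![j, k, l] n) := by
    intro n
    rw [hidx]
    fin_cases n <;> rfl
  have hr : ∀ n, idx (σ (e (Sum.inr n))) = Fin.natAdd 3 (![a, b, c, f] n) := by
    intro n
    rw [hidx]
    fin_cases n <;> rfl
  have hs : Equiv.Perm.sign σ = 1 := by decide
  have hd := Matrix.det_permute' σ (Matrix.of fun n m => eDual (idx m) (eVec n))
  rw [hs, Units.val_one, Int.cast_one, one_mul, ← Matrix.det_submatrix_equiv_self e] at hd
  rw [eForm_apply, ← hidx]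
  refine hd.symm.trans ?_
  rw [← Matrix.det_fromBlocks_zero₂₁ _ 0]
  congr 1
  refine Matrix.ext fun n m => ?_
  rcases n with n | n <;> rcases m with m | m <;>
    simp only [Matrix.submatrix_apply, Matrix.of_apply, id_eq, hl, hr, eDual_eVec,
      Matrix.fromBlocks_apply₁₁, Matrix.fromBlocks_apply₁₂, Matrix.fromBlocks_apply₂₁,
      Matrix.fromBlocks_apply₂₂, Matrix.one_apply, Matrix.zero_apply]
  · change (if Fin.castAdd 4 (![j, k, l] m) = Fin.castAdd 4 n then (1 : ℝ) else 0) = _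
    simp only [Fin.castAdd_inj, eq_comm]
  · change (if Fin.natAdd 3 (![a, b, c, f] m) = Fin.castAdd 4 n then (1 : ℝ) else 0) = _
    rw [if_neg]
    intro h
    have := congrArg Fin.val h
    simp at this
    omega
  · change (if Fin.castAdd 4 (![j, k, l] m) = Fin.natAdd 3 n then (1 : ℝ) else 0) = _
    rw [if_neg]
    intro h
    have := congrArg Fin.val h
    simp at this
    omega
  · change (if Fin.natAdd 3 (![a, b, c, f] m) = Fin.natAdd 3 n then (1 : ℝ) else 0) = _
    simp only [Fin.natAdd_inj, eq_comm]

theorem det_fin_four {R : Type*} [CommRing R] (A : Matrix (Fin 4) (Fin 4) R) : A.det =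
    A 0 0 * (A 1 1 * (A 2 2 * A 3 3 - A 2 3 * A 3 2) - A 1 2 * (A 2 1 * A 3 3 - A 2 3 * A 3 1)
      + A 1 3 * (A 2 1 * A 3 2 - A 2 2 * A 3 1))
    - A 0 1 * (A 1 0 * (A 2 2 * A 3 3 - A 2 3 * A 3 2) - A 1 2 * (A 2 0 * A 3 3 - A 2 3 * A 3 0)
      + A 1 3 * (A 2 0 * A 3 2 - A 2 2 * A 3 0))
    + A 0 2 * (A 1 0 * (A 2 1 * A 3 3 - A 2 3 * A 3 1) - A 1 1 * (A 2 0 * A 3 3 - A 2 3 * A 3 0)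
      + A 1 3 * (A 2 0 * A 3 1 - A 2 1 * A 3 0))
    - A 0 3 * (A 1 0 * (A 2 1 * A 3 2 - A 2 2 * A 3 1) - A 1 1 * (A 2 0 * A 3 2 - A 2 2 * A 3 0)
      + A 1 2 * (A 2 0 * A 3 1 - A 2 1 * A 3 0)) := by
  rw [Matrix.det_succ_row_zero, Fin.sum_univ_four]
  simp only [Matrix.det_fin_three, Matrix.submatrix_apply]
  simp [Fin.succAbove]
  ring

theorem wedge_eOmega_eeOmega (j i k l i' : Fin 3) :
    wedge (eOmega (Fin.castAdd 4 j) i) (eeOmega (Fin.castAdd 4 k) (Fin.castAdd 4 l) i') eVec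
      = ((1 : Matrix (Fin 3) (Fin 3) ℝ).submatrix id ![j, k, l]).det * if i = i' then 2 else 0 := by
  obtain ⟨z, hz⟩ : ∃ z : Fin 4 → Fin 7, z = Fin.natAdd 3 := ⟨_, rfl⟩
  have h : ∀ a b c f : Fin 4, wedge (eForm ![Fin.castAdd 4 j, z a, z b])
      (eForm ![Fin.castAdd 4 k, Fin.castAdd 4 l, z c, z f]) eVec
      = ((1 : Matrix (Fin 3) (Fin 3) ℝ).submatrix id ![j, k, l]).det
        * ((1 : Matrix (Fin 4) (Fin 4) ℝ).submatrix id ![a, b, c, f]).det := fun a b c f => by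
    rw [wedge_eForm, hz]
    exact eForm_eVec_blocks j k l a b c f
  have h1 : eOmega (Fin.castAdd 4 j) = ![
      eForm ![Fin.castAdd 4 j, z 0, z 3] + eForm ![Fin.castAdd 4 j, z 1, z 2],
      eForm ![Fin.castAdd 4 j, z 0, z 2] - eForm ![Fin.castAdd 4 j, z 1, z 3],
      eForm ![Fin.castAdd 4 j, z 0, z 1] + eForm ![Fin.castAdd 4 j, z 2, z 3]] := by
    rw [hz]; rfl
  have h2 : eeOmega (Fin.castAdd 4 k) (Fin.castAdd 4 l) = ![
      eForm ![Fin.castAdd 4 k, Fin.castAdd 4 l, z 0, z 3]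
        + eForm ![Fin.castAdd 4 k, Fin.castAdd 4 l, z 1, z 2],
      eForm ![Fin.castAdd 4 k, Fin.castAdd 4 l, z 0, z 2]
        - eForm ![Fin.castAdd 4 k, Fin.castAdd 4 l, z 1, z 3],
      eForm ![Fin.castAdd 4 k, Fin.castAdd 4 l, z 0, z 1]
        + eForm ![Fin.castAdd 4 k, Fin.castAdd 4 l, z 2, z 3]] := by
    rw [hz]; rfl
  rw [h1, h2]
  clear h1 h2 hz
  fin_cases i <;> fin_cases i' <;>
    simp only [Fin.zero_eta, Fin.mk_one, Fin.reduceFinMk, Matrix.cons_val, wedge_add_left,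
      wedge_add_right, wedge_sub_left,
      wedge_sub_right, h, det_fin_four] <;>
    simp [Matrix.one_apply] <;> ring

theorem eForm_eq_zero_of_eq {k : ℕ} (c : Fin k → Fin 7) (v : Fin k → HH) (i j : Fin k) (hij : i ≠ j)
    (h : c i = c j) : eForm c v = 0 := by
  rw [eForm_apply]
  exact Matrix.det_zero_of_column_eq hij fun n => by rw [Matrix.of_apply, Matrix.of_apply, h]

theorem wedge_vertical_eeOmega (k l i : Fin 3) :
    wedge (eForm ![0, 1, 2]) (eeOmega (Fin.castAdd 4 k) (Fin.castAdd 4 l) i) eVec = 0 := by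
  have h : ∀ c f : Fin 7, wedge (eForm ![0, 1, 2])
      (eForm ![Fin.castAdd 4 k, Fin.castAdd 4 l, c, f]) eVec = 0 := by
    intro c f
    rw [wedge_eForm]
    refine eForm_eq_zero_of_eq _ _ (Fin.castAdd 4 k) 3 (Fin.ne_of_lt ?_) ?_
    · exact k.2
    · rw [Fin.append_left]
      fin_cases k <;> rfl
  fin_cases i <;> simp [eeOmega, wedge_add_right, wedge_sub_right, h]

theorem wedge_eOmega_horizontal (j i : Fin 3) :
    wedge (eOmega (Fin.castAdd 4 j) i) (eForm ![3, 4, 5, 6]) eVec = 0 := by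
  have h : ∀ c : Fin 4, ∀ f, wedge (eForm ![Fin.castAdd 4 j, Fin.natAdd 3 c, f])
      (eForm ![3, 4, 5, 6]) eVec = 0 := by
    intro c f
    rw [wedge_eForm]
    refine eForm_eq_zero_of_eq _ _ 1 (Fin.natAdd 3 c) (Fin.ne_of_lt ?_) ?_
    · change 1 < 3 + c.val
      omega
    · rw [Fin.append_right]
      fin_cases c <;> rfl
  have h3 : ∀ f, wedge (eForm ![Fin.castAdd 4 j, 3, f]) (eForm ![3, 4, 5, 6]) eVec = 0 := h 0
  have h4 : ∀ f, wedge (eForm ![Fin.castAdd 4 j, 4, f]) (eForm ![3, 4, 5, 6]) eVec = 0 := h 1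
  have h5 : ∀ f, wedge (eForm ![Fin.castAdd 4 j, 5, f]) (eForm ![3, 4, 5, 6]) eVec = 0 := h 2
  fin_cases i <;> simp [eOmega, wedge_add_left, wedge_sub_left]
  · rw [h3, h4, add_zero]
  · rw [h3, h4, sub_zero]
  · rw [h3, h5, add_zero]

theorem wedge_vertical_horizontal : wedge (eForm ![0, 1, 2]) (eForm ![3, 4, 5, 6]) eVec = 1 := by
  have h : Fin.append ![0, 1, 2] ![3, 4, 5, 6] = (id : Fin 7 → Fin 7) := by decide
  rw [wedge_eForm, eForm_apply]
  refine Eq.trans (congrArg Matrix.det (Matrix.ext fun n m => ?_)) Matrix.det_one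
  rw [Matrix.of_apply, show Fin.append ![0, 1, 2] ![3, 4, 5, 6] m = m from congrFun h m, eDual_eVec,
    Matrix.one_apply]
  exact if_congr eq_comm rfl rfl

theorem wedge_formAt_fourAt (c s : ℝ) (C B : Matrix (Fin 3) (Fin 3) ℝ) :
    wedge (formAt c C) (fourAt s B) eVec = c * s + 2 * ∑ i, ∑ j, C i j * B i j := by
  have h : ∀ j i i' l : Fin 3, wedge (eOmega (Fin.castAdd 4 j) i)
      (eeOmega (Fin.castAdd 4 (l + 1)) (Fin.castAdd 4 (l + 2)) i') eVec
      = if j = l ∧ i = i' then 2 else 0 := by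
    intro j i i' l
    have h1 : ((1 : Matrix (Fin 3) (Fin 3) ℝ).submatrix id ![j, l + 1, l + 2]).det
        = if j = l then 1 else 0 := by
      rw [Matrix.det_fin_three]
      fin_cases j <;> fin_cases l <;> simp [Matrix.one_apply]
    rw [wedge_eOmega_eeOmega, h1, ite_and]
    split_ifs <;> simp
  simp only [formAt, fourAt, wedge_add_left, wedge_add_right, wedge_smul_left, wedge_smul_right,
    wedge_sum_left, wedge_sum_right, wedge_vertical_eeOmega, wedge_eOmega_horizontal,
    wedge_vertical_horizontal, h]
  simp only [Fin.sum_univ_three]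
  simp
  ring

/-- One value of φ ∧ dφ at the base point is enough to exclude purely coclosed structures. -/
theorem wedge_d_formAt (c : ℝ) (C : Matrix (Fin 3) (Fin 3) ℝ) :
    wedge (invForm (formAt c C) o) (d (invForm (formAt c C)) o) (frame o)
      = 2 * (2 * c * ∑ j, eps j * C j j) + 4 * (∑ j, eps j * C j j) ^ 2
        - 4 * ∑ i, ∑ j, C i j ^ 2 - 4 * ∑ i, ∑ j, eps i * eps j * C i j * C j i := by
  have h := wedge_formAt_fourAt c (2 * ∑ j, eps j * C j j) C (Matrix.of fun i l =>
    eps i * ((if i = l then c + 2 * ∑ j, eps j * C j j else 0)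
      - 2 * (eps i * C i l) - 2 * (eps l * C l i)))
  rw [d_formAt, wedge_invForm]
  simp only [frame, act_inv_act]
  rw [h]
  simp only [Fin.sum_univ_three]
  simp [eps]
  ring

/-! ### The torsion of `φ_{(r, h)}` -/

theorem S3.sum_sq (h : S3) : (h : EuclideanSpace ℝ (Fin 4)) 0 ^ 2
    + (h : EuclideanSpace ℝ (Fin 4)) 1 ^ 2 + (h : EuclideanSpace ℝ (Fin 4)) 2 ^ 2
    + (h : EuclideanSpace ℝ (Fin 4)) 3 ^ 2 = 1 := by
  have h1 : ‖(h : EuclideanSpace ℝ (Fin 4))‖ = 1 := mem_sphere_zero_iff_norm.1 h.2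
  rw [← Fin.sum_univ_four fun i => (h : EuclideanSpace ℝ (Fin 4)) i ^ 2,
    ← EuclideanSpace.real_norm_sq_eq, h1, one_pow]

theorem Upsilon_mem (h : S3) : Upsilon h ∈ Matrix.specialOrthogonalGroup (Fin 3) ℝ := by
  have hq := h.sum_sq
  rw [Matrix.mem_specialOrthogonalGroup_iff, Matrix.mem_orthogonalGroup_iff]
  dsimp only [Upsilon]
  generalize (h : EuclideanSpace ℝ (Fin 4)) 0 = a at *
  generalize (h : EuclideanSpace ℝ (Fin 4)) 1 = b at *
  generalize (h : EuclideanSpace ℝ (Fin 4)) 2 = c at *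
  generalize (h : EuclideanSpace ℝ (Fin 4)) 3 = e at *
  constructor
  · refine Matrix.ext fun i j => ?_
    rw [Matrix.mul_apply, Fin.sum_univ_three]
    fin_cases i <;> fin_cases j <;> simp <;> first
      | ring1
      | linear_combination (a ^ 2 + b ^ 2 + c ^ 2 + e ^ 2 + 1) * hq
  · rw [Matrix.det_fin_three]
    simp
    linear_combination ((a ^ 2 + b ^ 2 + c ^ 2 + e ^ 2) ^ 2 + (a ^ 2 + b ^ 2 + c ^ 2 + e ^ 2) + 1)
      * hq

theorem phi_eq (r : ℝ) (h : S3) : phi r h = invForm (formAt (r ^ 3) (Upsilon h)) := by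
  have h1 : IsUnit (Upsilon h).det := by
    rw [(Matrix.mem_specialOrthogonalGroup_iff.1 (Upsilon_mem h)).2]
    exact isUnit_one
  rw [phi, Phi, PhiAt_eq_formAt, Matrix.nonsing_inv_nonsing_inv _ h1]

/-- Since diag(−1, 1, −1) = Υ(j), the vector ν is the axial vector of Υ(jh), where jh = −h₂ + h₃i +
h₀j − h₁k. For Υ(q) the axial vector is 4q₀ Im q, and the trace is 4q₀² − 1, which explains
`trace_Upsilon`. -/
theorem nu_Upsilon (h : S3) : nu (Upsilon h) = fun m => 4 * (h : EuclideanSpace ℝ (Fin 4)) 2 *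
    ![-(h : EuclideanSpace ℝ (Fin 4)) 3, -(h : EuclideanSpace ℝ (Fin 4)) 0,
      (h : EuclideanSpace ℝ (Fin 4)) 1] m := by
  funext m
  fin_cases m <;> simp [nu, Upsilon, eps] <;> ring

theorem trace_Upsilon (h : S3) :
    ∑ j, eps j * Upsilon h j j = 4 * (h : EuclideanSpace ℝ (Fin 4)) 2 ^ 2 - 1 := by
  have hq := h.sum_sq
  rw [Fin.sum_univ_three]
  simp [Upsilon, eps]
  linear_combination -hq

/-- The rotation Υ(j)Υ(h) fixes its axis; multiply by Υ(j), which is its own inverse. -/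
theorem Upsilon_mulVec_nu (h : S3) (i : Fin 3) :
    ∑ l, Upsilon h i l * nu (Upsilon h) l = eps i * nu (Upsilon h) i := by
  have hq := h.sum_sq
  rw [nu_Upsilon, Fin.sum_univ_three]
  dsimp only [Upsilon]
  generalize (h : EuclideanSpace ℝ (Fin 4)) 0 = a at *
  generalize (h : EuclideanSpace ℝ (Fin 4)) 1 = b at *
  generalize (h : EuclideanSpace ℝ (Fin 4)) 2 = c at *
  generalize (h : EuclideanSpace ℝ (Fin 4)) 3 = e at *
  fin_cases i <;> simp [eps]
  · linear_combination (4 * c * e) * hq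
  · linear_combination (-4 * c * a) * hq
  · linear_combination (-4 * c * b) * hq

theorem isPole_iff (h : S3) : IsPole h ↔ (h : EuclideanSpace ℝ (Fin 4)) 0 = 0 ∧
    (h : EuclideanSpace ℝ (Fin 4)) 1 = 0 ∧ (h : EuclideanSpace ℝ (Fin 4)) 3 = 0 := by
  constructor
  · rintro (h1 | h1) <;> simp [h1]
  · rintro ⟨h0, h1, h3⟩
    have hq := h.sum_sq
    rw [h0, h1, h3] at hq
    have h2 : ((h : EuclideanSpace ℝ (Fin 4)) 2) ^ 2 = 1 := by linarith
    rcases mul_self_eq_one_iff.1 ((sq _).symm.trans h2) with h2 | h2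
    · left
      ext i
      fin_cases i <;> simp [h0, h1, h2, h3]
    · right
      ext i
      fin_cases i <;> simp [h0, h1, h2, h3]

theorem nu_Upsilon_eq_zero_iff (h : S3) : nu (Upsilon h) = 0 ↔ OnEquator h ∨ IsPole h := by
  rw [nu_Upsilon, isPole_iff, OnEquator, funext_iff, Fin.forall_fin_succ, Fin.forall_fin_two]
  simp
  tauto

theorem coclosed_phi_iff {r : ℝ} (hr : 0 < r) (h : S3) :
    Coclosed (phi r h) ↔ OnEquator h ∨ IsPole h := by
  rw [phi_eq, coclosed_formAt_iff hr (Upsilon_mem h), nu_Upsilon_eq_zero_iff]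

theorem IsPole.sq_eq_one {h : S3} (hp : IsPole h) : (h : EuclideanSpace ℝ (Fin 4)) 2 ^ 2 = 1 := by
  rcases hp with h1 | h1 <;> simp [h1]

theorem locallyConformallyCoclosed_phi_iff {r : ℝ} (hr : 0 < r) (h : S3) :
    LocallyConformallyCoclosed (phi r h) ↔ r = 1 ∨ Coclosed (phi r h) := by
  rw [phi_eq]
  exact locallyConformallyCoclosed_formAt_iff hr (Upsilon_mem h) (Upsilon_mulVec_nu h)

theorem eps_mul_eq_of_nu {C : Matrix (Fin 3) (Fin 3) ℝ} (h : nu C = 0) (i l : Fin 3) :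
    eps i * C i l = eps l * C l i := by
  have h0 := congrFun h 0
  have h1 := congrFun h 1
  have h2 := congrFun h 2
  simp [nu] at h0 h1 h2
  fin_cases i <;> fin_cases l <;> simp <;> linarith

theorem nearlyParallel_phi_iff {r : ℝ} (hr : 0 < r) (h : S3) : NearlyParallel (phi r h) ↔
    (r ^ 3 = 2 ∧ OnEquator h) ∨ (r ^ 3 = 2 / 5 ∧ IsPole h) := by
  rw [phi_eq, nearlyParallel_formAt_iff hr (Upsilon_mem h), trace_Upsilon, nu_Upsilon_eq_zero_iff]
  have htr := trace_Upsilon h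
  rw [Fin.sum_univ_three] at htr
  constructor
  · rintro ⟨hc, τ₀, -, h1, h2⟩
    have a0 := h2 0 0
    have a1 := h2 1 1
    have a2 := h2 2 2
    simp only [if_true] at a0 a1 a2
    obtain ⟨c, hc2⟩ : ∃ c, c = (h : EuclideanSpace ℝ (Fin 4)) 2 := ⟨_, rfl⟩
    rw [← hc2] at htr a0 a1 a2 h1
    -- With t = 4c² − 1 and τ₀ = 2tr² this is the trace of (r³ + 2t)·1 − 4EC = τ₀r EC. The trace
    -- decides r because t = −1 or 3 is known from coclosedness.
    have h4 : 3 * (r ^ 3 + 2 * (4 * c ^ 2 - 1)) - 4 * (4 * c ^ 2 - 1)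
        = 2 * (4 * c ^ 2 - 1) * r ^ 3 * (4 * c ^ 2 - 1) := by
      have e0 := eps_mul_self 0
      have e1 := eps_mul_self 1
      have e2 := eps_mul_self 2
      have hτ : τ₀ = 2 * (4 * c ^ 2 - 1) * r ^ 2 := by field_simp at h1; linarith
      rw [hτ] at a0 a1 a2
      simp [eps] at a0 a1 a2 htr
      linear_combination a1 - a0 - a2 + (4 + 2 * (4 * c ^ 2 - 1) * r ^ 3) * htr
    rcases hc with hc | hc
    · left
      have hc0 : c = 0 := hc2.trans hc
      rw [hc0] at h4
      exact ⟨by linarith, hc⟩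
    · right
      have hc0 : c ^ 2 = 1 := by rw [hc2]; exact hc.sq_eq_one
      rw [hc0] at h4
      exact ⟨by linarith, hc⟩
  · rintro (⟨h3, hc⟩ | ⟨h3, hc⟩)
    -- τ₀ = 2tr² with t = −1. For r³ = 2 both r³ + 2t and 4 + 2tr³ vanish, so EC drops out of the
    -- equation.
    · refine ⟨Or.inl hc, -2 * r ^ 2, by simp [hr.ne'], ?_, fun i l => ?_⟩
      · rw [hc]
        field_simp
        norm_num
      · have hν := eps_mul_eq_of_nu ((nu_Upsilon_eq_zero_iff h).2 (Or.inl hc)) i l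
        have := eps_mul_self i
        rw [← hν, hc, h3]
        have h5 : (if i = l then (2 : ℝ) + 2 * (4 * 0 ^ 2 - 1) else 0) = 0 := by
          split_ifs <;> norm_num
        rw [h5]
        linear_combination -4 * Upsilon h i l * this + 2 * Upsilon h i l * h3
    -- τ₀ = 2tr² with t = 3. Here EC = 1, and a single scalar equation remains.
    · refine ⟨Or.inr hc, 6 * r ^ 2, by simp [hr.ne'], ?_, fun i l => ?_⟩
      · rw [hc.sq_eq_one]
        field_simp
        norm_num
      · have hν := eps_mul_eq_of_nu ((nu_Upsilon_eq_zero_iff h).2 (Or.inr hc)) i l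
        have h6 := eps_mul_self i
        have h7 : eps i * Upsilon h i l = if i = l then 1 else 0 := by
          obtain ⟨b0, b1, b3⟩ := (isPole_iff h).1 hc
          have b2 := hc.sq_eq_one
          fin_cases i <;> fin_cases l <;> simp [Upsilon, eps, b0, b1, b2, b3]
        rw [← hν, hc.sq_eq_one, h3, h7]
        split_ifs with hil
        · rw [if_pos hil] at h7
          have h8 : Upsilon h i l = eps i := by
            linear_combination eps i * h7 - Upsilon h i l * h6
          rw [h8]
          linear_combination -6 * eps i * h3
        · rw [if_neg hil] at h7
          have h8 : Upsilon h i l = 0 := by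
            linear_combination eps i * h7 - Upsilon h i l * h6
          rw [h8]
          ring

/-- When ν = 0 the matrix EC is symmetric, so both double sums in `wedge_d_formAt` equal 3 and the
value is 4r³t + 4t² − 24: this is −4r³ − 20 < 0 on the equator and 12r³ + 12 > 0 at the poles. -/
theorem not_purelyCoclosed_phi {r : ℝ} (hr : 0 < r) (h : S3) : ¬ PurelyCoclosed (phi r h) := by
  rintro ⟨hc, hw⟩
  rw [coclosed_phi_iff hr] at hc
  have hν := (nu_Upsilon_eq_zero_iff h).2 hc
  have h1 := hw o (frame o)
  rw [phi_eq, wedge_d_formAt, trace_Upsilon] at h1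
  have h2 : ∑ i, ∑ j, Upsilon h i j ^ 2 = 3 := by
    have h3 : ∀ i, ∑ j, Upsilon h i j ^ 2 = 1 := by
      intro i
      have h4 : Upsilon h * (Upsilon h).transpose = 1 :=
        (Matrix.mem_orthogonalGroup_iff _ _).1
          (Matrix.mem_specialOrthogonalGroup_iff.1 (Upsilon_mem h)).1
      have h5 := congrFun (congrFun h4 i) i
      rw [Matrix.mul_apply, Matrix.one_apply_eq] at h5
      rw [← h5]
      exact Finset.sum_congr rfl fun j _ => sq _
    simp [h3]
  have h3 : ∑ i, ∑ j, eps i * eps j * Upsilon h i j * Upsilon h j i = 3 := by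
    rw [← h2]
    refine Finset.sum_congr rfl fun i _ => Finset.sum_congr rfl fun j _ => ?_
    have h4 := eps_mul_eq_of_nu hν i j
    have h5 := eps_mul_self i
    linear_combination (-eps i * Upsilon h i j) * h4 + Upsilon h i j ^ 2 * h5
  rw [h2, h3] at h1
  have h4 : 0 < r ^ 3 := by positivity
  rcases hc with hc | hc
  · rw [hc] at h1
    nlinarith
  · rw [hc.sq_eq_one] at h1
    nlinarith

/-! ### The double cover `S³ → SO(3)` -/

theorem eq_or_eq_neg_of_mul_eq {ι : Type*} {p q : ι → ℝ} (h : ∀ a b, p a * p b = q a * q b) :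
    p = q ∨ p = -q := by
  by_cases hp : p = 0
  · left
    rw [hp]
    funext a
    have := h a a
    rw [hp] at this
    exact (show q a = 0 by simpa using this.symm).symm
  · obtain ⟨a, ha⟩ := Function.ne_iff.1 hp
    have ha : p a ≠ 0 := ha
    rcases mul_self_eq_mul_self_iff.1 (h a a) with h1 | h1
    · left
      funext b
      have := h a b
      rw [← h1] at this
      exact mul_left_cancel₀ ha this
    · right
      funext b
      have := h a b
      rw [show q a = -p a by rw [h1, neg_neg], neg_mul, ← mul_neg] at this
      exact mul_left_cancel₀ ha this

/-- The matrix `q qᵀ` of the unit quaternion `q` with `Υ(q) = C`. -/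
def quatProd (C : Matrix (Fin 3) (Fin 3) ℝ) : Matrix (Fin 4) (Fin 4) ℝ :=
  (4 : ℝ)⁻¹ • !![1 + C 0 0 + C 1 1 + C 2 2, C 2 1 - C 1 2, C 0 2 - C 2 0, C 1 0 - C 0 1;
    C 2 1 - C 1 2, 1 + C 0 0 - C 1 1 - C 2 2, C 0 1 + C 1 0, C 0 2 + C 2 0;
    C 0 2 - C 2 0, C 0 1 + C 1 0, 1 - C 0 0 + C 1 1 - C 2 2, C 1 2 + C 2 1;
    C 1 0 - C 0 1, C 0 2 + C 2 0, C 1 2 + C 2 1, 1 - C 0 0 - C 1 1 + C 2 2]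

theorem quatProd_Upsilon (h : S3) (a b : Fin 4) : quatProd (Upsilon h) a b
    = (h : EuclideanSpace ℝ (Fin 4)) a * (h : EuclideanSpace ℝ (Fin 4)) b := by
  have hq := h.sum_sq
  fin_cases a <;> fin_cases b <;> simp [quatProd, Upsilon] <;> first
    | ring1
    | linear_combination -(1 / 4) * hq

theorem Upsilon_eq_iff (h h' : S3) : Upsilon h = Upsilon h' ↔ h = h' ∨ h = -h' := by
  constructor
  · intro hU
    have h1 := eq_or_eq_neg_of_mul_eq (p := fun a => (h : EuclideanSpace ℝ (Fin 4)) a)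
      (q := fun a => (h' : EuclideanSpace ℝ (Fin 4)) a) fun a b => by
        rw [← quatProd_Upsilon, hU, quatProd_Upsilon]
    rcases h1 with h1 | h1
    · left
      ext a
      exact congrFun h1 a
    · right
      ext a
      exact congrFun h1 a
  · rintro (rfl | rfl)
    · rfl
    · refine Matrix.ext fun i j => ?_
      fin_cases i <;> fin_cases j <;> simp [Upsilon]

/-- For a rotation C the symmetric matrix `quatProd C` has rank one. Its quadratic relations follow
linearly from the orthogonality relations and the cofactor identities. -/
theorem quatProd_mul {C : Matrix (Fin 3) (Fin 3) ℝ}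
    (hC : C ∈ Matrix.specialOrthogonalGroup (Fin 3) ℝ) (a b c : Fin 4) :
    quatProd C a b * quatProd C a c = quatProd C a a * quatProd C b c := by
  have hcof := cofactor_eq hC
  have f00 := hcof 0 0
  have f01 := hcof 0 1
  have f02 := hcof 0 2
  have f10 := hcof 1 0
  have f11 := hcof 1 1
  have f12 := hcof 1 2
  have f20 := hcof 2 0
  have f21 := hcof 2 1
  have f22 := hcof 2 2
  have hO := (Matrix.mem_specialOrthogonalGroup_iff.1 hC).1
  have hr : ∀ i j, C i 0 * C j 0 + C i 1 * C j 1 + C i 2 * C j 2 = if i = j then 1 else 0 := by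
    intro i j
    rw [← Matrix.one_apply, ← (Matrix.mem_orthogonalGroup_iff _ _).1 hO, Matrix.mul_apply,
      Fin.sum_univ_three]
    rfl
  have hc : ∀ i j, C 0 i * C 0 j + C 1 i * C 1 j + C 2 i * C 2 j = if i = j then 1 else 0 := by
    intro i j
    rw [← Matrix.one_apply, ← (Matrix.mem_orthogonalGroup_iff' _ _).1 hO, Matrix.mul_apply,
      Fin.sum_univ_three]
    rfl
  have r00 := hr 0 0
  have r01 := hr 0 1
  have r02 := hr 0 2
  have r11 := hr 1 1
  have r12 := hr 1 2
  have r22 := hr 2 2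
  have c00 := hc 0 0
  have c01 := hc 0 1
  have c02 := hc 0 2
  have c11 := hc 1 1
  have c12 := hc 1 2
  have c22 := hc 2 2
  simp at f00 f01 f02 f10 f11 f12 f20 f21 f22 r00 r01 r02 r11 r12 r22 c00 c01 c02 c11 c12 c22
  clear hr hc hcof hO hC
  fin_cases a <;> fin_cases b <;> fin_cases c <;> simp [quatProd] <;> first
    | ring1
    | linarith

theorem exists_Upsilon_eq {C : Matrix (Fin 3) (Fin 3) ℝ}
    (hC : C ∈ Matrix.specialOrthogonalGroup (Fin 3) ℝ) : ∃ h : S3, Upsilon h = C := by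
  have hP := quatProd_mul hC
  have htr : quatProd C 0 0 + quatProd C 1 1 + quatProd C 2 2 + quatProd C 3 3 = 1 := by
    simp [quatProd]; ring
  -- Trace 1 gives a positive diagonal entry; the corresponding row divided by its square root is
  -- the unit quaternion, whose norm is again the trace.
  obtain ⟨a, ha⟩ : ∃ a, 0 < quatProd C a a := by
    by_contra! h
    linarith [h 0, h 1, h 2, h 3]
  obtain ⟨q, hq⟩ : ∃ q : EuclideanSpace ℝ (Fin 4), ∀ b c, q b * q c = quatProd C b c := by
    refine ⟨WithLp.toLp 2 fun b => quatProd C a b / √(quatProd C a a), fun b c => ?_⟩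
    have h1 : √(quatProd C a a) ≠ 0 := (Real.sqrt_pos.2 ha).ne'
    change quatProd C a b / _ * (quatProd C a c / _) = _
    rw [div_mul_div_comm, Real.mul_self_sqrt ha.le, hP, mul_div_cancel_left₀ _ ha.ne']
  have hn : ‖q‖ = 1 := by
    rw [← sq_eq_sq₀ (norm_nonneg _) zero_le_one, EuclideanSpace.real_norm_sq_eq,
      Fin.sum_univ_four, sq, sq, sq, sq, hq, hq, hq, hq, htr, one_pow]
  refine ⟨⟨q, mem_sphere_zero_iff_norm.2 hn⟩, Matrix.ext fun i j => ?_⟩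
  fin_cases i <;> fin_cases j <;>
    simp [Upsilon, sq, hq] <;> simp [quatProd] <;> ring

theorem exists_phi_eq {r : ℝ} {φ : Form 3} (hφ : φ ∈ B r) : ∃ h, phi r h = φ := by
  obtain ⟨C, hC, rfl⟩ := (mem_B_iff φ).1 hφ
  obtain ⟨h, rfl⟩ := exists_Upsilon_eq hC
  exact ⟨h, phi_eq r h⟩

theorem phi_mem_B (r : ℝ) (h : S3) : phi r h ∈ B r :=
  (mem_B_iff _).2 ⟨Upsilon h, Upsilon_mem h, phi_eq r h⟩

theorem phi_eq_iff {r : ℝ} (h h' : S3) : phi r h = phi r h' ↔ h = h' ∨ h = -h' := by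
  rw [← Upsilon_eq_iff, phi_eq, phi_eq]
  refine ⟨fun hh => ?_, fun hh => by rw [hh]⟩
  have h1 := congrFun hh o
  rw [invForm_formAt_o, invForm_formAt_o] at h1
  exact (formAt_injective h1).2

theorem continuous_Upsilon (i j : Fin 3) : Continuous fun h : S3 => Upsilon h i j := by
  fin_cases i <;> fin_cases j <;> simp [Upsilon] <;> fun_prop

theorem continuous_phi (r : ℝ) : Continuous fun h : S3 => phi r h := by
  refine continuous_pi fun x => ?_
  have h1 : ∀ h : S3, phi r h x = r ^ 3 • invForm (eForm ![0, 1, 2]) x + ∑ i : Fin 3, ∑ j : Fin 3,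
      Upsilon h i j • invForm (eOmega (Fin.castAdd 4 j) i) x := by
    intro h
    rw [phi_eq]
    simp only [formAt, invForm_add, invForm_smul, invForm_sum, Pi.add_apply, Pi.smul_apply,
      Finset.sum_apply]
  simp only [h1]
  refine continuous_const.add (continuous_finsetSum _ fun i _ =>
    continuous_finsetSum _ fun j _ => ?_)
  exact (continuous_Upsilon i j).smul continuous_const

/-- The map `ℝP³ → B_r`. -/
def projPhi (r : ℝ) : RP3 → B r :=
  Quotient.lift (fun h => ⟨phi r h, phi_mem_B r h⟩) fun h h' hh =>
    Subtype.ext ((phi_eq_iff h h').2 hh)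

theorem projPhi_bijective (r : ℝ) : Function.Bijective (projPhi r) := by
  constructor
  · rintro ⟨h⟩ ⟨h'⟩ hh
    exact Quotient.sound ((phi_eq_iff h h').1 (congrArg Subtype.val hh))
  · rintro ⟨φ, hφ⟩
    obtain ⟨h, rfl⟩ := exists_phi_eq hφ
    exact ⟨Quotient.mk antipodal h, rfl⟩

theorem continuous_projPhi (r : ℝ) : Continuous (projPhi r) :=
  Continuous.quotient_lift ((continuous_phi r).subtype_mk _) _

/-- A continuous bijection from a compact space to a Hausdorff space; forms carry the topology of
pointwise convergence on S⁷. -/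
theorem exists_homeomorph (r : ℝ) :
    ∃ F : RP3 ≃ₜ B r, ∀ h : S3, (F (Quotient.mk antipodal h) : Form 3) = phi r h :=
  ⟨Continuous.homeoOfEquivCompactToT2 (f := Equiv.ofBijective _ (projPhi_bijective r))
    (continuous_projPhi r), fun _ => rfl⟩

/-! ### The immersion `S³ → B_r` -/

/-- The extension of `Υ` to all quaternions. -/
def rot (q : EuclideanSpace ℝ (Fin 4)) : Matrix (Fin 3) (Fin 3) ℝ :=
  !![q 0 ^ 2 + q 1 ^ 2 - q 2 ^ 2 - q 3 ^ 2, 2 * (q 1 * q 2 - q 0 * q 3),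
      2 * (q 1 * q 3 + q 0 * q 2);
    2 * (q 1 * q 2 + q 0 * q 3), q 0 ^ 2 - q 1 ^ 2 + q 2 ^ 2 - q 3 ^ 2,
      2 * (q 2 * q 3 - q 0 * q 1);
    2 * (q 1 * q 3 - q 0 * q 2), 2 * (q 2 * q 3 + q 0 * q 1),
      q 0 ^ 2 - q 1 ^ 2 - q 2 ^ 2 + q 3 ^ 2]

/-- The derivative of `rot`. -/
def rotDeriv (q v : EuclideanSpace ℝ (Fin 4)) : Matrix (Fin 3) (Fin 3) ℝ :=
  (2 : ℝ) • !![q 0 * v 0 + q 1 * v 1 - q 2 * v 2 - q 3 * v 3,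
      q 1 * v 2 + v 1 * q 2 - q 0 * v 3 - v 0 * q 3, q 1 * v 3 + v 1 * q 3 + q 0 * v 2 + v 0 * q 2;
    q 1 * v 2 + v 1 * q 2 + q 0 * v 3 + v 0 * q 3, q 0 * v 0 - q 1 * v 1 + q 2 * v 2 - q 3 * v 3,
      q 2 * v 3 + v 2 * q 3 - q 0 * v 1 - v 0 * q 1;
    q 1 * v 3 + v 1 * q 3 - q 0 * v 2 - v 0 * q 2, q 2 * v 3 + v 2 * q 3 + q 0 * v 1 + v 0 * q 1,
      q 0 * v 0 - q 1 * v 1 - q 2 * v 2 + q 3 * v 3]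

theorem rot_line (q v : EuclideanSpace ℝ (Fin 4)) (t : ℝ) (i j : Fin 3) :
    rot (q + t • v) i j = rot q i j + t * rotDeriv q v i j + t ^ 2 * rot v i j := by
  fin_cases i <;> fin_cases j <;> simp [rot, rotDeriv] <;> ring

theorem hasDerivAt_rot (q v : EuclideanSpace ℝ (Fin 4)) (i j : Fin 3) :
    HasDerivAt (fun t : ℝ => rot (q + t • v) i j) (rotDeriv q v i j) 0 := by
  simp only [rot_line]
  have h := (((hasDerivAt_id (0 : ℝ)).mul_const (rotDeriv q v i j)).const_add (rot q i j)).add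
    (((hasDerivAt_id (0 : ℝ)).pow 2).mul_const (rot v i j))
  refine (h.congr_deriv (by simp)).congr_of_eventuallyEq (Filter.Eventually.of_forall fun t => ?_)
  simp

theorem eq_zero_of_rotDeriv_eq_zero {q v : EuclideanSpace ℝ (Fin 4)} (hq : ‖q‖ = 1)
    (hv : ⟪q, v⟫ = 0) (h : rotDeriv q v = 0) : v = 0 := by
  have hn : q 0 ^ 2 + q 1 ^ 2 + q 2 ^ 2 + q 3 ^ 2 = 1 := by
    rw [← Fin.sum_univ_four fun i => q i ^ 2, ← EuclideanSpace.real_norm_sq_eq, hq, one_pow]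
  have hv' : q 0 * v 0 + q 1 * v 1 + q 2 * v 2 + q 3 * v 3 = 0 := by
    simpa [PiLp.inner_apply, Fin.sum_univ_four, mul_comm] using hv
  have h' := fun i j => congrFun (congrFun h i) j
  have h00 := h' 0 0
  have h01 := h' 0 1
  have h02 := h' 0 2
  have h10 := h' 1 0
  have h11 := h' 1 1
  have h12 := h' 1 2
  have h20 := h' 2 0
  have h21 := h' 2 1
  have h22 := h' 2 2
  simp [rotDeriv] at h00 h01 h02 h10 h11 h12 h20 h21 h22
  ext b
  -- The derivative of qqᵀ, which is determined by that of Υ together with q · v = 0. Contracting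
  -- with q leaves v.
  have hs : ∀ a, q a * v b + q b * v a = 0 := by
    intro a
    fin_cases a <;> fin_cases b <;> simp only [Fin.zero_eta, Fin.mk_one, Fin.reduceFinMk] <;>
      linarith
  have h0 := hs 0
  have h1 := hs 1
  have h2 := hs 2
  have h3 := hs 3
  rw [PiLp.zero_apply]
  linear_combination q 0 * h0 + q 1 * h1 + q 2 * h2 + q 3 * h3 - q b * hv' - v b * hn

section

variable {F : Type*} [NormedAddCommGroup F] [NormedSpace ℝ F]

theorem contDiff_rot (i j : Fin 3) :
    ContDiff ℝ ∞ fun q : EuclideanSpace ℝ (Fin 4) => rot q i j := by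
  fin_cases i <;> fin_cases j <;>
    simp only [rot, Fin.zero_eta, Fin.mk_one, Fin.reduceFinMk, Matrix.of_apply, Matrix.cons_val] <;>
    fun_prop

theorem contDiff_sum_rot (w : F) (e : Fin 3 → Fin 3 → F) :
    ContDiff ℝ ∞ fun q => w + ∑ i, ∑ j, rot q i j • e i j :=
  contDiff_const.add <| ContDiff.sum fun i _ => ContDiff.sum fun j _ =>
    (contDiff_rot i j).smul contDiff_const

theorem fderiv_sum_rot (w : F) (e : Fin 3 → Fin 3 → F) (q v : EuclideanSpace ℝ (Fin 4)) :
    fderiv ℝ (fun q => w + ∑ i, ∑ j, rot q i j • e i j) q v =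
      ∑ i, ∑ j, rotDeriv q v i j • e i j := by
  rw [← (((contDiff_sum_rot w e).differentiable (by simp)) q).lineDeriv_eq_fderiv]
  exact ((HasDerivAt.fun_sum fun i _ => HasDerivAt.fun_sum fun j _ =>
    (hasDerivAt_rot q v i j).smul_const (e i j)).const_add w).deriv

/-- An immersion of the ambient space along `S³` restricts to an immersion of `S³`. -/
theorem injective_mfderiv_comp_coe {G : EuclideanSpace ℝ (Fin 4) → F} (hG : ContDiff ℝ ∞ G)
    (h : S3) (hker : ∀ v, ⟪(h : EuclideanSpace ℝ (Fin 4)), v⟫ = 0 →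
      fderiv ℝ G h v = 0 → v = 0) :
    Function.Injective (mfderiv (𝓡 3) 𝓘(ℝ, F) (fun h : S3 => G h) h) := by
  have hGd : MDifferentiableAt 𝓘(ℝ, EuclideanSpace ℝ (Fin 4)) 𝓘(ℝ, F) G h :=
    (hG.differentiable (by simp) h).mdifferentiableAt
  have hc : MDifferentiableAt (𝓡 3) 𝓘(ℝ, EuclideanSpace ℝ (Fin 4))
      ((↑) : S3 → EuclideanSpace ℝ (Fin 4)) h :=
    (contMDiff_coe_sphere (m := ∞) h).mdifferentiableAt (by simp)
  have hcomp := mfderiv_comp h hGd hc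
  rw [mfderiv_eq_fderiv] at hcomp
  change Function.Injective (mfderiv (𝓡 3) 𝓘(ℝ, F) (G ∘ ((↑) : S3 → EuclideanSpace ℝ (Fin 4))) h)
  rw [hcomp]
  refine (injective_iff_map_eq_zero (mvfderiv (𝓡 3)
    ((↑) : S3 → EuclideanSpace ℝ (Fin 4)) h : _ →L[ℝ] EuclideanSpace ℝ (Fin 4))).1
    (injective_mvfderiv_subtypeVal_sphere h) |> fun hi => ?_
  refine (injective_iff_map_eq_zero _).2 fun u hu => hi u ?_
  refine hker _ ?_ hu
  have hm : mvfderiv (𝓡 3) ((↑) : S3 → EuclideanSpace ℝ (Fin 4)) h u ∈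
      (ℝ ∙ (h : EuclideanSpace ℝ (Fin 4)))ᗮ := by
    rw [← range_mvfderiv_subtypeVal (n := 3) h]
    exact ⟨u, rfl⟩
  exact Submodule.mem_orthogonal_singleton_iff_inner_right.1 hm

theorem injective_mfderiv_of_eq_sum_rot {f : S3 → F} {w : F} {e : Fin 3 → Fin 3 → F}
    (hf : ∀ h, f h = w + ∑ i, ∑ j, rot h i j • e i j)
    (he : ∀ M : Matrix (Fin 3) (Fin 3) ℝ, ∑ i, ∑ j, M i j • e i j = 0 → M = 0) (h : S3) :
    Function.Injective (mfderiv (𝓡 3) 𝓘(ℝ, F) f h) := by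
  obtain rfl : f = _ := funext hf
  refine injective_mfderiv_comp_coe (contDiff_sum_rot w e) h fun v hv hd => ?_
  rw [fderiv_sum_rot] at hd
  exact eq_zero_of_rotDeriv_eq_zero (mem_sphere_zero_iff_norm.1 h.2) hv (he _ hd)

end

theorem phi_o (r : ℝ) (h : S3) :
    phi r h o = r ^ 3 • eForm ![0, 1, 2] + ∑ i, ∑ j, rot h i j • eOmega (Fin.castAdd 4 j) i := by
  rw [phi_eq, invForm_formAt_o]
  rfl

/-- Evaluation at `o` determines an invariant form, so the map into B_r is differentiated in the
vector space of alternating forms at `o`. -/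
theorem contMDiff_phi_o (r : ℝ) :
    ContMDiff (𝓡 3) 𝓘(ℝ, HH [⋀^Fin 3]→L[ℝ] ℝ) ∞ (fun h : S3 => phi r h o) := by
  simp only [phi_o]
  exact (contDiff_sum_rot (r ^ 3 • eForm ![0, 1, 2])
    fun i j => eOmega (Fin.castAdd 4 j) i).contMDiff.comp contMDiff_coe_sphere

theorem eq_zero_of_sum_smul_eOmega {M : Matrix (Fin 3) (Fin 3) ℝ}
    (h : ∑ i, ∑ j, M i j • eOmega (Fin.castAdd 4 j) i = 0) : M = 0 :=
  (formAt_injective (c := 0) (c' := 0) (by simpa [formAt] using h)).2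

theorem injective_mfderiv_phi_o (r : ℝ) (h : S3) :
    Function.Injective
      (mfderiv (𝓡 3) 𝓘(ℝ, HH [⋀^Fin 3]→L[ℝ] ℝ) (fun h : S3 => phi r h o) h) := by
  refine injective_mfderiv_of_eq_sum_rot (w := r ^ 3 • eForm ![0, 1, 2])
    (e := fun i j => eOmega (Fin.castAdd 4 j) i) (fun h => ?_) (fun M hM => ?_) h
  · exact phi_o r h
  exact eq_zero_of_sum_smul_eOmega hM

end G2Sphere

end

theorem theorem2 :
    -- each `B_r` is a distinct isometric class, the class of the metric `g_r`
    (∀ r : ℝ, 0 < r →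
      B r = {φ | φ ∈ InvG2 ∧ IsMetricOf φ (g r)} ∧ ∀ φ ∈ B r, isometricClass φ = B r) ∧
    (∀ r s : ℝ, 0 < r → 0 < s → r ≠ s → Disjoint (B r) (B s)) ∧
    -- `B_r ≃ ℝP³ = S³ / {±1}` through `h ↦ φ_{(r, h)}`, which is moreover a smooth immersion
    (∀ r : ℝ, 0 < r →
      (∃ F : RP3 ≃ₜ B r, ∀ h : S3, (F (Quotient.mk antipodal h) : Form 3) = phi r h) ∧
      ContMDiff (𝓡 3) 𝓘(ℝ, HH [⋀^Fin 3]→L[ℝ] ℝ) ∞ (fun h : S3 => phi r h o) ∧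
      ∀ h : S3, Function.Injective
        (mfderiv (𝓡 3) 𝓘(ℝ, HH [⋀^Fin 3]→L[ℝ] ℝ) (fun h : S3 => phi r h o) h)) ∧
    -- (i) coclosed
    (∀ r : ℝ, 0 < r → ∀ h : S3, Coclosed (phi r h) ↔ OnEquator h ∨ IsPole h) ∧
    -- (ii) nearly parallel: round and squashed
    (∀ r : ℝ, 0 < r → ∀ h : S3, NearlyParallel (phi r h) ↔
      (r ^ 3 = 2 ∧ OnEquator h) ∨ (r ^ 3 = 2 / 5 ∧ IsPole h)) ∧
    (∀ r : ℝ, 0 < r → (r ^ 3 = 2 → IsRound (g r)) ∧ (r ^ 3 = 2 / 5 → IsSquashed (g r))) ∧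
    -- (iii) locally conformally coclosed
    (∀ r : ℝ, 0 < r → ∀ h : S3, LocallyConformallyCoclosed (phi r h) ↔
      r = 1 ∨ Coclosed (phi r h)) ∧
    -- no purely coclosed structure
    (∀ r : ℝ, 0 < r → ∀ φ ∈ B r, ¬ PurelyCoclosed φ) := by
  refine ⟨fun r hr => ⟨B_eq hr, fun φ hφ => isometricClass_eq hr hφ⟩,
    fun r s hr hs hrs => disjoint_B hr hs hrs,
    fun r _ => ⟨exists_homeomorph r, contMDiff_phi_o r, injective_mfderiv_phi_o r⟩,
    fun r hr h => coclosed_phi_iff hr h, fun r hr h => nearlyParallel_phi_iff hr h,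
    fun r hr => ⟨isRound_g hr, isSquashed_g hr⟩,
    fun r hr h => locallyConformallyCoclosed_phi_iff hr h, fun r hr φ hφ => ?_⟩
  obtain ⟨h, rfl⟩ := exists_phi_eq hφ
  exact not_purelyCoclosed_phi hr h
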